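/- Let $S\subset\mathbb{A}^3$ be the affine surface over $\mathbb{Q}$ with coordinates $(r,t,y)$ and equation $$(1+r-2r^2t-t^2+rt^2)(-1+r+2r^2t+t^2+rt^2)(-r-r^2-2t-rt^2+r^2t^2)(r-r^2-2t+rt^2+r^2t^2)=y^2,$$ and let $\pi:S\to\mathbb{A}^2$, $\pi(r,t,y)=(r,t)$. Let $D_1,D_2,D_3\subset\mathbb{A}^2$ be the plane curves over $\mathbb{Q}$ \begin{align*} D_1&:\ r^2t^2-4r^2t-3r^2-2rt^2-2r-3t^2-4t+1=0,\\ D_2&:\ r^2t-r^2+2rt^2+2r-t-1=0,\\ D_3&:\ r^2t^2+3r^2-t^2+2t-1=0, \end{align*} and let $\widetilde{D_i}=\pi^{-1}(D_i)$ be their pullbacks to $S$. Consider also the curves over $\mathbb{Q}$ $$E_1:\ y^2=x^3-2892x-59024,\qquad E_2:\ y^2=x^3-876x-9520,\qquad E_3:\ y^2+xy+y=x^3-x^2-41x+96.$$ A rational Diophantine quintuple is a set of five distinct nonzero rationals such that the product of any two distinct elements plus $1$ is the square of a rational. A quadruple $\{a,b,c,d\}$ is regular if $(a+b-c-d)^2=4(ab+1)(cd+1)$.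 A rational Diophantine quintuple $\{a,b,c,d,e\}$ is exotic if $abcd=1$, the quadruples $\{a,b,d,e\}$ and $\{a,c,d,e\}$ are regular, and the product of any two distinct elements of the quintuple is the square of a rational. Proposition. For each $i\in\{1,2,3\}$, $D_i$ is an absolutely irreducible curve of geometric genus zero, and $\widetilde{D_i}$ is an absolutely irreducible curve over $\mathbb{Q}$ of geometric genus one; $E_i$ is an elliptic curve, $\widetilde{D_i}$ is birationally equivalent over $\mathbb{Q}$ to $E_i$, and the Mordell--Weil rank of $E_i(\mathbb{Q})$ is at least one. In particular, there are infinitely many exotic rational Diophantine quintuples. -/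

import Mathlib

noncomputable section

open MvPolynomial

/-! ### Affine varieties given by an ideal, and the geometric genus -/

namespace AffineVariety

variable {k : Type} [Field k] {σ : Type}

/-- The coordinate ring `k[x_i : i ∈ σ] / I` of the closed subscheme `V(I)` of affine space. -/
abbrev CoordRing (I : Ideal (MvPolynomial σ k)) : Type := MvPolynomial σ k ⧸ I

/-- The function field of `V(I)` (the total ring of fractions of the coordinate ring, which is a
field as soon as `I` is prime). -/
abbrev FunctionField (I : Ideal (MvPolynomial σ k)) : Type := FractionRing (CoordRing I)

/-- The structure morphism `Spec A ⟶ Spec k` of a `k`-algebra `A`. -/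
def structureMap (k A : Type) [Field k] [CommRing A] [Algebra k A] :
    AlgebraicGeometry.Spec (CommRingCat.of A) ⟶ AlgebraicGeometry.Spec (CommRingCat.of k) :=
  AlgebraicGeometry.Spec.map (CommRingCat.ofHom (algebraMap k A))

/-- `V(I)` is an absolutely irreducible (and reduced) curve over `k`: over an algebraic closure of
`k` its ideal becomes prime, and its function field has transcendence degree one over `k`. -/
def IsCurve (I : Ideal (MvPolynomial σ k)) : Prop :=
  (I.map (MvPolynomial.map (algebraMap k (AlgebraicClosure k)))).IsPrime ∧
    Algebra.trdeg k (FunctionField I) = 1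

/-- `O` is a valuation ring of `K` containing `k`: every element of `K` either lies in `O` or is
invertible with inverse in `O`. (For a field `K`, this says `x ∈ O` or `x⁻¹ ∈ O` for all `x`.) -/
def IsValuationRingOver (k : Type) {K : Type} [Field k] [CommRing K] [Algebra k K]
    (O : Subalgebra k K) : Prop :=
  ∀ x : K, x ∈ O ∨ ∃ y ∈ O, x * y = 1

/-- The differentials of `K / k` that are regular at `O`: the image of `Ω[O⁄k]` in `Ω[K⁄k]`,
that is, the `O`-span of the differentials `dg` with `g ∈ O`. -/
def regularAt (k : Type) {K : Type} [Field k] [CommRing K] [Algebra k K]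
    (O : Subalgebra k K) : Submodule k (Ω[K⁄k]) :=
  (Submodule.span O ((fun g : K => KaehlerDifferential.D k K g) '' (O : Set K))).restrictScalars k

/-- The everywhere regular differentials of a function field `K / k`: those that are regular at
every valuation ring of `K` containing `k`. For a function field of one variable over a field of
characteristic zero, the nontrivial such valuation rings are the local rings of the closed points
of the smooth projective model `X` of `K`, so that this is `H⁰(X, Ω¹)`. -/
def regularDifferentials (k K : Type) [Field k] [CommRing K] [Algebra k K] :
    Submodule k (Ω[K⁄k]) :=
  ⨅ (O : Subalgebra k K) (_ : IsValuationRingOver k O), regularAt k O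

/-- The (geometric) genus of the curve `V(I)`: the dimension of the space of regular differentials
on the smooth projective model of its function field. -/
def genus (I : Ideal (MvPolynomial σ k)) : ℕ :=
  Module.finrank k (regularDifferentials k (FunctionField I))

end AffineVariety

/-! ### The surface `S`, the plane curves `D₁, D₂, D₃`, and the elliptic curves `E₁, E₂, E₃` -/

namespace Exotic

/-- The left-hand side of the equation of `S`, as a polynomial in the coordinates `r, t` of the
plane. -/
def branchPoly : MvPolynomial (Fin 2) ℚ :=
  let r : MvPolynomial (Fin 2) ℚ := X 0
  let t : MvPolynomial (Fin 2) ℚ := X 1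
  (1 + r - 2 * r ^ 2 * t - t ^ 2 + r * t ^ 2) *
    (-1 + r + 2 * r ^ 2 * t + t ^ 2 + r * t ^ 2) *
    (-r - r ^ 2 - 2 * t - r * t ^ 2 + r ^ 2 * t ^ 2) *
    (r - r ^ 2 - 2 * t + r * t ^ 2 + r ^ 2 * t ^ 2)

/-- The comorphism `π^* : ℚ[r, t] → ℚ[r, t, y]` of the projection `π (r, t, y) = (r, t)`. -/
def piStar : MvPolynomial (Fin 2) ℚ →ₐ[ℚ] MvPolynomial (Fin 3) ℚ :=
  aeval ![X 0, X 1]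

/-- The ideal of the affine surface `S` in the affine space with coordinates `(r, t, y)`. -/
def surfaceS : Ideal (MvPolynomial (Fin 3) ℚ) :=
  Ideal.span {piStar branchPoly - X 2 ^ 2}

/-- The polynomials defining the plane curves `D₁, D₂, D₃`. -/
def polyD : Fin 3 → MvPolynomial (Fin 2) ℚ :=
  let r : MvPolynomial (Fin 2) ℚ := X 0
  let t : MvPolynomial (Fin 2) ℚ := X 1
  ![r ^ 2 * t ^ 2 - 4 * r ^ 2 * t - 3 * r ^ 2 - 2 * r * t ^ 2 - 2 * r - 3 * t ^ 2 - 4 * t + 1,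
    r ^ 2 * t - r ^ 2 + 2 * r * t ^ 2 + 2 * r - t - 1,
    r ^ 2 * t ^ 2 + 3 * r ^ 2 - t ^ 2 + 2 * t - 1]

/-- The ideals of the plane curves `D₁, D₂, D₃`. -/
def curveD (i : Fin 3) : Ideal (MvPolynomial (Fin 2) ℚ) :=
  Ideal.span {polyD i}

/-- The ideal of the pullback `π⁻¹(D)` to `S` of the plane subscheme with ideal `J`. -/
def pullback (J : Ideal (MvPolynomial (Fin 2) ℚ)) : Ideal (MvPolynomial (Fin 3) ℚ) :=
  surfaceS ⊔ J.map piStar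

/-- The Weierstrass curves `E₁, E₂, E₃`: `y² = x³ - 2892x - 59024`, `y² = x³ - 876x - 9520` and
`y² + xy + y = x³ - x² - 41x + 96`. -/
def curveE : Fin 3 → WeierstrassCurve ℚ :=
  ![⟨0, 0, 0, -2892, -59024⟩, ⟨0, 0, 0, -876, -9520⟩, ⟨1, -1, 1, -41, 96⟩]

/-! ### Exotic quintuples -/

/-- A rational Diophantine tuple: a finite set of nonzero rationals such that the product of any
two distinct elements plus one is a square. -/
def IsRationalDiophantine (M : Finset ℚ) : Prop :=
  0 ∉ M ∧ ∀ x ∈ M, ∀ y ∈ M, x ≠ y → IsSquare (x * y + 1)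

/-- Regularity of a quadruple (the condition is symmetric in the four elements). -/
def IsRegular (a b c d : ℚ) : Prop :=
  (a + b - c - d) ^ 2 = 4 * (a * b + 1) * (c * d + 1)

/-- `M` is an exotic rational Diophantine quintuple: its five elements can be named
`a, b, c, d, e` so that `abcd = 1` and `{a, b, d, e}` and `{a, c, d, e}` are regular, and the
product of any two of its elements is a square. -/
def IsExoticQuintuple (M : Finset ℚ) : Prop :=
  M.card = 5 ∧ IsRationalDiophantine M ∧
    (∃ a b c d e : ℚ, M = {a, b, c, d, e} ∧ a * b * c * d = 1 ∧
      IsRegular a b d e ∧ IsRegular a c d e) ∧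
    ∀ x ∈ M, ∀ y ∈ M, x ≠ y → IsSquare (x * y)

end Exotic

end

/-!
The three curves `Dᵢ` are quadratic in `r`, and their discriminants with respect to `r` are, up to
squares, of degree two in `t`. A parametrization of the conic `w² = t² + h₁ t + h₀` by `s = w - t`
therefore makes `r` and `t` rational functions of a parameter `s`, and along this parametrization
the left-hand side of the equation of `S` equals a square times a separable quartic `q(s)`. So the
function fields of `Dᵢ` and of its pullback are `ℚ(s)` and `ℚ(s, v)` with `v² = q(s)`. The data of
such a parametrization form the structure `ConicCover`.

*Irreducibility.* The ideals of `Dᵢ` and of its pullback are prime because they are the ideals of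
all algebraic relations satisfied by a generic point `(r, t)` or `(r, t, y)`
(`dvd_of_aeval_eq_zero`, `mem_of_aeval_eq_zero`). The same holds over an algebraic closure, by base
change of the parametrization. The one arithmetic fact used over and over is that `√q(s)` is not a
rational function of `s` when `q` is separable (`eq_zero_of_add_mul_sqrt_eq_zero`).

*Genus.* If a Dedekind domain `A` with fraction field `K` is stable under the derivation
`g ↦ dg / ω`, then every differential of `K` that is regular everywhere lies in `A ω`
(`mem_range_of_smul_mem_regularDifferentials`). For `K = k(s)` this is applied to `k[s]` and
`k[1/s]`, and for `K = k(s, v)` to `k[s, v]` with `ω = ds / v`, and to the same ring at infinity.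
Comparing the two descriptions leaves no regular differential in the first case, and the multiples
of `ds / v` in the second. Conversely `ds / v` is regular everywhere, since it is a combination of
`ds` and `dv` as well as of the corresponding differentials at infinity.

*Birational equivalence.* Each quartic has a rational point, which yields generators of `ℚ(s, v)`
that satisfy the Weierstrass equation of `Eᵢ` (`exists_weierstrass_generators`). Two affine domains
of finite type with the same field of fractions are birational
(`birationalOver_of_isFractionRing`).

*Rank.* On an integral Weierstrass curve, a rational point `P` whose `x`-coordinate has `2`-adic
valuation at most `-3` has infinite order, since the duplication formula lowers this valuation by
two (`HasTwoAdicPole.double`). Such a point is exhibited on each `Eᵢ`.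

*Quintuples.* A rational point `(r, t, y)` of `S` gives numbers `p`, `k₁`, `k₂` for which `p² + 1`,
`k₁² + 1` and `k₂² + 1` are squares and `(k₁ + k₂)² = 4 p² (p² + 1) (1 - k₁ k₂)²`. Then
`a = k₁ k₂ p`, `b = k₁ / (k₂ p)`, `c = k₂ / (k₁ p)`, `d = p / (k₁ k₂)` and
`e = a + d - (2 p + 1 / p)` form an exotic quintuple as soon as they are distinct and `e ≠ 0`: the
relation between `p`, `k₁` and `k₂` expresses that both quadruples are regular, and `a e` differs
by a square from the left-hand side of the equation of `S` (`isExoticQuintuple_of_branchPoly`).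
The infinitely many rational points of `E₁` give infinitely many `s` for which `q(s)` is a square.
All but finitely many of these parameters are nondegenerate, and only finitely many of them can
give the same quintuple, because `a d = p²` is a nonconstant rational function of `s`.
-/

noncomputable section

open Polynomial AffineVariety

/-! ### Square roots of separable polynomials -/

/-- If `s` is transcendental over `k` and `v² = q(s)` with `q` separable and nonconstant, then
`1` and `v` are linearly independent over `k[s]`. -/
theorem eq_zero_of_add_mul_sqrt_eq_zero {k E : Type*} [Field k] [Field E] [Algebra k E] {s v : E}
    (hs : Transcendental k s) {q : k[X]} (hq : IsCoprime q q.derivative) (hdeg : 0 < q.natDegree)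
    (hv : v ^ 2 = aeval s q) {a b : k[X]} (h : aeval s a + aeval s b * v = 0) :
    a = 0 ∧ b = 0 := by
  have hinj := transcendental_iff_injective.mp hs
  have key : b ^ 2 * q = a ^ 2 := by
    apply hinj
    simp only [map_mul, map_pow, ← hv]
    linear_combination (aeval s b * v - aeval s a) * h
  have hb : b = 0 := by
    by_contra hb
    have hdvd : b ∣ a := (IsIntegrallyClosed.pow_dvd_pow_iff two_ne_zero).mp ⟨q, key.symm⟩
    obtain ⟨c, rfl⟩ := hdvd
    have hqc : q = c ^ 2 := by
      have : b ^ 2 * q = b ^ 2 * c ^ 2 := by rw [key]; ring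
      exact mul_left_cancel₀ (pow_ne_zero 2 hb) this
    have hc : IsUnit c := by
      apply hq.isUnit_of_dvd' (hqc ▸ dvd_pow_self c two_ne_zero)
      rw [hqc, derivative_pow]
      exact Dvd.dvd.mul_right (Dvd.dvd.mul_left (by simp) _) _
    have := natDegree_eq_zero_of_isUnit (hc.pow 2)
    rw [← hqc] at this
    omega
  subst hb
  refine ⟨hinj ?_, rfl⟩
  simpa using h

/-! ### Differentials of a function field of one variable -/

/-- In characteristic zero, let `K` be algebraic over `k(s)` with `s` transcendental over `k`; the
inclusion of `k[s]` is encoded as a faithful `k[X]`-algebra structure.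
Then `Ω[K⁄k]` is one-dimensional over `K` with basis `ds`; the coordinate of `dg` is `δ g`, where
`δ` is the derivation `d/ds`. -/
theorem exists_derivation_of_isAlgebraic (k K : Type) [Field k] [CharZero k] [Field K]
    [Algebra k K] [Algebra k[X] K] [IsScalarTower k k[X] K] [FaithfulSMul k[X] K]
    [Algebra.IsAlgebraic k[X] K] :
    KaehlerDifferential.D k K (algebraMap k[X] K X) ≠ 0 ∧
      ∃ δ : Derivation k K K, δ (algebraMap k[X] K X) = 1 ∧
      (∀ g : K, KaehlerDifferential.D k K g =
        δ g • KaehlerDifferential.D k K (algebraMap k[X] K X)) ∧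
      ∀ η : Ω[K⁄k], ∃ f : K, η = f • KaehlerDifferential.D k K (algebraMap k[X] K X) := by
  let : Algebra (FractionRing k[X]) K := FractionRing.liftAlgebra k[X] K
  have : IsScalarTower k[X] (FractionRing k[X]) K := FractionRing.isScalarTower_liftAlgebra k[X] K
  have : Algebra.IsAlgebraic (FractionRing k[X]) K :=
    (IsFractionRing.comap_isAlgebraic_iff (A := k[X])).mp inferInstance
  have : CharZero (FractionRing k[X]) :=
    charZero_of_injective_algebraMap (IsFractionRing.injective k[X] (FractionRing k[X]))
  have : Algebra.FormallyEtale k[X] (FractionRing k[X]) :=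
    Algebra.FormallyEtale.of_isLocalization (nonZeroDivisors k[X])
  have : Algebra.FormallyEtale (FractionRing k[X]) K :=
    Algebra.FormallyEtale.of_isSeparable (FractionRing k[X]) K
  have : Algebra.FormallyEtale k[X] K :=
    Algebra.FormallyEtale.comp k[X] (FractionRing k[X]) K
  have hbc := KaehlerDifferential.isBaseChange_of_formallyEtale k k[X] K
  -- the coordinate function `Ω[K⁄k] → K` with respect to `ds`
  let ℓ : Ω[K⁄k] →ₗ[K] K :=
    hbc.lift ((Algebra.linearMap k[X] K).comp (KaehlerDifferential.polynomialEquiv k).toLinearMap)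
  have hℓ : ℓ (KaehlerDifferential.D k K (algebraMap k[X] K X)) = 1 := by
    have := hbc.lift_eq
      ((Algebra.linearMap k[X] K).comp (KaehlerDifferential.polynomialEquiv k).toLinearMap)
      (KaehlerDifferential.D k k[X] X)
    rw [KaehlerDifferential.map_D] at this
    rw [this]
    simp [KaehlerDifferential.polynomialEquiv_D]
  have hspan : ∀ ω : Ω[K⁄k], ω = ℓ ω • KaehlerDifferential.D k K (algebraMap k[X] K X) := by
    intro ω
    induction ω using hbc.inductionOn with
    | zero => simp
    | tmul m =>
      obtain ⟨p, rfl⟩ := (KaehlerDifferential.polynomialEquiv k).symm.surjective m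
      have h1 : (KaehlerDifferential.polynomialEquiv k).symm p
          = p • KaehlerDifferential.D k k[X] X := by
        rw [LinearEquiv.symm_apply_eq, map_smul, KaehlerDifferential.polynomialEquiv_D]
        simp
      rw [h1, map_smul, KaehlerDifferential.map_D, ← algebraMap_smul K p, map_smul, hℓ]
      simp
    | smul c n hn => rw [map_smul, smul_assoc, ← hn]
    | add a b ha hb => rw [map_add, add_smul, ← ha, ← hb]
  refine ⟨fun h0 => ?_, ℓ.compDer (KaehlerDifferential.D k K), ?_, fun g => hspan _,
    fun η => ⟨_, hspan η⟩⟩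
  · rw [h0, map_zero] at hℓ
    exact zero_ne_one hℓ
  · exact hℓ

/-! ### Everywhere regular differentials -/

/-- Differentials regular at `O` have a coordinate in `O` with respect to a nonzero differential `ω`
such that `O` is stable under the derivation `g ↦ dg / ω`. -/
theorem mem_of_smul_mem_regularAt {k K : Type} [Field k] [Field K] [Algebra k K]
    {δ : Derivation k K K} {ω : Ω[K⁄k]} (hω : ω ≠ 0)
    (hδω : ∀ g, KaehlerDifferential.D k K g = δ g • ω) {O : Subalgebra k K}
    (hO : ∀ g ∈ O, δ g ∈ O) {f : K} (hf : f • ω ∈ regularAt k O) : f ∈ O := by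
  have key : ∀ η ∈ Submodule.span O ((fun g : K => KaehlerDifferential.D k K g) '' (O : Set K)),
      ∃ h ∈ O, η = h • ω := by
    intro η hη
    induction hη using Submodule.span_induction with
    | mem x hx =>
      obtain ⟨g, hg, rfl⟩ := hx
      exact ⟨δ g, hO g hg, hδω g⟩
    | zero => exact ⟨0, O.zero_mem, by simp⟩
    | add x y _ _ hx hy =>
      obtain ⟨a, ha, rfl⟩ := hx
      obtain ⟨b, hb, rfl⟩ := hy
      exact ⟨a + b, O.add_mem ha hb, by rw [add_smul]⟩
    | smul c x _ hx =>
      obtain ⟨a, ha, rfl⟩ := hx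
      exact ⟨c * a, O.mul_mem c.2 ha, by rw [mul_smul]; rfl⟩
  obtain ⟨h, hh, he⟩ := key _ hf
  rwa [smul_left_injective K hω he]

/-- If the affine curve with Dedekind coordinate ring `A` is stable under the derivation
`g ↦ dg / ω`, then the everywhere regular differentials are of the form `f • ω` with `f ∈ A` only:
the local rings of `A` are stable as well, and `A` is their intersection. -/
theorem mem_range_of_smul_mem_regularDifferentials {k A K : Type} [Field k] [CommRing A]
    [IsDedekindDomain A] [Field K] [Algebra k A] [Algebra A K] [Algebra k K] [IsScalarTower k A K]
    [IsFractionRing A K] {δ : Derivation k K K} {ω : Ω[K⁄k]} (hω : ω ≠ 0)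
    (hδω : ∀ g, KaehlerDifferential.D k K g = δ g • ω)
    (hA : ∀ a : A, δ (algebraMap A K a) ∈ Set.range (algebraMap A K)) {f : K}
    (hf : f • ω ∈ regularDifferentials k K) : f ∈ Set.range (algebraMap A K) := by
  rw [← Algebra.coe_bot, ← MaximalSpectrum.iInf_localization_eq_bot A K, SetLike.mem_coe,
    Algebra.mem_iInf]
  intro P
  let O := Localization.subalgebra.ofField K P.asIdeal.primeCompl
    P.asIdeal.primeCompl_le_nonZeroDivisors
  change f ∈ O.restrictScalars k
  have hmem : ∀ x, x ∈ O ↔ ∃ a s, ∃ _ : s ∈ P.asIdeal.primeCompl,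
      x = algebraMap A K a * (algebraMap A K s)⁻¹ := fun x => Iff.rfl
  refine mem_of_smul_mem_regularAt hω hδω ?_ ?_
  · rintro g ⟨a, s, hs, rfl⟩
    obtain ⟨a', ha'⟩ := hA a
    obtain ⟨s', hs'⟩ := hA s
    have hs0 : algebraMap A K s ≠ 0 := by
      rw [map_ne_zero_iff _ (IsFractionRing.injective A K)]
      rintro rfl
      exact hs P.asIdeal.zero_mem
    refine (hmem _).mpr ⟨s * a' - a * s', s * s, mul_mem hs hs, ?_⟩
    rw [δ.leibniz, δ.leibniz_inv, ← ha', ← hs']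
    simp only [map_sub, map_mul, smul_eq_mul]
    field_simp
    ring
  · have hval : IsValuationRingOver k (O.restrictScalars k) := by
      intro x
      rcases eq_or_ne x 0 with rfl | hx
      · exact Or.inl (zero_mem _)
      suffices x ∈ O ∨ x⁻¹ ∈ O from
        this.imp id fun h => ⟨x⁻¹, h, mul_inv_cancel₀ hx⟩
      by_cases hP : P.asIdeal = ⊥
      · obtain ⟨a, s, hs, rfl⟩ := IsFractionRing.div_surjective (A := A) x
        refine Or.inl ((hmem _).mpr ⟨a, s, ?_, div_eq_mul_inv _ _⟩)
        intro h
        rw [SetLike.mem_coe, hP, Ideal.mem_bot] at h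
        exact nonZeroDivisors.ne_zero hs h
      · have : IsLocalization.AtPrime O P.asIdeal :=
          Localization.subalgebra.isLocalization_ofField K _ _
        have : IsFractionRing O K :=
          Localization.subalgebra.isFractionRing_ofField K _ _
        have : IsDiscreteValuationRing O :=
          IsLocalization.AtPrime.isDiscreteValuationRing_of_dedekind_domain A hP O
        rcases ValuationRing.isInteger_or_isInteger O x with ⟨y, hy⟩ | ⟨y, hy⟩
        · exact Or.inl (hy ▸ y.2)
        · exact Or.inr (hy ▸ y.2)
    exact (Submodule.mem_iInf _).mp ((Submodule.mem_iInf _).mp hf _) hval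

/-! ### The genus of a rational function field -/

/-- `s ^ N * p(1/s)` is a polynomial in `s` of degree at most `N`. -/
theorem exists_aeval_eq_pow_mul_aeval_inv {k K : Type*} [Field k] [Field K] [Algebra k K] {s : K}
    (hs : s ≠ 0) (p : k[X]) {N : ℕ} (hN : p.natDegree ≤ N) :
    ∃ p' : k[X], p'.natDegree ≤ N ∧ aeval s p' = s ^ N * aeval s⁻¹ p := by
  refine ⟨reflect N p, natDegree_reflect_le.trans (max_le le_rfl hN), ?_⟩
  let _ : Invertible s⁻¹ := invertibleOfNonzero (inv_ne_zero hs)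
  have h := eval₂_reflect_mul_pow (algebraMap k K) s⁻¹ N p hN
  rw [invOf_eq_inv, inv_inv] at h
  rw [aeval_def, aeval_def, ← h, mul_comm, mul_assoc, ← mul_pow, inv_mul_cancel₀ hs, one_pow,
    mul_one]

/-- In a rational function field `k(s)`, a differential regular at all valuation rings containing
`k` has the form `p(s) ds` with a polynomial `p`. -/
theorem exists_eq_aeval_smul_of_mem_regularDifferentials {k K : Type} [Field k] [CharZero k]
    [Field K] [Algebra k K] {s : K} (hs : Transcendental k s)
    (hK : IntermediateField.adjoin k {s} = ⊤) :
    KaehlerDifferential.D k K s ≠ 0 ∧ ∀ η ∈ regularDifferentials k K,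
      ∃ p : k[X], η = aeval s p • KaehlerDifferential.D k K s := by
  let : Algebra k[X] K := (aeval s).toAlgebra
  have hmap : ∀ p : k[X], algebraMap k[X] K p = aeval s p := fun _ => rfl
  have : IsScalarTower k k[X] K := IsScalarTower.of_algebraMap_eq fun c => by simp [hmap]
  have : FaithfulSMul k[X] K :=
    (faithfulSMul_iff_algebraMap_injective k[X] K).mpr (transcendental_iff_injective.mp hs)
  have : IsFractionRing k[X] K := IsFractionRing.of_field k[X] K fun z =>
    (IntermediateField.mem_adjoin_simple_iff k z).mp (hK ▸ IntermediateField.mem_top)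
  have : Algebra.IsAlgebraic k[X] K :=
    IsLocalization.isAlgebraic K (nonZeroDivisors k[X])
  obtain ⟨h0, δ, hδs, hδ, hspan⟩ := exists_derivation_of_isAlgebraic k K
  simp only [hmap, aeval_X] at h0 hδs hδ hspan
  refine ⟨h0, fun η hη => ?_⟩
  obtain ⟨f, rfl⟩ := hspan η
  obtain ⟨p, rfl⟩ := mem_range_of_smul_mem_regularDifferentials (A := k[X]) h0 hδ
    (fun a => ⟨derivative a, by rw [hmap, hmap, Derivation.map_aeval, hδs]; simp⟩) hη
  exact ⟨p, rfl⟩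

/-- A rational function field has genus zero: a regular differential is `p(s) ds` and also
`c(1/s) d(1/s)` with polynomials `p` and `c`, which forces `s² p(s) = -c(1/s)`. -/
theorem finrank_regularDifferentials_eq_zero {k K : Type} [Field k] [CharZero k]
    [Field K] [Algebra k K] {s : K} (hs : Transcendental k s)
    (hK : IntermediateField.adjoin k {s} = ⊤) :
    Module.finrank k (regularDifferentials k K) = 0 := by
  have hs0 : s ≠ 0 := by rintro rfl; exact hs isAlgebraic_zero
  have hs' : Transcendental k s⁻¹ := fun h => hs (IsAlgebraic.inv_iff.mp h)
  have hK' : IntermediateField.adjoin k {s⁻¹} = ⊤ := by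
    rw [← top_le_iff, ← hK, IntermediateField.adjoin_simple_le_iff, ← inv_inv s]
    exact inv_mem (by simpa using IntermediateField.mem_adjoin_simple_self k s⁻¹)
  obtain ⟨h0, h1⟩ := exists_eq_aeval_smul_of_mem_regularDifferentials hs hK
  obtain ⟨-, h2⟩ := exists_eq_aeval_smul_of_mem_regularDifferentials hs' hK'
  suffices regularDifferentials k K = ⊥ by rw [this, finrank_bot]
  refine (Submodule.eq_bot_iff _).mpr fun η hη => ?_
  obtain ⟨p, hp⟩ := h1 η hη
  obtain ⟨c, hc⟩ := h2 η hη
  rw [Derivation.leibniz_inv, smul_smul, hp] at hc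
  have hpc : aeval s p = aeval s⁻¹ c * -s⁻¹ ^ 2 := smul_left_injective K h0 hc
  obtain ⟨c', hc', hcs⟩ := exists_aeval_eq_pow_mul_aeval_inv hs0 c le_rfl
  have hpoly : p * X ^ (c.natDegree + 2) = -c' := by
    apply transcendental_iff_injective.mp hs
    simp only [map_mul, map_pow, aeval_X, map_neg, hcs, hpc]
    generalize aeval s⁻¹ c = z
    field_simp
    ring
  have hp0 : p = 0 := by
    by_contra hne
    have := natDegree_mul_X_pow (c.natDegree + 2) hne
    rw [hpoly, natDegree_neg] at this
    omega
  rw [hp, hp0, map_zero, zero_smul]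

/-! ### The integral closure of `k[s]` in `k(s, √q(s))` -/

/-- The elements of `k(s, v)`, with `v² = q(s)`, have the form `(a(s) + b(s) v) / c(s)`. -/
theorem exists_mul_eq_add_mul_sqrt {k K : Type*} [Field k] [Field K] [Algebra k K] {s v : K}
    (hs : Transcendental k s) {q : k[X]} (hq : IsCoprime q (derivative q)) (hdeg : 0 < q.natDegree)
    (hv : v ^ 2 = aeval s q) {x : K} (hx : x ∈ IntermediateField.adjoin k {s, v}) :
    ∃ a b c : k[X], c ≠ 0 ∧ x * aeval s c = aeval s a + aeval s b * v := by
  have hinj := transcendental_iff_injective.mp hs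
  induction hx using IntermediateField.adjoin_induction with
  | mem x hx =>
    rcases hx with rfl | rfl
    · exact ⟨X, 0, 1, one_ne_zero, by simp⟩
    · exact ⟨0, 1, 1, one_ne_zero, by simp⟩
  | algebraMap x => exact ⟨C x, 0, 1, one_ne_zero, by simp⟩
  | add x y _ _ hx hy =>
    obtain ⟨a, b, c, hc, h⟩ := hx
    obtain ⟨a', b', c', hc', h'⟩ := hy
    refine ⟨a * c' + a' * c, b * c' + b' * c, c * c', mul_ne_zero hc hc', ?_⟩
    simp only [map_mul, map_add]
    linear_combination aeval s c' * h + aeval s c * h'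
  | mul x y _ _ hx hy =>
    obtain ⟨a, b, c, hc, h⟩ := hx
    obtain ⟨a', b', c', hc', h'⟩ := hy
    refine ⟨a * a' + b * b' * q, a * b' + a' * b, c * c', mul_ne_zero hc hc', ?_⟩
    simp only [map_mul, map_add, ← hv]
    linear_combination y * aeval s c' * h + (aeval s a + aeval s b * v) * h'
  | inv x _ hx =>
    obtain ⟨a, b, c, hc, h⟩ := hx
    rcases eq_or_ne x 0 with rfl | hx0
    · exact ⟨0, 0, 1, one_ne_zero, by simp⟩
    have hc0 : aeval s c ≠ 0 := (map_ne_zero_iff _ hinj).mpr hc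
    refine ⟨a * c, -(b * c), a ^ 2 - b ^ 2 * q, ?_, ?_⟩
    · intro h0
      have h1 : (aeval s a + aeval s b * v) * (aeval s a - aeval s b * v) = 0 := by
        have := congrArg (aeval s) h0
        simp only [map_sub, map_mul, map_pow, map_zero, ← hv] at this
        linear_combination this
      rcases mul_eq_zero.mp h1 with h2 | h2
      · rw [h2] at h
        exact mul_ne_zero hx0 hc0 h
      · have h3 := eq_zero_of_add_mul_sqrt_eq_zero hs hq hdeg hv (a := a) (b := -b)
          (by rw [← h2]; simp only [map_neg]; ring)
        rw [neg_eq_zero] at h3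
        rw [h3.1, h3.2, map_zero, zero_mul, zero_add] at h
        exact mul_ne_zero hx0 hc0 h
    · simp only [map_sub, map_mul, map_pow, map_neg, ← hv]
      field_simp
      linear_combination (aeval s b * v - aeval s a) * h

/-- If `q` is squarefree and `c² ∣ b² q`, then `c ∣ b`. -/
theorem dvd_of_sq_dvd_sq_mul_squarefree {R : Type*} [CommRing R] [IsDomain R] [IsGCDMonoid R]
    {q b c : R} (hq : Squarefree q) (hc : c ≠ 0) (h : c ^ 2 ∣ b ^ 2 * q) : c ∣ b := by
  obtain ⟨_⟩ := ‹IsGCDMonoid R›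
  obtain ⟨b', c', hb', hc', hu⟩ := extract_gcd b c
  set d := gcd b c
  have hd : d ≠ 0 := by
    intro h0
    rw [h0, zero_mul] at hc'
    exact hc hc'
  have h1 : c' ^ 2 ∣ b' ^ 2 * q := by
    rw [hb', hc', mul_pow, mul_pow, mul_assoc] at h
    exact (mul_dvd_mul_iff_left (pow_ne_zero 2 hd)).mp h
  have hrel : IsRelPrime (c' ^ 2) (b' ^ 2) :=
    (IsRelPrime.pow (gcd_isUnit_iff_isRelPrime.mp hu)).symm
  have h2 : c' * c' ∣ q := by
    rw [← sq]
    exact hrel.dvd_of_dvd_mul_left h1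
  obtain ⟨u, hu⟩ := hq c' h2
  rw [hc', hb', ← hu]
  exact mul_dvd_mul_left d u.isUnit.dvd

/-- If `q` is separable, the integral closure of `k[s]` in `k(s, v)`, `v² = q(s)`, is
`k[s] + k[s] v`. -/
theorem exists_eq_add_mul_sqrt_of_isIntegral {k K : Type*} [Field k] [CharZero k] [Field K]
    [Algebra k K] [Algebra k[X] K] [IsScalarTower k k[X] K] [FaithfulSMul k[X] K]
    {v : K} {q : k[X]} (hq : IsCoprime q (derivative q)) (hdeg : 0 < q.natDegree)
    (hv : v ^ 2 = algebraMap k[X] K q)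
    (hK : IntermediateField.adjoin k {algebraMap k[X] K X, v} = ⊤) {x : K}
    (hx : IsIntegral k[X] x) :
    ∃ a b : k[X], x = algebraMap k[X] K a + algebraMap k[X] K b * v := by
  set s := algebraMap k[X] K X with hsdef
  have hmap : ∀ p : k[X], algebraMap k[X] K p = aeval s p := fun p => by
    rw [hsdef, aeval_algebraMap_apply, aeval_X_left_apply]
  have hinj := FaithfulSMul.algebraMap_injective k[X] K
  have hs : Transcendental k s := by
    rw [transcendental_iff_injective]
    intro a b h
    rw [← hmap, ← hmap] at h
    exact hinj h
  obtain ⟨a, b, c, hc, h⟩ := exists_mul_eq_add_mul_sqrt hs hq hdeg (hv.trans (hmap q))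
    (x := x) (hK ▸ IntermediateField.mem_top)
  rw [← hmap, ← hmap, ← hmap] at h
  have hv' := hv.trans (hmap q)
  let F := FractionRing k[X]
  let : Algebra F K := FractionRing.liftAlgebra k[X] K
  have : IsScalarTower k[X] F K := FractionRing.isScalarTower_liftAlgebra k[X] K
  have hFK : ∀ p, algebraMap F K (algebraMap k[X] F p) = algebraMap k[X] K p := fun p =>
    (IsScalarTower.algebraMap_apply k[X] F K p).symm
  have hτ := IsFractionRing.injective k[X] F
  have hcF : algebraMap k[X] F c ≠ 0 := (map_ne_zero_iff _ hτ).mpr hc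
  have hcK : algebraMap k[X] K c ≠ 0 := (map_ne_zero_iff _ hinj).mpr hc
  by_cases hxF : x ∈ (algebraMap F K).range
  · obtain ⟨y, rfl⟩ := hxF
    have hy : IsIntegral k[X] y :=
      (isIntegral_algebraMap_iff (algebraMap F K).injective).mp hx
    obtain ⟨p, rfl⟩ := IsIntegrallyClosed.isIntegral_iff.mp hy
    exact ⟨p, 0, by simp [hFK]⟩
  · have hxF' : IsIntegral F x := hx.tower_top
    let g : F[X] := X ^ 2 - C (algebraMap k[X] F (2 * a) / algebraMap k[X] F c) * X
      + C (algebraMap k[X] F (a ^ 2 - b ^ 2 * q) / algebraMap k[X] F c ^ 2)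
    have hgdeg : g.natDegree = 2 := by simp only [g]; compute_degree!
    have hgmonic : g.Monic := by simp only [g]; monicity!
    have hgx : aeval x g = 0 := by
      simp only [g, map_add, map_sub, map_mul, map_pow, aeval_X, aeval_C, map_div₀, hFK, ← hv]
      rw [eq_div_of_mul_eq hcK h]
      simp only [map_ofNat]
      field_simp
      ring
    have hdegm : 2 ≤ (minpoly F x).natDegree := by
      have h1 := minpoly.natDegree_pos hxF'
      have h2 : (minpoly F x).natDegree ≠ 1 := fun h => hxF (minpoly.natDegree_eq_one_iff.mp h)
      omega
    have hgm : g = (minpoly k[X] x).map (algebraMap k[X] F) := by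
      rw [← minpoly.isIntegrallyClosed_eq_field_fractions' F hx]
      exact eq_of_monic_of_dvd_of_natDegree_le (minpoly.monic hxF') hgmonic
        (minpoly.dvd F x hgx) (hgdeg.trans_le hdegm)
    have h1 := congrArg (fun p => coeff p 1) hgm
    have h0 := congrArg (fun p => coeff p 0) hgm
    simp only [g, coeff_map, coeff_add, coeff_sub, coeff_X_pow, coeff_C_mul, coeff_X_one,
      coeff_X_zero, coeff_C_zero, coeff_C_succ] at h1 h0
    generalize (minpoly k[X] x).coeff 1 = m1 at h1
    generalize (minpoly k[X] x).coeff 0 = m0 at h0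
    have hca : c ∣ a := by
      have h2 : 2 * a = c * -m1 := by
        apply hτ
        rw [map_mul _ c, map_neg, ← h1]
        rw [if_neg (by norm_num), mul_one, zero_sub, add_zero, neg_neg, mul_div_cancel₀ _ hcF]
      have h3 : a = c * (C (1 / 2) * -m1) := by
        have h4 : (C (1 / 2) : k[X]) * 2 = 1 := by
          rw [← map_ofNat (C : k →+* k[X]) 2, ← map_mul]; simp
        linear_combination C (1 / 2) * h2 - a * h4
      exact ⟨_, h3⟩
    have hcb : c ∣ b := by
      refine dvd_of_sq_dvd_sq_mul_squarefree (Separable.squarefree hq) hc ?_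
      have h2 : a ^ 2 - b ^ 2 * q = c ^ 2 * m0 := by
        apply hτ
        rw [map_mul _ (c ^ 2), map_pow _ c, ← h0]
        rw [if_neg (by norm_num), mul_zero, zero_sub, neg_zero, zero_add,
          mul_div_cancel₀ _ (pow_ne_zero 2 hcF)]
      have h3 : b ^ 2 * q = a ^ 2 - c ^ 2 * m0 := by linear_combination -h2
      rw [h3]
      exact dvd_sub (pow_dvd_pow_of_dvd hca 2) (dvd_mul_right _ _)
    obtain ⟨a', rfl⟩ := hca
    obtain ⟨b', rfl⟩ := hcb
    refine ⟨a', b', mul_right_cancel₀ hcK (h.trans ?_)⟩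
    simp only [map_mul]
    ring

/-! ### The genus of the function field of `v² = q(s)` -/

/-- Let `K = k(s, v)` with `v² = q(s)` and `q` separable. A differential regular at all valuation
rings containing `k` is a multiple of `ds / v` by an element of `k[s, v]`: the derivation
`v d/ds` preserves `k[s, v]`, since it maps `v` to `q'(s) / 2`. -/
theorem exists_eq_smul_of_mem_regularDifferentials_sqrt {k K : Type} [Field k] [CharZero k]
    [Field K] [Algebra k K] {s v : K} (hs : Transcendental k s) {q : k[X]}
    (hq : IsCoprime q (derivative q)) (hdeg : 0 < q.natDegree) (hv : v ^ 2 = aeval s q)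
    (hK : IntermediateField.adjoin k {s, v} = ⊤) :
    KaehlerDifferential.D k K s ≠ 0 ∧ ∀ η ∈ regularDifferentials k K, ∃ a b : k[X],
      η = ((aeval s a + aeval s b * v) * v⁻¹) • KaehlerDifferential.D k K s := by
  let : Algebra k[X] K := (aeval s).toAlgebra
  have hmap : ∀ p : k[X], algebraMap k[X] K p = aeval s p := fun _ => rfl
  have : IsScalarTower k k[X] K := IsScalarTower.of_algebraMap_eq fun c => by simp [hmap]
  have hinj := transcendental_iff_injective.mp hs
  have : FaithfulSMul k[X] K := (faithfulSMul_iff_algebraMap_injective k[X] K).mpr hinj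
  have hsX : algebraMap k[X] K X = s := by simp [hmap]
  have hq0 : q ≠ 0 := by rintro rfl; simp at hdeg
  have hv0 : v ≠ 0 := by
    rintro rfl
    rw [zero_pow two_ne_zero] at hv
    exact hq0 (hinj (by rw [← hv, map_zero]))
  have hvint : IsIntegral k[X] v :=
    IsIntegral.of_pow two_pos (by rw [hv, ← hmap]; exact isIntegral_algebraMap)
  have : Algebra.IsAlgebraic k[X] K := ⟨fun x => by
    have hx : x ∈ IntermediateField.adjoin k {s, v} := hK ▸ IntermediateField.mem_top
    induction hx using IntermediateField.adjoin_induction with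
    | mem x hx =>
      rcases hx with rfl | rfl
      · rw [← hsX]; exact isAlgebraic_algebraMap _
      · exact hvint.isAlgebraic
    | algebraMap x =>
      rw [IsScalarTower.algebraMap_apply k k[X] K]; exact isAlgebraic_algebraMap _
    | add x y _ _ hx hy => exact hx.add hy
    | mul x y _ _ hx hy => exact hx.mul hy
    | inv x _ hx => exact hx.inv⟩
  obtain ⟨h0, δ, hδs, hδ, hspan⟩ := exists_derivation_of_isAlgebraic k K
  rw [hsX] at h0 hδs hδ hspan
  refine ⟨h0, fun η hη => ?_⟩
  -- the ring `k[s, v]` is realised as the integral closure of `k[s]`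
  let F := FractionRing k[X]
  let : Algebra F K := FractionRing.liftAlgebra k[X] K
  have : IsScalarTower k[X] F K := FractionRing.isScalarTower_liftAlgebra k[X] K
  have : CharZero F := charZero_of_injective_algebraMap (IsFractionRing.injective k[X] F)
  have : Algebra.IsAlgebraic F K :=
    (IsFractionRing.comap_isAlgebraic_iff (A := k[X])).mp inferInstance
  have : FiniteDimensional F K := by
    refine ⟨Submodule.fg_def.mpr ⟨{1, v}, Set.toFinite _, ?_⟩⟩
    rw [eq_top_iff]
    intro x _
    obtain ⟨a, b, c, hc, h⟩ := exists_mul_eq_add_mul_sqrt hs hq hdeg hv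
      (x := x) (hK ▸ IntermediateField.mem_top)
    have hcK : aeval s c ≠ 0 := (map_ne_zero_iff _ hinj).mpr hc
    have hFK : ∀ p, algebraMap F K (algebraMap k[X] F p) = aeval s p := fun p =>
      (IsScalarTower.algebraMap_apply k[X] F K p).symm
    have hx : x = (algebraMap k[X] F a / algebraMap k[X] F c) • (1 : K)
        + (algebraMap k[X] F b / algebraMap k[X] F c) • v := by
      rw [Algebra.smul_def, Algebra.smul_def, map_div₀, map_div₀, hFK, hFK, hFK]
      field_simp
      linear_combination h
    rw [hx]
    exact add_mem (Submodule.smul_mem _ _ (Submodule.subset_span (by simp)))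
      (Submodule.smul_mem _ _ (Submodule.subset_span (by simp)))
  have : IsDedekindDomain (integralClosure k[X] K) := integralClosure.isDedekindDomain k[X] F K
  have : IsFractionRing (integralClosure k[X] K) K :=
    integralClosure.isFractionRing_of_finite_extension F K
  have h2 : (2 : K) ≠ 0 := by
    have : CharZero K := charZero_of_injective_algebraMap (algebraMap k K).injective
    exact two_ne_zero
  have hδaeval : ∀ p : k[X], δ (aeval s p) = aeval s (derivative p) := fun p => by
    rw [Derivation.map_aeval, hδs, smul_eq_mul, mul_one]
  have hδv : 2 * (v * δ v) = aeval s (derivative q) := by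
    rw [← hδaeval, ← hv, sq, δ.leibniz, smul_eq_mul]
    ring
  obtain ⟨f, rfl⟩ : ∃ f : K, η = f • v⁻¹ • KaehlerDifferential.D k K s := by
    obtain ⟨f, rfl⟩ := hspan η
    exact ⟨f * v, by rw [smul_smul, mul_assoc, mul_inv_cancel₀ hv0, mul_one]⟩
  obtain ⟨⟨x, hx⟩, rfl⟩ := mem_range_of_smul_mem_regularDifferentials
    (A := integralClosure k[X] K) (δ := v • δ) (ω := v⁻¹ • KaehlerDifferential.D k K s)
    (smul_ne_zero (inv_ne_zero hv0) h0)
    (fun g => by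
      rw [hδ g, smul_smul]
      congr 1
      simp only [Derivation.smul_apply, smul_eq_mul]
      field_simp)
    (fun ⟨x, hx⟩ => by
      obtain ⟨a, b, hab⟩ := exists_eq_add_mul_sqrt_of_isIntegral hq hdeg hv (by rwa [hsX]) hx
      change x = aeval s a + aeval s b * v at hab
      have hval : (v • δ) x = algebraMap k[X] K (derivative a) * v
          + algebraMap k[X] K (derivative b * q + C (1 / 2) * (b * derivative q)) := by
        simp only [Derivation.smul_apply, hab, map_add, δ.leibniz, hδaeval, smul_eq_mul, hmap,
          map_mul, ← hv, ← hδv, aeval_C, map_div₀, map_one, map_ofNat]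
        field_simp
        ring
      refine ⟨⟨(v • δ) x, ?_⟩, rfl⟩
      rw [hval]
      exact (isIntegral_algebraMap.mul hvint).add isIntegral_algebraMap) hη
  obtain ⟨a, b, hab⟩ := exists_eq_add_mul_sqrt_of_isIntegral hq hdeg hv (by rwa [hsX]) hx
  refine ⟨a, b, ?_⟩
  rw [mul_smul]
  congr 1

/-- If `O` contains `s` and `v`, where `v² = q(s)` with `q` separable, then `ds / v` is regular at
`O`: if `a q + b q' = 1`, then `ds / v = a(s) v ds + 2 b(s) dv`. -/
theorem inv_smul_mem_regularAt {k K : Type} [Field k] [CharZero k] [Field K] [Algebra k K]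
    {s v : K} (hv0 : v ≠ 0) {q : k[X]} (hq : IsCoprime q (derivative q)) (hv : v ^ 2 = aeval s q)
    {O : Subalgebra k K} (hsO : s ∈ O) (hvO : v ∈ O) :
    v⁻¹ • KaehlerDifferential.D k K s ∈ regularAt k O := by
  obtain ⟨a, b, hab⟩ := hq
  have hO : ∀ p : k[X], aeval s p ∈ O := fun p => by
    have := aeval_mem_adjoin_singleton k s (p := p)
    exact (Algebra.adjoin_le (by simpa using hsO) : Algebra.adjoin k {s} ≤ O) this
  have hdv : (2 * v) • KaehlerDifferential.D k K v
      = aeval s (derivative q) • KaehlerDifferential.D k K s := by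
    rw [← Derivation.map_aeval, ← hv, sq, Derivation.leibniz, ← add_smul, two_mul]
  have h1 := congrArg (aeval s) hab
  rw [map_add, map_mul, map_mul, map_one, ← hv] at h1
  have key : v⁻¹ • KaehlerDifferential.D k K s
      = (aeval s a * v) • KaehlerDifferential.D k K s
        + (2 * aeval s b) • KaehlerDifferential.D k K v := by
    have h2 : (2 * aeval s b) • KaehlerDifferential.D k K v
        = (aeval s b * v⁻¹ * aeval s (derivative q)) • KaehlerDifferential.D k K s := by
      rw [mul_smul (aeval s b * v⁻¹), ← hdv, smul_smul]
      congr 1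
      field_simp
    rw [h2, ← add_smul]
    congr 1
    field_simp
    linear_combination -h1
  rw [key]
  have hmem : ∀ c ∈ O, ∀ g ∈ O, c • KaehlerDifferential.D k K g ∈ regularAt k O :=
    fun c hc g hg => Submodule.smul_mem
      (Submodule.span O ((fun g : K => KaehlerDifferential.D k K g) '' (O : Set K))) (⟨c, hc⟩ : O)
      (Submodule.subset_span ⟨g, hg, rfl⟩)
  exact add_mem (hmem _ (mul_mem (hO a) hvO) _ hsO)
    (hmem _ (mul_mem (ofNat_mem O 2) (hO b)) _ hvO)

/-- The function field `k(s, v)`, `v² = q(s)`, has genus one if `q` and its reversal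
`q' = s⁴ q(1/s)` are separable: the regular differentials are spanned by `ds / v`. With
`u = 1/s` and `w = v/s²` one has `w² = q'(u)` and `du / w = - ds / v`, and a differential which is
`(a(s) + b(s) v) ds / v` as well as `(a'(u) + b'(u) w) du / w` is a constant multiple of `ds / v`. -/
theorem finrank_regularDifferentials_eq_one {k K : Type} [Field k] [CharZero k]
    [Field K] [Algebra k K] {s v : K} (hs : Transcendental k s) {q q' : k[X]}
    (hq : IsCoprime q (derivative q)) (hdeg : 0 < q.natDegree) (hv : v ^ 2 = aeval s q)
    (hq' : IsCoprime q' (derivative q')) (hdeg' : 0 < q'.natDegree)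
    (hqq' : aeval s q = s ^ 4 * aeval s⁻¹ q')
    (hK : IntermediateField.adjoin k {s, v} = ⊤) :
    Module.finrank k (regularDifferentials k K) = 1 := by
  have hinj := transcendental_iff_injective.mp hs
  have hs0 : s ≠ 0 := by rintro rfl; exact hs isAlgebraic_zero
  have hs' : Transcendental k s⁻¹ := fun h => hs (IsAlgebraic.inv_iff.mp h)
  have hq0 : q ≠ 0 := by rintro rfl; simp at hdeg
  have hv0 : v ≠ 0 := by
    rintro rfl
    rw [zero_pow two_ne_zero] at hv
    exact hq0 (hinj (by rw [← hv, map_zero]))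
  have hv' : (v * s⁻¹ ^ 2) ^ 2 = aeval s⁻¹ q' := by
    rw [mul_pow, hv, hqq']
    generalize aeval s⁻¹ q' = z
    field_simp
  have hK' : IntermediateField.adjoin k {s⁻¹, v * s⁻¹ ^ 2} = ⊤ := by
    have h1 : s⁻¹ ∈ IntermediateField.adjoin k {s⁻¹, v * s⁻¹ ^ 2} :=
      IntermediateField.subset_adjoin _ _ (by simp)
    have h2 : v * s⁻¹ ^ 2 ∈ IntermediateField.adjoin k {s⁻¹, v * s⁻¹ ^ 2} :=
      IntermediateField.subset_adjoin _ _ (by simp)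
    have h3 : s ∈ IntermediateField.adjoin k {s⁻¹, v * s⁻¹ ^ 2} := by simpa using inv_mem h1
    have h4 := mul_mem h2 (pow_mem h3 2)
    rw [mul_assoc, ← mul_pow, inv_mul_cancel₀ hs0, one_pow, mul_one] at h4
    rw [← top_le_iff, ← hK, IntermediateField.adjoin_le_iff]
    rintro x (rfl | rfl)
    · exact h3
    · exact h4
  obtain ⟨h0, h1⟩ := exists_eq_smul_of_mem_regularDifferentials_sqrt hs hq hdeg hv hK
  obtain ⟨-, h2⟩ := exists_eq_smul_of_mem_regularDifferentials_sqrt hs' hq' hdeg' hv' hK'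
  have hinv : KaehlerDifferential.D k K s⁻¹ = (-s⁻¹ ^ 2) • KaehlerDifferential.D k K s :=
    Derivation.leibniz_inv _ s
  suffices regularDifferentials k K
      = Submodule.span k {v⁻¹ • KaehlerDifferential.D k K s} by
    rw [this, finrank_span_singleton (smul_ne_zero (inv_ne_zero hv0) h0)]
  apply le_antisymm
  · intro η hη
    obtain ⟨a, b, hab⟩ := h1 η hη
    obtain ⟨a', b', hab'⟩ := h2 η hη
    rw [hinv, smul_smul, hab] at hab'
    have heq := smul_left_injective K h0 hab'
    set N := a'.natDegree + b'.natDegree + 2 with hN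
    obtain ⟨α, hα, hαs⟩ := exists_aeval_eq_pow_mul_aeval_inv hs0 a' (N := N) (by omega)
    obtain ⟨β, hβ, hβs⟩ := exists_aeval_eq_pow_mul_aeval_inv hs0 b'
      (N := a'.natDegree + b'.natDegree) (by omega)
    have hz := eq_zero_of_add_mul_sqrt_eq_zero hs hq hdeg hv (a := a * X ^ N + α)
      (b := b * X ^ N + β) (by
        simp only [map_add, map_mul, map_pow, aeval_X, hαs, hβs, hN, pow_add]
        generalize aeval s⁻¹ a' = a₁ at heq ⊢
        generalize aeval s⁻¹ b' = b₁ at heq ⊢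
        field_simp at heq ⊢
        linear_combination s ^ a'.natDegree * s ^ b'.natDegree * heq)
    have hb : b = 0 := by
      by_contra hb
      have h3 := natDegree_mul_X_pow N hb
      rw [eq_neg_of_add_eq_zero_left hz.2, natDegree_neg] at h3
      omega
    have ha : a.natDegree = 0 := by
      by_contra ha
      have ha0 : a ≠ 0 := by rintro rfl; simp at ha
      have h3 := natDegree_mul_X_pow N ha0
      rw [eq_neg_of_add_eq_zero_left hz.1, natDegree_neg] at h3
      omega
    obtain ⟨c, rfl⟩ := natDegree_eq_zero.mp ha
    refine Submodule.mem_span_singleton.mpr ⟨c, ?_⟩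
    rw [hab, hb, aeval_C, map_zero, zero_mul, add_zero, mul_smul, algebraMap_smul]
  · rw [Submodule.span_singleton_le_iff_mem]
    refine (Submodule.mem_iInf _).mpr fun O => (Submodule.mem_iInf _).mpr fun hO => ?_
    -- a valuation ring containing the square of an element contains the element
    have hsqrt : ∀ x, x ^ 2 ∈ O → x ∈ O := by
      intro x hx
      rcases hO x with h | ⟨y, hy, hxy⟩
      · exact h
      · have : x = x ^ 2 * y := by rw [sq, mul_assoc, hxy, mul_one]
        rw [this]
        exact mul_mem hx hy
    have haev : ∀ (p : k[X]) {x : K}, x ∈ O → aeval x p ∈ O := fun p x hx =>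
      (Algebra.adjoin_le (by simpa using hx) : Algebra.adjoin k {x} ≤ O)
        (aeval_mem_adjoin_singleton k x (p := p))
    rcases hO s with h | ⟨y, hy, hxy⟩
    · exact inv_smul_mem_regularAt hv0 hq hv h (hsqrt v (hv ▸ haev q h))
    · obtain rfl : y = s⁻¹ := eq_inv_of_mul_eq_one_right hxy
      have h3 := inv_smul_mem_regularAt (mul_ne_zero hv0 (pow_ne_zero 2 (inv_ne_zero hs0)))
        hq' hv' hy (hsqrt _ (hv' ▸ haev q' hy))
      have h4 : v⁻¹ • KaehlerDifferential.D k K s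
          = -((v * s⁻¹ ^ 2)⁻¹ • KaehlerDifferential.D k K s⁻¹) := by
        rw [hinv, smul_smul, ← neg_smul]
        congr 1
        field_simp
      rw [h4]
      exact neg_mem h3

/-! ### Birational affine varieties -/

/-- The fractions with a power of `f` as denominator form a `k`-subalgebra. -/
theorem exists_pow_mul_eq_of_mem_adjoin {k A K : Type*} [CommRing k] [CommRing A] [CommRing K]
    [Algebra k A] [Algebra k K] [Algebra A K] [IsScalarTower k A K] {f : A} {S : Set K}
    (hS : ∀ x ∈ S, ∃ (n : ℕ) (c : A), algebraMap A K f ^ n * x = algebraMap A K c) {x : K}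
    (hx : x ∈ Algebra.adjoin k S) :
    ∃ (n : ℕ) (c : A), algebraMap A K f ^ n * x = algebraMap A K c := by
  induction hx using Algebra.adjoin_induction with
  | mem x hx => exact hS x hx
  | algebraMap r => exact ⟨0, algebraMap k A r, by simp [← IsScalarTower.algebraMap_apply]⟩
  | add x y _ _ hx hy =>
    obtain ⟨i, c, h⟩ := hx
    obtain ⟨j, d, h'⟩ := hy
    refine ⟨i + j, f ^ j * c + f ^ i * d, ?_⟩
    rw [map_add, map_mul, map_mul, ← h, ← h', map_pow, map_pow]
    ring
  | mul x y _ _ hx hy =>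
    obtain ⟨i, c, h⟩ := hx
    obtain ⟨j, d, h'⟩ := hy
    refine ⟨i + j, c * d, ?_⟩
    rw [map_mul, ← h, ← h']
    ring

/-- Finitely many fractions have a common denominator: a finitely generated subalgebra of the
fraction field `K` of `A` lies in some `A[1/a]`. -/
theorem exists_pow_mul_mem_range {k A B K : Type*} [CommRing k] [CommRing A] [IsDomain A]
    [CommRing B] [Field K] [Algebra k A] [Algebra k B] [Algebra k K] [Algebra A K] [Algebra B K]
    [IsScalarTower k A K] [IsScalarTower k B K] [IsFractionRing A K] [Algebra.FiniteType k B] :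
    ∃ a : A, a ≠ 0 ∧ ∀ b : B, ∃ (n : ℕ) (c : A),
      algebraMap A K a ^ n * algebraMap B K b = algebraMap A K c := by
  classical
  obtain ⟨S, hS⟩ := Algebra.FiniteType.out (R := k) (A := B)
  obtain ⟨⟨a, ha⟩, hab⟩ := IsLocalization.exist_integer_multiples_of_finset (nonZeroDivisors A)
    (S.image (algebraMap B K))
  refine ⟨a, nonZeroDivisors.ne_zero ha, fun b => ?_⟩
  refine exists_pow_mul_eq_of_mem_adjoin (k := k) (S := algebraMap B K '' S) ?_ ?_
  · rintro _ ⟨x, hx, rfl⟩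
    obtain ⟨c, hc⟩ := hab (algebraMap B K x) (Finset.mem_image_of_mem _ hx)
    exact ⟨1, c, by rw [hc, pow_one, Algebra.smul_def]⟩
  · have h := Set.mem_image_of_mem (IsScalarTower.toAlgHom k B K)
      (hS ▸ Algebra.mem_top : b ∈ Algebra.adjoin k (S : Set B))
    rwa [← Subalgebra.coe_map, AlgHom.map_adjoin] at h

/-- If the `k`-subalgebra `C` of the fraction field of `A` is `A[1/f]`, then `Spec C ⟶ Spec A` is
a dominant open immersion, so that `Spec C` and `Spec A` are birational. -/
theorem birationalOver_of_subalgebra {k A K : Type} [Field k] [CommRing A] [IsDomain A] [Field K]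
    [Algebra k A] [Algebra k K] [Algebra A K] [IsScalarTower k A K] [IsFractionRing A K]
    (C : Subalgebra k K) (hAC : ∀ a, algebraMap A K a ∈ C) {f : A} (hf0 : f ≠ 0)
    (hf : (algebraMap A K f)⁻¹ ∈ C)
    (hC : ∀ x ∈ C, ∃ (n : ℕ) (a : A), algebraMap A K f ^ n * x = algebraMap A K a) :
    AlgebraicGeometry.Scheme.BirationalOver (structureMap k C) (structureMap k A) := by
  have hinj := IsFractionRing.injective A K
  have hfK : algebraMap A K f ≠ 0 := (map_ne_zero_iff _ hinj).mpr hf0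
  let φ : A →ₐ[k] C := (IsScalarTower.toAlgHom k A K).codRestrict C hAC
  let : Algebra A C := φ.toRingHom.toAlgebra
  have hφ : ∀ a, ((algebraMap A C a : C) : K) = algebraMap A K a := fun _ => rfl
  have hφinj : Function.Injective (algebraMap A C) := fun a b h => hinj (by
    rw [← hφ, ← hφ, h])
  have : IsLocalization.Away f C := by
    refine (isLocalization_iff _ _).mpr ⟨?_, ?_, ?_⟩
    · rintro ⟨_, n, rfl⟩
      refine IsUnit.of_mul_eq_one ⟨(algebraMap A K f)⁻¹ ^ n, pow_mem hf n⟩ (Subtype.ext ?_)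
      change ((algebraMap A C (f ^ n) : C) : K) * _ = 1
      rw [hφ, map_pow, ← mul_pow, mul_inv_cancel₀ hfK, one_pow]
    · rintro ⟨x, hx⟩
      obtain ⟨n, a, h⟩ := hC x hx
      refine ⟨(a, ⟨f ^ n, n, rfl⟩), Subtype.ext ?_⟩
      change x * ((algebraMap A C (f ^ n) : C) : K) = ((algebraMap A C a : C) : K)
      rw [hφ, hφ, map_pow, ← h, mul_comm]
    · intro x y h
      exact ⟨1, by rw [hφinj h]⟩
  have := AlgebraicGeometry.IsOpenImmersion.of_isLocalization (S := C) f
  have : AlgebraicGeometry.IsDominant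
      (AlgebraicGeometry.Spec.map (CommRingCat.ofHom (algebraMap A C))) := by
    refine ⟨?_⟩
    refine (PrimeSpectrum.denseRange_comap_iff_ker_le_nilRadical (algebraMap A C)).mpr ?_
    rw [(RingHom.injective_iff_ker_eq_bot _).mp hφinj]
    exact bot_le
  refine AlgebraicGeometry.Scheme.Hom.birationalOver
    (AlgebraicGeometry.Spec.map (CommRingCat.ofHom (algebraMap A C))) _ _ ?_
  rw [structureMap, structureMap, ← AlgebraicGeometry.Spec.map_comp, ← CommRingCat.ofHom_comp]
  congr 2
  exact φ.comp_algebraMap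

/-- Affine varieties with the same function field are birational: if `a ∈ A` and `b ∈ B` are common
denominators with `B ⊆ A[1/a]` and `A ⊆ B[1/b]`, then the algebra `C` generated by `A`, `B`, `1/a`
and `1/b` is a localization of both `A` and `B` at one element. -/
theorem birationalOver_of_isFractionRing {k A B : Type} (K : Type) [Field k] [CommRing A]
    [IsDomain A] [CommRing B] [IsDomain B] [Field K] [Algebra k A] [Algebra k B] [Algebra k K]
    [Algebra A K] [Algebra B K] [IsScalarTower k A K] [IsScalarTower k B K] [IsFractionRing A K]
    [IsFractionRing B K] [Algebra.FiniteType k A] [Algebra.FiniteType k B] :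
    AlgebraicGeometry.Scheme.BirationalOver (structureMap k A) (structureMap k B) := by
  obtain ⟨a, ha0, ha⟩ := exists_pow_mul_mem_range (k := k) (A := A) (B := B) (K := K)
  obtain ⟨b, hb0, hb⟩ := exists_pow_mul_mem_range (k := k) (A := B) (B := A) (K := K)
  have haK : algebraMap A K a ≠ 0 := (map_ne_zero_iff _ (IsFractionRing.injective A K)).mpr ha0
  have hbK : algebraMap B K b ≠ 0 := (map_ne_zero_iff _ (IsFractionRing.injective B K)).mpr hb0
  let C : Subalgebra k K := Algebra.adjoin k (Set.range (algebraMap A K) ∪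
    Set.range (algebraMap B K) ∪ {(algebraMap A K a)⁻¹, (algebraMap B K b)⁻¹})
  have hAC : ∀ x, algebraMap A K x ∈ C := fun x => Algebra.subset_adjoin (by simp)
  have hBC : ∀ x, algebraMap B K x ∈ C := fun x => Algebra.subset_adjoin (by simp)
  have haC : (algebraMap A K a)⁻¹ ∈ C := Algebra.subset_adjoin (by simp)
  have hbC : (algebraMap B K b)⁻¹ ∈ C := Algebra.subset_adjoin (by simp)
  obtain ⟨m, n, hn⟩ := ha b
  obtain ⟨l, n', hn'⟩ := hb a
  have hnK : algebraMap A K n ≠ 0 := hn ▸ mul_ne_zero (pow_ne_zero m haK) hbK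
  have hnK' : algebraMap B K n' ≠ 0 := hn' ▸ mul_ne_zero (pow_ne_zero l hbK) haK
  have hn0 : n ≠ 0 := by rintro rfl; exact hnK (map_zero _)
  have hn0' : n' ≠ 0 := by rintro rfl; exact hnK' (map_zero _)
  refine (birationalOver_of_subalgebra C hAC (mul_ne_zero ha0 hn0) ?_ ?_).symm.trans
    (birationalOver_of_subalgebra C hBC (mul_ne_zero hb0 hn0') ?_ ?_)
  · rw [map_mul, ← hn, mul_inv, mul_inv, ← inv_pow]
    exact mul_mem haC (mul_mem (pow_mem haC m) hbC)
  · refine fun x => exists_pow_mul_eq_of_mem_adjoin fun x hx => ?_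
    rcases hx with (⟨y, rfl⟩ | ⟨y, rfl⟩) | rfl | rfl
    · exact ⟨0, y, by simp⟩
    · obtain ⟨i, c, hc⟩ := ha y
      exact ⟨i, n ^ i * c, by rw [map_mul, map_mul, ← hc, map_pow]; ring⟩
    · exact ⟨1, n, by rw [map_mul]; field_simp⟩
    · exact ⟨1, a * a ^ m, by
        rw [map_mul, ← hn, map_mul, map_pow]; field_simp⟩
  · rw [map_mul, ← hn', mul_inv, mul_inv, ← inv_pow]
    exact mul_mem hbC (mul_mem (pow_mem hbC l) haC)
  · refine fun x => exists_pow_mul_eq_of_mem_adjoin fun x hx => ?_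
    rcases hx with (⟨y, rfl⟩ | ⟨y, rfl⟩) | rfl | rfl
    · obtain ⟨i, c, hc⟩ := hb y
      exact ⟨i, n' ^ i * c, by rw [map_mul, map_mul, ← hc, map_pow]; ring⟩
    · exact ⟨0, y, by simp⟩
    · exact ⟨1, b * b ^ l, by
        rw [map_mul, ← hn', map_mul, map_pow]; field_simp⟩
    · exact ⟨1, n', by rw [map_mul]; field_simp⟩

/-! ### Plane curves that are quadratic in one coordinate -/

/-- Let `t` be transcendental over `L`, let `w² = h(t)` with `h` separable and nonconstant, and let
`a(t) r = b(t) + b'(t) w`. Then `r` is quadratic over `L(t)`, with primitive equation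
`a(t) r² - 2 b(t) r + c(t) = 0`, which generates all algebraic relations between `r` and `t`. -/
theorem dvd_of_aeval_eq_zero {L E : Type*} [Field L] [CharZero L] [Field E] [Algebra L E]
    {r t w : E} (ht : Transcendental L t) {a b b' c h : L[X]} (ha : a ≠ 0) (hb' : b' ≠ 0)
    (hh : IsCoprime h (derivative h)) (hdeg : 0 < h.natDegree) (hw : w ^ 2 = aeval t h)
    (hr : aeval t a * r = aeval t b + aeval t b' * w) (hac : a * c = b ^ 2 - b' ^ 2 * h)
    (hprim : ∃ x y z : L[X], x * a + y * b + z * c = 1) {F : MvPolynomial (Fin 2) L}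
    (hF : MvPolynomial.aeval ![r, t] F = 0) :
    aeval (MvPolynomial.X 1) a * MvPolynomial.X 0 ^ 2
      - 2 * aeval (MvPolynomial.X 1) b * MvPolynomial.X 0
      + aeval (MvPolynomial.X 1) c ∣ F := by
  have hinj := transcendental_iff_injective.mp ht
  -- pass from `L[r, t]` to `L[t][r]`
  let χ : MvPolynomial (Fin 2) L →ₐ[L] L[X][X] := MvPolynomial.aeval ![X, C X]
  let ψ : L[X][X] →+* MvPolynomial (Fin 2) L :=
    eval₂RingHom (aeval (MvPolynomial.X 1 : MvPolynomial (Fin 2) L)).toRingHom (MvPolynomial.X 0)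
  have hψχ : ∀ G, ψ (χ G) = G := by
    intro G
    induction G using MvPolynomial.induction_on with
    | C x => simp [χ, ψ, Polynomial.algebraMap_apply]
    | add p q hp hq => rw [map_add, map_add, hp, hq]
    | mul_X p i hp =>
      rw [map_mul, map_mul, hp]
      congr 1
      fin_cases i <;> simp [χ, ψ]
  let P : L[X][X] := C a * X ^ 2 - C (2 * b) * X + C c
  have hψP : ψ P = aeval (MvPolynomial.X 1) a * MvPolynomial.X 0 ^ 2
      - 2 * aeval (MvPolynomial.X 1) b * MvPolynomial.X 0 + aeval (MvPolynomial.X 1) c := by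
    simp only [P, ψ, map_add, map_sub, map_mul, map_pow, coe_eval₂RingHom, eval₂_C, eval₂_X]
    simp [map_ofNat (aeval (MvPolynomial.X 1 : MvPolynomial (Fin 2) L)) 2]
  suffices P ∣ χ F by
    rw [← hψP, ← hψχ F]
    exact map_dvd ψ this
  let : Algebra L[X] E := (aeval t).toAlgebra
  have hmap : ∀ p : L[X], algebraMap L[X] E p = aeval t p := fun _ => rfl
  have : IsScalarTower L L[X] E := IsScalarTower.of_algebraMap_eq fun c => by simp [hmap]
  have : FaithfulSMul L[X] E := (faithfulSMul_iff_algebraMap_injective L[X] E).mpr hinj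
  let K := FractionRing L[X]
  let : Algebra K E := FractionRing.liftAlgebra L[X] E
  have : IsScalarTower L[X] K E := FractionRing.isScalarTower_liftAlgebra L[X] E
  have haE : aeval t a ≠ 0 := (map_ne_zero_iff _ hinj).mpr ha
  have hPprim : P.IsPrimitive := by
    obtain ⟨x, y, z, hxyz⟩ := hprim
    intro d hd
    rw [C_dvd_iff_dvd_coeff] at hd
    have h0 : d ∣ c := by simpa [P] using hd 0
    have h1 : d ∣ 2 * b := by simpa [P, coeff_X, coeff_one] using hd 1
    have h2 : d ∣ a := by simpa [P, coeff_X, coeff_C] using hd 2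
    refine isUnit_of_dvd_one ?_
    have h3 : (C (1 / 2) : L[X]) * 2 = 1 := by
      rw [← map_ofNat (C : L →+* L[X]) 2, ← map_mul]; simp
    have : (1 : L[X]) = x * a + (y * C (1 / 2)) * (2 * b) + z * c := by
      rw [← hxyz]; linear_combination (-y * b) * h3
    rw [this]
    exact dvd_add (dvd_add (h2.mul_left _) (h1.mul_left _)) (h0.mul_left _)
  refine hPprim.dvd_of_fraction_map_dvd_fraction_map (K := K) ?_
  have hPr : aeval r (P.map (algebraMap L[X] K)) = 0 := by
    rw [aeval_map_algebraMap]
    have h1 := congrArg (aeval t) hac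
    simp only [map_mul, map_sub, map_pow, ← hw] at h1
    apply mul_left_cancel₀ haE
    simp only [P, map_add, map_sub, map_mul, map_pow, aeval_X, aeval_C, hmap, map_ofNat, mul_zero]
    linear_combination (aeval t a * r - aeval t b + aeval t b' * w) * hr + h1
  have hfr : aeval r ((χ F).map (algebraMap L[X] K)) = 0 := by
    rw [aeval_map_algebraMap, ← hF]
    have : ((aeval r : L[X][X] →ₐ[L[X]] E).restrictScalars L).comp χ
        = MvPolynomial.aeval ![r, t] := by
      ext i
      fin_cases i <;> simp [χ, hmap]
    exact DFunLike.congr_fun this F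
  have hPdeg : (P.map (algebraMap L[X] K)).natDegree = 2 := by
    rw [natDegree_map_eq_of_injective (IsFractionRing.injective L[X] K)]
    simp only [P]
    compute_degree!
  have hP0 : P.map (algebraMap L[X] K) ≠ 0 := by
    intro h0
    rw [h0, natDegree_zero] at hPdeg
    omega
  have hrint : IsIntegral K r := isAlgebraic_iff_isIntegral.mp ⟨_, hP0, hPr⟩
  -- `r` is not in `L(t)` since `w` is not
  have hrK : r ∉ (algebraMap K E).range := by
    rintro ⟨x, rfl⟩
    obtain ⟨n, d, hd, rfl⟩ := IsFractionRing.div_surjective (A := L[X]) x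
    have hd0 : d ≠ 0 := nonZeroDivisors.ne_zero hd
    have hdE : aeval t d ≠ 0 := (map_ne_zero_iff _ hinj).mpr hd0
    rw [map_div₀, ← IsScalarTower.algebraMap_apply, ← IsScalarTower.algebraMap_apply, hmap,
      hmap] at hr
    have := eq_zero_of_add_mul_sqrt_eq_zero ht hh hdeg hw (a := d * b - a * n) (b := d * b')
      (by
        simp only [map_sub, map_mul]
        field_simp at hr
        linear_combination -hr)
    exact mul_ne_zero hd0 hb' this.2
  have hdegm : 2 ≤ (minpoly K r).natDegree := by
    have h1 := minpoly.natDegree_pos hrint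
    have h2 : (minpoly K r).natDegree ≠ 1 := fun h => hrK (minpoly.natDegree_eq_one_iff.mp h)
    omega
  have hassoc := associated_of_dvd_of_natDegree_le (minpoly.dvd K r hPr) hP0
    (hPdeg.trans_le hdegm)
  exact hassoc.symm.dvd.trans (minpoly.dvd K r hfr)

/-- Let `y² = f(r, t)` where `1` and `y` are linearly independent over `L[r, t]`. The algebraic
relations between `r`, `t` and `y` are generated by those between `r` and `t`, together with
`y² = f(r, t)`. -/
theorem mem_of_aeval_eq_zero {L E : Type*} [Field L] [Field E] [Algebra L E] {r t y : E}
    {I : Ideal (MvPolynomial (Fin 2) L)} {f : MvPolynomial (Fin 2) L}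
    (hy : y ^ 2 = MvPolynomial.aeval ![r, t] f)
    (hI : ∀ a b : MvPolynomial (Fin 2) L,
      MvPolynomial.aeval ![r, t] a + MvPolynomial.aeval ![r, t] b * y = 0 → a ∈ I ∧ b ∈ I)
    {F : MvPolynomial (Fin 3) L} (hF : MvPolynomial.aeval ![r, t, y] F = 0) :
    F ∈ Ideal.span {MvPolynomial.aeval ![MvPolynomial.X 0, MvPolynomial.X 1] f
        - MvPolynomial.X 2 ^ 2} ⊔
      I.map (MvPolynomial.aeval (R := L) (σ := Fin 2)
        ![(MvPolynomial.X 0 : MvPolynomial (Fin 3) L), MvPolynomial.X 1]) := by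
  set ι : MvPolynomial (Fin 2) L →ₐ[L] MvPolynomial (Fin 3) L :=
    MvPolynomial.aeval ![MvPolynomial.X 0, MvPolynomial.X 1] with hι
  have hcomp : ∀ G, MvPolynomial.aeval ![r, t, y] (ι G) = MvPolynomial.aeval ![r, t] G := by
    intro G
    have : (MvPolynomial.aeval ![r, t, y]).comp ι = MvPolynomial.aeval (R := L) ![r, t] := by
      ext i
      fin_cases i <;> simp [ι]
    exact DFunLike.congr_fun this G
  have hdiv : ∀ G : MvPolynomial (Fin 3) L, ∃ a b, ∃ c ∈ Ideal.span {ι f - MvPolynomial.X 2 ^ 2},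
      G = ι a + ι b * MvPolynomial.X 2 + c := by
    intro G
    induction G using MvPolynomial.induction_on with
    | C x => exact ⟨MvPolynomial.C x, 0, 0, zero_mem _, by simp [ι, MvPolynomial.algebraMap_eq]⟩
    | add p q hp hq =>
      obtain ⟨a, b, c, hc, rfl⟩ := hp
      obtain ⟨a', b', c', hc', rfl⟩ := hq
      exact ⟨a + a', b + b', c + c', add_mem hc hc', by simp only [map_add]; ring⟩
    | mul_X p i hp =>
      obtain ⟨a, b, c, hc, rfl⟩ := hp
      have h01 : ∀ j : Fin 2, ι (MvPolynomial.X j) = MvPolynomial.X j.castSucc := by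
        intro j
        fin_cases j <;> simp [ι]
      have hcast : ∀ j : Fin 2, ∃ a' b', ∃ c' ∈ Ideal.span {ι f - MvPolynomial.X 2 ^ 2},
          (ι a + ι b * MvPolynomial.X 2 + c) * MvPolynomial.X j.castSucc
            = ι a' + ι b' * MvPolynomial.X 2 + c' := fun j =>
        ⟨a * MvPolynomial.X j, b * MvPolynomial.X j, c * MvPolynomial.X j.castSucc,
          Ideal.mul_mem_right _ _ hc, by rw [map_mul, map_mul, h01]; ring⟩
      fin_cases i
      · exact hcast 0
      · exact hcast 1
      · refine ⟨b * f, a, c * MvPolynomial.X 2 - ι b * (ι f - MvPolynomial.X 2 ^ 2),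
          sub_mem (Ideal.mul_mem_right _ _ hc)
            (Ideal.mul_mem_left _ _ (Ideal.mem_span_singleton_self _)), ?_⟩
        change (ι a + ι b * MvPolynomial.X 2 + c) * MvPolynomial.X 2 = _
        rw [map_mul]
        ring
  obtain ⟨a, b, c, hc, rfl⟩ := hdiv F
  have hc0 : MvPolynomial.aeval ![r, t, y] c = 0 := by
    obtain ⟨d, rfl⟩ := Ideal.mem_span_singleton'.mp hc
    rw [map_mul, map_sub, hcomp, map_pow, MvPolynomial.aeval_X, ← hy]
    simp
  rw [map_add, hc0, add_zero, map_add, map_mul, hcomp, hcomp, MvPolynomial.aeval_X] at hF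
  obtain ⟨haI, hbI⟩ := hI a b hF
  rw [add_comm]
  exact add_mem (Ideal.mem_sup_left hc) (Ideal.mem_sup_right (add_mem (Ideal.mem_map_of_mem ι haI)
    (Ideal.mul_mem_right _ _ (Ideal.mem_map_of_mem ι hbI))))

/-! ### Double covers of curves parametrized through a conic -/

theorem two_mul_sub_ne_zero_of_transcendental {k E : Type*} [Field k] [CharZero k] [Field E]
    [Algebra k E] {s : E} (hs : Transcendental k s) (h₁ : k) :
    2 * s - algebraMap k E h₁ ≠ 0 := by
  have hp : (2 * X - C h₁ : k[X]) ≠ 0 := by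
    intro h0
    have := congrArg (fun p => coeff p 1) h0
    simp [coeff_ofNat_mul] at this
  simpa only [map_sub, map_mul, map_ofNat, aeval_X, aeval_C] using
    (map_ne_zero_iff _ (transcendental_iff_injective.mp hs)).mpr hp

/-- The coordinate `t` of the conic `w² = t² + h₁ t + h₀` is transcendental if the parameter
`s = w - t` is, since `s` is a root of `s² + 2 t s - (h₁ t + h₀)`. -/
theorem transcendental_of_conic {k E : Type*} [Field k] [Field E] [Algebra k E] {s t : E}
    {h₁ h₀ : k} (hs : Transcendental k s)
    (ht : t * (2 * s - algebraMap k E h₁) = algebraMap k E h₀ - s ^ 2) : Transcendental k t := by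
  intro htalg
  refine hs ?_
  have hint : IsIntegral (algebraicClosure k E) s := by
    let t' : algebraicClosure k E := ⟨t, mem_algebraicClosure_iff.mpr htalg⟩
    refine ⟨X ^ 2 + C (2 * t') * X - C (algebraMap k _ h₁ * t' + algebraMap k _ h₀),
      by monicity!, ?_⟩
    rw [← aeval_def]
    simp only [map_add, map_sub, map_mul, map_pow, aeval_X, aeval_C]
    change s ^ 2 + (2 * t) * s - (algebraMap k E h₁ * t + algebraMap k E h₀) = 0
    linear_combination ht
  exact (isIntegral_trans (R := k) (A := algebraicClosure k E) s hint).isAlgebraic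

/-- The ideal of the double cover `y² = f(r, t)` of the plane curve `P(r, t) = 0`. -/
def coverIdeal {k : Type} [Field k] (P f : MvPolynomial (Fin 2) k) :
    Ideal (MvPolynomial (Fin 3) k) :=
  Ideal.span {MvPolynomial.aeval ![MvPolynomial.X 0, MvPolynomial.X 1] f
      - MvPolynomial.X 2 ^ 2} ⊔
    (Ideal.span {P}).map (MvPolynomial.aeval (R := k) (σ := Fin 2)
      ![(MvPolynomial.X 0 : MvPolynomial (Fin 3) k), MvPolynomial.X 1])

/-- A rational parametrization of the plane curve `P(r, t) = 0` through a conic, together with a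
model `v² = q(s)` of its double cover `y² = f(r, t)`.

The polynomial `P = a(t) r² - 2 b(t) r + c(t)` is quadratic in `r` with reduced discriminant
`b(t)² - a(t) c(t) = b'(t)² (t² + h₁ t + h₀)`. The conic `w² = t² + h₁ t + h₀` is parametrized by
`s = w - t`, for which `t (2 s - h₁) = h₀ - s²`. Along the resulting parametrization of the curve,
`f = (m(s) / n(s))² q(s)`. -/
structure ConicCover {k : Type} [Field k] (P f : MvPolynomial (Fin 2) k) where
  (a b b' c : k[X])
  (h₁ h₀ : k)
  (q m n : k[X])
  ha : a ≠ 0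
  hb' : b' ≠ 0
  hm : m ≠ 0
  hn : n ≠ 0
  conic_ne : h₁ ^ 2 - 4 * h₀ ≠ 0
  disc_eq : a * c = b ^ 2 - b' ^ 2 * (X ^ 2 + C h₁ * X + C h₀)
  primitive : ∃ x y z : k[X], x * a + y * b + z * c = 1
  eq_P : P = aeval (MvPolynomial.X 1) a * MvPolynomial.X 0 ^ 2
      - 2 * aeval (MvPolynomial.X 1) b * MvPolynomial.X 0
      + aeval (MvPolynomial.X 1) c
  q_separable : IsCoprime q (derivative q)
  q_natDegree : 0 < q.natDegree
  branch : ∀ {E : Type} [Field E] [Algebra k E] {s r t : E}, Transcendental k s →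
    t * (2 * s - algebraMap k E h₁) = algebraMap k E h₀ - s ^ 2 →
    aeval t a * r = aeval t b + aeval t b' * (t + s) →
    MvPolynomial.aeval ![r, t] f * aeval s n ^ 2 = aeval s m ^ 2 * aeval s q

namespace ConicCover

variable {k : Type} [Field k] {P f : MvPolynomial (Fin 2) k}

/-- Base change of a parametrized double cover to an extension field. -/
def baseChange (D : ConicCover P f) (L : Type) [Field L] [Algebra k L] :
    ConicCover (MvPolynomial.map (algebraMap k L) P) (MvPolynomial.map (algebraMap k L) f) where
  a := D.a.map (algebraMap k L)
  b := D.b.map (algebraMap k L)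
  b' := D.b'.map (algebraMap k L)
  c := D.c.map (algebraMap k L)
  h₁ := algebraMap k L D.h₁
  h₀ := algebraMap k L D.h₀
  q := D.q.map (algebraMap k L)
  m := D.m.map (algebraMap k L)
  n := D.n.map (algebraMap k L)
  ha := (Polynomial.map_ne_zero_iff (algebraMap k L).injective).mpr D.ha
  hb' := (Polynomial.map_ne_zero_iff (algebraMap k L).injective).mpr D.hb'
  hm := (Polynomial.map_ne_zero_iff (algebraMap k L).injective).mpr D.hm
  hn := (Polynomial.map_ne_zero_iff (algebraMap k L).injective).mpr D.hn
  conic_ne := by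
    have := (map_ne_zero (algebraMap k L)).mpr D.conic_ne
    simpa only [map_sub, map_mul, map_pow, map_ofNat] using this
  disc_eq := by
    have := congrArg (Polynomial.map (algebraMap k L)) D.disc_eq
    simpa using this
  primitive := by
    obtain ⟨x, y, z, h⟩ := D.primitive
    refine ⟨x.map (algebraMap k L), y.map (algebraMap k L), z.map (algebraMap k L), ?_⟩
    simpa using congrArg (Polynomial.map (algebraMap k L)) h
  eq_P := by
    have hmap : ∀ p : k[X], MvPolynomial.map (algebraMap k L)
        (aeval (MvPolynomial.X 1 : MvPolynomial (Fin 2) k) p)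
        = aeval (MvPolynomial.X 1) (p.map (algebraMap k L)) := fun p => by
      rw [aeval_map_algebraMap]
      have := (aeval_algHom_apply (MvPolynomial.mapAlgHom (Algebra.ofId k L))
        (MvPolynomial.X 1 : MvPolynomial (Fin 2) k) p).symm
      simpa using this
    conv_lhs => rw [D.eq_P]
    simp only [map_add, map_sub, map_mul, map_pow, MvPolynomial.map_X, hmap, map_ofNat]
  q_separable := by
    have := D.q_separable.map (Polynomial.mapRingHom (algebraMap k L))
    simpa [derivative_map] using this
  q_natDegree := by
    rw [natDegree_map]
    exact D.q_natDegree
  branch := by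
    intro E _ _ s r t hs ht hr
    let : Algebra k E := ((algebraMap L E).comp (algebraMap k L)).toAlgebra
    have : IsScalarTower k L E := IsScalarTower.of_algebraMap_eq' rfl
    simp only [aeval_map_algebraMap, MvPolynomial.aeval_map_algebraMap] at hr ⊢
    exact D.branch (fun h => hs (h.tower_top L)) ht hr

/-- `(s, r, t, v, y)` is a generic point of the double cover, described by the coordinates `(s, v)`
of the model `v² = q(s)` and the coordinates `(r, t, y)` of the embedding. -/
structure IsGenericPoint (D : ConicCover P f) {E : Type} [Field E] [Algebra k E]
    (s r t v y : E) : Prop where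
  transcendental : Transcendental k s
  t_eq : t * (2 * s - algebraMap k E D.h₁) = algebraMap k E D.h₀ - s ^ 2
  r_eq : aeval t D.a * r = aeval t D.b + aeval t D.b' * (t + s)
  v_eq : v ^ 2 = aeval s D.q
  y_eq : y * aeval s D.n = aeval s D.m * v

namespace IsGenericPoint

variable {D : ConicCover P f} {E : Type} [Field E] [Algebra k E] {s r t v y : E}

theorem aeval_ne_zero (h : D.IsGenericPoint s r t v y) {p : k[X]} (hp : p ≠ 0) :
    aeval s p ≠ 0 :=
  (map_ne_zero_iff _ (transcendental_iff_injective.mp h.transcendental)).mpr hp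

theorem aeval_t_ne_zero (h : D.IsGenericPoint s r t v y) {p : k[X]} (hp : p ≠ 0) :
    aeval t p ≠ 0 :=
  (map_ne_zero_iff _ (transcendental_iff_injective.mp
    (transcendental_of_conic h.transcendental h.t_eq))).mpr hp

variable [CharZero k]

theorem aeval_eq_zero_iff_dvd (h : D.IsGenericPoint s r t v y) {F : MvPolynomial (Fin 2) k} :
    MvPolynomial.aeval ![r, t] F = 0 ↔ P ∣ F := by
  set hpoly : k[X] := X ^ 2 + C D.h₁ * X + C D.h₀ with hpoly_def
  have hsep : IsCoprime hpoly (derivative hpoly) := by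
    -- `(2 X + h₁)² - 4 (X² + h₁ X + h₀)` is the nonzero constant `h₁² - 4 h₀`
    refine ⟨C (-4 / (D.h₁ ^ 2 - 4 * D.h₀)),
      C (1 / (D.h₁ ^ 2 - 4 * D.h₀)) * (2 * X + C D.h₁), ?_⟩
    have h1 : derivative hpoly = 2 * X + C D.h₁ := by
      simp [hpoly_def, one_add_one_eq_two, map_ofNat (C : k →+* k[X])]
    have h2 : C (1 / (D.h₁ ^ 2 - 4 * D.h₀)) * (C (D.h₁ ^ 2 - 4 * D.h₀) : k[X]) = 1 := by
      rw [← map_mul, one_div, inv_mul_cancel₀ D.conic_ne, map_one]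
    have h3 : (C (-4 / (D.h₁ ^ 2 - 4 * D.h₀)) : k[X])
        = -4 * C (1 / (D.h₁ ^ 2 - 4 * D.h₀)) := by
      rw [← map_ofNat (C : k →+* k[X]) 4, ← map_neg, ← map_mul]
      congr 1
      ring
    rw [h1, h3, ← h2, hpoly_def]
    simp only [map_sub, map_mul, map_pow, map_ofNat]
    ring
  have hw : (t + s) ^ 2 = aeval t hpoly := by
    simp only [hpoly_def, map_add, map_mul, map_pow, aeval_X, aeval_C]
    linear_combination h.t_eq
  have hdeg : hpoly.natDegree = 2 := by rw [hpoly_def]; compute_degree!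
  constructor
  · intro hF
    have := dvd_of_aeval_eq_zero
      (transcendental_of_conic h.transcendental h.t_eq) D.ha D.hb' hsep (by omega) hw h.r_eq
      D.disc_eq D.primitive hF
    rwa [← D.eq_P] at this
  · rintro ⟨G, rfl⟩
    have hP : MvPolynomial.aeval ![r, t] P = 0 := by
      have hX : ∀ p : k[X], MvPolynomial.aeval ![r, t]
          (aeval (MvPolynomial.X 1 : MvPolynomial (Fin 2) k) p) = aeval t p := fun p => by
        rw [← aeval_algHom_apply, MvPolynomial.aeval_X]
        rfl
      have h1 := congrArg (aeval t) D.disc_eq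
      simp only [map_mul, map_sub, map_pow] at h1
      rw [← hpoly_def, ← hw] at h1
      apply mul_left_cancel₀ (h.aeval_t_ne_zero D.ha)
      refine (congrArg (aeval t D.a * MvPolynomial.aeval ![r, t] ·) D.eq_P).trans ?_
      simp only [map_add, map_sub, map_mul, map_pow, hX, MvPolynomial.aeval_X, map_ofNat, mul_zero]
      change aeval t D.a * (aeval t D.a * r ^ 2 - 2 * aeval t D.b * r + aeval t D.c) = 0
      linear_combination
        (aeval t D.a * r - aeval t D.b + aeval t D.b' * (t + s)) * h.r_eq + h1
    rw [map_mul, hP, zero_mul]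

/-- The values of polynomials in `r` and `t` are rational functions of `s`. -/
theorem exists_mul_aeval_eq (h : D.IsGenericPoint s r t v y) (F : MvPolynomial (Fin 2) k) :
    ∃ d p : k[X], d ≠ 0 ∧ aeval s d * MvPolynomial.aeval ![r, t] F = aeval s p := by
  suffices H : MvPolynomial.aeval ![r, t] F ∈ IntermediateField.adjoin k {s} by
    obtain ⟨p, d, hpd⟩ := (IntermediateField.mem_adjoin_simple_iff k _).mp H
    by_cases hd : d = 0
    · exact ⟨1, 0, one_ne_zero, by simp [hpd, hd]⟩
    · exact ⟨d, p, hd, by rw [hpd, mul_div_cancel₀ _ (h.aeval_ne_zero hd)]⟩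
  set M := IntermediateField.adjoin k {s}
  have hs : s ∈ M := IntermediateField.mem_adjoin_simple_self k s
  have ht : t ∈ M := by
    rw [eq_div_of_mul_eq (two_mul_sub_ne_zero_of_transcendental h.transcendental _) h.t_eq]
    exact div_mem (sub_mem (M.algebraMap_mem _) (pow_mem hs 2))
      (sub_mem (mul_mem (ofNat_mem M 2) hs) (M.algebraMap_mem _))
  have hat : ∀ p : k[X], aeval t p ∈ M := fun p => by
    have := (aeval (⟨t, ht⟩ : M) p).2
    rwa [← IntermediateField.aeval_coe] at this
  have hr : r ∈ M := by
    rw [eq_div_of_mul_eq (h.aeval_t_ne_zero D.ha) ((mul_comm _ _).trans h.r_eq)]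
    exact div_mem (add_mem (hat _) (mul_mem (hat _) (add_mem ht hs))) (hat _)
  have hadj : MvPolynomial.aeval ![r, t] F ∈ Algebra.adjoin k (Set.range ![r, t]) := by
    rw [Algebra.adjoin_range_eq_range_aeval]
    exact ⟨F, rfl⟩
  refine (Algebra.adjoin_le ?_ : _ ≤ M.toSubalgebra) hadj
  rintro _ ⟨i, rfl⟩
  fin_cases i
  · exact hr
  · exact ht

theorem aeval_eq_zero_iff_mem_coverIdeal (h : D.IsGenericPoint s r t v y)
    {F : MvPolynomial (Fin 3) k} :
    MvPolynomial.aeval ![r, t, y] F = 0 ↔ F ∈ coverIdeal P f := by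
  have hn := h.aeval_ne_zero D.hn
  have hy : y ^ 2 = MvPolynomial.aeval ![r, t] f := by
    apply mul_right_cancel₀ (pow_ne_zero 2 hn)
    rw [D.branch h.transcendental h.t_eq h.r_eq, ← h.v_eq]
    linear_combination (y * aeval s D.n + aeval s D.m * v) * h.y_eq
  constructor
  · refine mem_of_aeval_eq_zero hy ?_
    intro α β hαβ
    obtain ⟨d, p, hd, hp⟩ := h.exists_mul_aeval_eq α
    obtain ⟨d', p', hd', hp'⟩ := h.exists_mul_aeval_eq β
    have h0 := eq_zero_of_add_mul_sqrt_eq_zero h.transcendental D.q_separable D.q_natDegree h.v_eq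
      (a := D.n * d' * p) (b := d * p' * D.m) (by
        simp only [map_mul, ← hp, ← hp']
        linear_combination aeval s d * aeval s d' * aeval s D.n * hαβ
          - aeval s d * aeval s d' * MvPolynomial.aeval ![r, t] β * h.y_eq)
    rw [mul_eq_zero, or_iff_right (mul_ne_zero D.hn hd'), mul_eq_zero, or_iff_left D.hm,
      mul_eq_zero, or_iff_right hd] at h0
    rw [h0.1, map_zero, mul_eq_zero, or_iff_right (h.aeval_ne_zero hd),
      h.aeval_eq_zero_iff_dvd] at hp
    rw [h0.2, map_zero, mul_eq_zero, or_iff_right (h.aeval_ne_zero hd'),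
      h.aeval_eq_zero_iff_dvd] at hp'
    exact ⟨Ideal.mem_span_singleton.mpr hp, Ideal.mem_span_singleton.mpr hp'⟩
  · intro hF
    have hcomp : ∀ G, MvPolynomial.aeval ![r, t, y] (MvPolynomial.aeval (R := k)
        ![(MvPolynomial.X 0 : MvPolynomial (Fin 3) k), MvPolynomial.X 1] G)
        = MvPolynomial.aeval ![r, t] G := by
      intro G
      have : (MvPolynomial.aeval ![r, t, y]).comp (MvPolynomial.aeval (R := k)
          ![(MvPolynomial.X 0 : MvPolynomial (Fin 3) k), MvPolynomial.X 1])
          = MvPolynomial.aeval (R := k) ![r, t] := by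
        ext i
        fin_cases i <;> simp
      exact DFunLike.congr_fun this G
    have hle : coverIdeal P f ≤ RingHom.ker (MvPolynomial.aeval (R := k) ![r, t, y]) := by
      refine sup_le ?_ ?_
      · rw [Ideal.span_singleton_le_iff_mem, RingHom.mem_ker, map_sub, hcomp, ← hy]
        simp
      · rw [Ideal.map_span, Set.image_singleton, Ideal.span_singleton_le_iff_mem, RingHom.mem_ker,
          hcomp, h.aeval_eq_zero_iff_dvd]
    exact hle hF

end IsGenericPoint

/-- A parametrized double cover has a generic point over some extension field. -/
theorem exists_isGenericPoint [CharZero k] (D : ConicCover P f) :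
    ∃ (E : Type) (_ : Field E) (_ : Algebra k E) (s r t v y : E), D.IsGenericPoint s r t v y := by
  let E := AlgebraicClosure (RatFunc k)
  let s : E := algebraMap (RatFunc k) E RatFunc.X
  have hs : Transcendental k s :=
    (transcendental_algebraMap_iff (algebraMap (RatFunc k) E).injective).mpr
      RatFunc.transcendental_X
  obtain ⟨v, hv⟩ := IsAlgClosed.exists_pow_nat_eq (aeval s D.q) two_pos
  have hinj := transcendental_iff_injective.mp hs
  let t : E := (algebraMap k E D.h₀ - s ^ 2) / (2 * s - algebraMap k E D.h₁)
  have ht : t * (2 * s - algebraMap k E D.h₁) = algebraMap k E D.h₀ - s ^ 2 :=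
    div_mul_cancel₀ _ (two_mul_sub_ne_zero_of_transcendental hs _)
  have ha : aeval t D.a ≠ 0 := (map_ne_zero_iff _
    (transcendental_iff_injective.mp (transcendental_of_conic hs ht))).mpr D.ha
  have hn : aeval s D.n ≠ 0 := (map_ne_zero_iff _ hinj).mpr D.hn
  exact ⟨E, inferInstance, inferInstance, s,
    (aeval t D.b + aeval t D.b' * (t + s)) / aeval t D.a, t, v, aeval s D.m * v / aeval s D.n,
    hs, ht, mul_div_cancel₀ _ ha, hv, div_mul_cancel₀ _ hn⟩

end ConicCover

/-! ### Function field, irreducibility and genus of the double cover -/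

/-- A function field of the form `k(s, v)` with `s` transcendental and `v` algebraic over `k(s)`
has transcendence degree one. -/
theorem trdeg_eq_one_of_adjoin_eq_top {k K : Type} [Field k] [Field K] [Algebra k K] {s v : K}
    (hs : Transcendental k s) {q : k[X]} (hv : v ^ 2 = aeval s q)
    (hK : IntermediateField.adjoin k {s, v} = ⊤) : Algebra.trdeg k K = 1 := by
  have hsA : s ∈ Algebra.adjoin k (Set.range fun _ : Unit => s) :=
    Algebra.subset_adjoin ⟨(), rfl⟩
  have hbasis : IsTranscendenceBasis k (fun _ : Unit => s) := by
    rw [isTranscendenceBasis_iff_algebraicIndependent_isAlgebraic]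
    refine ⟨algebraicIndependent_unique_type_iff.mpr hs, ⟨fun x => ?_⟩⟩
    have hx : x ∈ IntermediateField.adjoin k {s, v} := hK ▸ IntermediateField.mem_top
    induction hx using IntermediateField.adjoin_induction with
    | mem x hx =>
      have hsalg := isAlgebraic_algebraMap (R := Algebra.adjoin k (Set.range fun _ : Unit => s))
        (A := K) ⟨s, hsA⟩
      rcases hx with rfl | rfl
      · exact hsalg
      · refine IsAlgebraic.of_pow two_pos ?_
        rw [hv]
        exact isAlgebraic_algebraMap
          (⟨aeval s q, (Algebra.adjoin_mono (by simp) :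
            Algebra.adjoin k {s} ≤ Algebra.adjoin k (Set.range fun _ : Unit => s))
              (aeval_mem_adjoin_singleton k s)⟩ : Algebra.adjoin k (Set.range fun _ : Unit => s))
    | algebraMap x =>
      rw [IsScalarTower.algebraMap_apply k (Algebra.adjoin k (Set.range fun _ : Unit => s)) K]
      exact isAlgebraic_algebraMap _
    | add x y _ _ hx hy => exact hx.add hy
    | mul x y _ _ hx hy => exact hx.mul hy
    | inv x _ hx => exact hx.inv
  rw [← hbasis.cardinalMk_eq_trdeg, Cardinal.mk_unit]

/-- The function field of `V(I)` is generated by the coordinate functions. -/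
theorem intermediateField_eq_top_of_X_mem {k σ : Type} [Field k] (I : Ideal (MvPolynomial σ k))
    [I.IsPrime] {M : IntermediateField k (FunctionField I)}
    (hM : ∀ i, algebraMap (CoordRing I) (FunctionField I)
      (Ideal.Quotient.mk I (MvPolynomial.X i)) ∈ M) : M = ⊤ := by
  have hF : ∀ x : CoordRing I, algebraMap (CoordRing I) (FunctionField I) x ∈ M := by
    intro x
    obtain ⟨F, rfl⟩ := Ideal.Quotient.mk_surjective x
    induction F using MvPolynomial.induction_on with
    | C c =>
      have : algebraMap (CoordRing I) (FunctionField I) (Ideal.Quotient.mk I (MvPolynomial.C c))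
          = algebraMap k (FunctionField I) c := by
        rw [IsScalarTower.algebraMap_apply k (CoordRing I) (FunctionField I)]
        rfl
      rw [this]
      exact M.algebraMap_mem c
    | add p q hp hq =>
      rw [map_add, map_add]
      exact add_mem hp hq
    | mul_X p i hp =>
      rw [map_mul, map_mul]
      exact mul_mem hp (hM i)
  rw [eq_top_iff]
  intro z _
  obtain ⟨x, y, -, rfl⟩ := IsFractionRing.div_surjective (A := CoordRing I) z
  exact div_mem (hF x) (hF y)

/-- If `I` is the ideal of relations of a point `x` with coordinates in a field `E`, then the
function field of `V(I)` embeds into `E`, mapping the coordinate functions to the coordinates. -/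
theorem exists_functionField_algHom {k σ E : Type} [Field k] [Field E] [Algebra k E]
    {I : Ideal (MvPolynomial σ k)} {x : σ → E}
    (hI : ∀ F, MvPolynomial.aeval x F = 0 ↔ F ∈ I) [I.IsPrime] :
    ∃ τ : FunctionField I →ₐ[k] E, ∀ i, τ (algebraMap (CoordRing I) (FunctionField I)
      (Ideal.Quotient.mk I (MvPolynomial.X i))) = x i := by
  let g : CoordRing I →ₐ[k] E := Ideal.Quotient.liftₐ I (MvPolynomial.aeval x)
    fun F hF => (hI F).mpr hF
  have hg : Function.Injective g := by
    rw [injective_iff_map_eq_zero]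
    intro a ha
    obtain ⟨F, rfl⟩ := Ideal.Quotient.mk_surjective a
    exact Ideal.Quotient.eq_zero_iff_mem.mpr ((hI F).mp ha)
  refine ⟨IsFractionRing.liftAlgHom hg, fun i => ?_⟩
  rw [IsFractionRing.liftAlgHom_apply, IsFractionRing.lift_algebraMap]
  exact MvPolynomial.aeval_X x i

theorem isPrime_of_aeval_eq_zero_iff {k σ E : Type*} [Field k] [Field E] [Algebra k E]
    {I : Ideal (MvPolynomial σ k)} {x : σ → E}
    (hI : ∀ F, MvPolynomial.aeval x F = 0 ↔ F ∈ I) : I.IsPrime := by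
  have : I = RingHom.ker (MvPolynomial.aeval (R := k) x) := by
    ext F
    rw [← hI, RingHom.mem_ker]
  rw [this]
  exact RingHom.ker_isPrime _

theorem map_coverIdeal {k L : Type} [Field k] [Field L] (φ : k →+* L)
    (P f : MvPolynomial (Fin 2) k) :
    (coverIdeal P f).map (MvPolynomial.map φ)
      = coverIdeal (MvPolynomial.map φ P) (MvPolynomial.map φ f) := by
  have hcomm : ∀ G : MvPolynomial (Fin 2) k, MvPolynomial.map φ (MvPolynomial.aeval (R := k)
      ![(MvPolynomial.X 0 : MvPolynomial (Fin 3) k), MvPolynomial.X 1] G)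
      = MvPolynomial.aeval (R := L) ![(MvPolynomial.X 0 : MvPolynomial (Fin 3) L),
        MvPolynomial.X 1] (MvPolynomial.map φ G) := by
    intro G
    induction G using MvPolynomial.induction_on with
    | C c => simp [MvPolynomial.algebraMap_eq]
    | add p q hp hq => simp only [map_add, hp, hq]
    | mul_X p i hp =>
      rw [map_mul, map_mul, map_mul, map_mul, hp]
      congr 1
      fin_cases i <;> simp
  simp only [coverIdeal, Ideal.map_sup, Ideal.map_span, Set.image_singleton, map_sub, map_pow,
    MvPolynomial.map_X, hcomm]

namespace ConicCover

variable {k : Type} [Field k] [CharZero k] {P f : MvPolynomial (Fin 2) k}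

theorem isPrime_span (D : ConicCover P f) : (Ideal.span {P}).IsPrime := by
  obtain ⟨E, _, _, s, r, t, v, y, h⟩ := D.exists_isGenericPoint
  exact isPrime_of_aeval_eq_zero_iff fun F =>
    h.aeval_eq_zero_iff_dvd.trans Ideal.mem_span_singleton.symm

theorem isPrime_coverIdeal (D : ConicCover P f) : (coverIdeal P f).IsPrime := by
  obtain ⟨E, _, _, s, r, t, v, y, h⟩ := D.exists_isGenericPoint
  exact isPrime_of_aeval_eq_zero_iff fun F => h.aeval_eq_zero_iff_mem_coverIdeal

/-- A field containing `r` and `t` contains the parameter `s`, and vice versa. -/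
theorem IsGenericPoint.exists_parameter {D : ConicCover P f} {E K : Type} [Field E] [Algebra k E]
    {s r t v y : E} (h : D.IsGenericPoint s r t v y) [Field K] [Algebra k K] (τ : K →ₐ[k] E)
    {r' t' : K} (hr : τ r' = r) (ht : τ t' = t) :
    ∃ s', τ s' = s ∧ ∀ M : IntermediateField k K, s' ∈ M → r' ∈ M ∧ t' ∈ M := by
  have hτinj : Function.Injective τ := τ.toRingHom.injective
  have hτa : ∀ p : k[X], τ (aeval t' p) = aeval t p := fun p => by
    rw [← aeval_algHom_apply, ht]
  let s' := (aeval t' D.a * r' - aeval t' D.b) / aeval t' D.b' - t'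
  have hτs : τ s' = s := by
    simp only [s', map_sub, map_div₀, map_mul, hτa, hr, ht]
    have := h.aeval_t_ne_zero D.hb'
    field_simp
    linear_combination h.r_eq
  refine ⟨s', hτs, fun M hsM => ?_⟩
  have htM : t' ∈ M := by
    have : t' = (algebraMap k _ D.h₀ - s' ^ 2) / (2 * s' - algebraMap k _ D.h₁) := by
      apply hτinj
      simp only [map_sub, map_div₀, map_mul, map_pow, hτs, ht, AlgHom.commutes, map_ofNat]
      exact eq_div_of_mul_eq (two_mul_sub_ne_zero_of_transcendental h.transcendental _) h.t_eq
    rw [this]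
    exact div_mem (sub_mem (M.algebraMap_mem _) (pow_mem hsM 2))
      (sub_mem (mul_mem (ofNat_mem M 2) hsM) (M.algebraMap_mem _))
  have haM : ∀ p : k[X], aeval t' p ∈ M := fun p => by
    have := (aeval (⟨t', htM⟩ : M) p).2
    rwa [← IntermediateField.aeval_coe] at this
  refine ⟨?_, htM⟩
  have : r' = (aeval t' D.b + aeval t' D.b' * (t' + s')) / aeval t' D.a := by
    apply hτinj
    simp only [map_add, map_div₀, map_mul, hτs, ht, hτa, hr]
    exact eq_div_of_mul_eq (h.aeval_t_ne_zero D.ha) ((mul_comm _ _).trans h.r_eq)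
  rw [this]
  exact div_mem (add_mem (haM _) (mul_mem (haM _) (add_mem htM hsM))) (haM _)

/-- The function field of the plane curve is `k(s)`. -/
theorem exists_functionField_plane (D : ConicCover P f) [(Ideal.span {P}).IsPrime] :
    ∃ s : FunctionField (Ideal.span {P}), Transcendental k s ∧
      IntermediateField.adjoin k {s} = ⊤ := by
  obtain ⟨E, _, _, s, r, t, v, y, h⟩ := D.exists_isGenericPoint
  obtain ⟨τ, hτ⟩ := exists_functionField_algHom (I := Ideal.span {P}) (x := ![r, t])
    fun F => h.aeval_eq_zero_iff_dvd.trans Ideal.mem_span_singleton.symm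
  obtain ⟨s', hs', hM⟩ := h.exists_parameter τ (hτ 0) (hτ 1)
  refine ⟨s', fun halg => h.transcendental (hs' ▸ halg.algHom τ),
    intermediateField_eq_top_of_X_mem _ fun i => ?_⟩
  have := hM _ (IntermediateField.mem_adjoin_simple_self k s')
  fin_cases i
  · exact this.1
  · exact this.2

/-- The function field of the double cover is `k(s, v)` with `v² = q(s)`. -/
theorem exists_functionField_cover (D : ConicCover P f) [(coverIdeal P f).IsPrime] :
    ∃ s v : FunctionField (coverIdeal P f), Transcendental k s ∧ v ^ 2 = aeval s D.q ∧
      IntermediateField.adjoin k {s, v} = ⊤ := by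
  obtain ⟨E, _, _, s, r, t, v, y, h⟩ := D.exists_isGenericPoint
  obtain ⟨τ, hτ⟩ := exists_functionField_algHom (I := coverIdeal P f) (x := ![r, t, y])
    fun F => h.aeval_eq_zero_iff_mem_coverIdeal
  have hτinj : Function.Injective τ := τ.toRingHom.injective
  obtain ⟨s', hs', hM⟩ := h.exists_parameter τ (hτ 0) (hτ 1)
  have hτa : ∀ p : k[X], τ (aeval s' p) = aeval s p := fun p => by
    rw [← aeval_algHom_apply, hs']
  have hτy := hτ 2
  generalize hy' : algebraMap (CoordRing (coverIdeal P f)) (FunctionField (coverIdeal P f))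
    (Ideal.Quotient.mk _ (MvPolynomial.X 2)) = y' at hτy
  have hτy' : τ y' = y := hτy
  let v' := y' * aeval s' D.n / aeval s' D.m
  have hτv : τ v' = v := by
    simp only [v', map_div₀, map_mul, hτa, hτy']
    rw [h.y_eq, mul_div_cancel_left₀ _ (h.aeval_ne_zero D.hm)]
  refine ⟨s', v', fun halg => h.transcendental (hs' ▸ halg.algHom τ),
    hτinj (by rw [map_pow, hτv, hτa, h.v_eq]), intermediateField_eq_top_of_X_mem _ fun i => ?_⟩
  set M := IntermediateField.adjoin k {s', v'}
  have hsM : s' ∈ M := IntermediateField.subset_adjoin _ _ (by simp)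
  have hvM : v' ∈ M := IntermediateField.subset_adjoin _ _ (by simp)
  have haM : ∀ p : k[X], aeval s' p ∈ M := fun p => by
    have := (aeval (⟨s', hsM⟩ : M) p).2
    rwa [← IntermediateField.aeval_coe] at this
  have hyM : y' ∈ M := by
    have : y' = aeval s' D.m * v' / aeval s' D.n := by
      apply hτinj
      simp only [map_div₀, map_mul, hτa, hτv, hτy']
      exact eq_div_of_mul_eq (h.aeval_ne_zero D.hn) h.y_eq
    rw [this]
    exact div_mem (mul_mem (haM _) hvM) (haM _)
  fin_cases i
  · exact (hM M hsM).1
  · exact (hM M hsM).2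
  · exact hy' ▸ hyM

theorem isCurve_span (D : ConicCover P f) : IsCurve (Ideal.span {P}) := by
  refine ⟨?_, ?_⟩
  · rw [Ideal.map_span, Set.image_singleton]
    exact (D.baseChange (AlgebraicClosure k)).isPrime_span
  · have := D.isPrime_span
    obtain ⟨s, hs, hK⟩ := D.exists_functionField_plane
    exact trdeg_eq_one_of_adjoin_eq_top (v := s) hs (q := X ^ 2) (by simp)
      (by rw [Set.pair_eq_singleton, hK])

theorem genus_span (D : ConicCover P f) : genus (Ideal.span {P}) = 0 := by
  have := D.isPrime_span
  obtain ⟨s, hs, hK⟩ := D.exists_functionField_plane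
  exact finrank_regularDifferentials_eq_zero hs hK

theorem isCurve_coverIdeal (D : ConicCover P f) : IsCurve (coverIdeal P f) := by
  refine ⟨?_, ?_⟩
  · rw [map_coverIdeal]
    exact (D.baseChange (AlgebraicClosure k)).isPrime_coverIdeal
  · have := D.isPrime_coverIdeal
    obtain ⟨s, v, hs, hv, hK⟩ := D.exists_functionField_cover
    exact trdeg_eq_one_of_adjoin_eq_top hs hv hK

theorem genus_coverIdeal (D : ConicCover P f) {q' : k[X]}
    (hq' : IsCoprime q' (derivative q')) (hdeg' : 0 < q'.natDegree)
    (hqq' : ∀ {E : Type} [Field E] [Algebra k E] {s : E}, s ≠ 0 →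
      aeval s D.q = s ^ 4 * aeval s⁻¹ q') : genus (coverIdeal P f) = 1 := by
  have := D.isPrime_coverIdeal
  obtain ⟨s, v, hs, hv, hK⟩ := D.exists_functionField_cover
  exact finrank_regularDifferentials_eq_one hs D.q_separable D.q_natDegree hv hq' hdeg'
    (hqq' (by rintro rfl; exact hs isAlgebraic_zero)) hK

end ConicCover

/-! ### The branch polynomial along the curves `Dᵢ` -/

namespace Exotic

theorem aeval_branchPoly {E : Type*} [CommRing E] [Algebra ℚ E] (r t : E) :
    MvPolynomial.aeval ![r, t] branchPoly =
      (1 + r - 2 * r ^ 2 * t - t ^ 2 + r * t ^ 2) *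
      (-1 + r + 2 * r ^ 2 * t + t ^ 2 + r * t ^ 2) *
      (-r - r ^ 2 - 2 * t - r * t ^ 2 + r ^ 2 * t ^ 2) *
      (r - r ^ 2 - 2 * t + r * t ^ 2 + r ^ 2 * t ^ 2) := by
  simp [branchPoly]

theorem pullback_curveD (i : Fin 3) : pullback (curveD i) = coverIdeal (polyD i) branchPoly := rfl

/-- The restriction of the branch polynomial to `D₁`, in terms of the parameter `s`. -/
theorem aeval_branchPoly_zero {E : Type*} [Field E] [Algebra ℚ E] {s r t : E}
    (h1 : 2 * s + 4 ≠ 0) (h2 : s ^ 2 - 7 ≠ 0) (ht : t = (1 - s ^ 2) / (2 * s + 4))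
    (hr : r = (3 + 4 * s - s ^ 2) / (s ^ 2 - 7)) :
    MvPolynomial.aeval ![r, t] branchPoly * ((s ^ 3 + 2 * s ^ 2 - 7 * s - 14) ^ 4) ^ 2 =
      (1 / 2 * (s ^ 2 - 2 * s - 5) * (s ^ 5 - s ^ 4 + 2 * s ^ 3 + 14 * s ^ 2 + s - 17) ^ 2) ^ 2 *
      (-15 * s ^ 4 + 60 * s ^ 3 + 114 * s ^ 2 - 348 * s - 351) := by
  have : CharZero E := algebraRat.charZero E
  have h1' : s + 2 ≠ 0 := fun h => h1 (by linear_combination 2 * h)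
  rw [aeval_branchPoly]
  have f1 : 1 + r - 2 * r ^ 2 * t - t ^ 2 + r * t ^ 2 = -1 / 2 * (s ^ 6 - 2 * s ^ 5 - 7 * s ^ 4
      + 12 * s ^ 3 - 33 * s ^ 2 - 178 * s - 153) * (s - 1) ^ 2
      / (s ^ 3 + 2 * s ^ 2 - 7 * s - 14) ^ 2 := by
    rw [show s ^ 3 + 2 * s ^ 2 - 7 * s - 14 = (s + 2) * (s ^ 2 - 7) by ring, hr, ht,
      show 2 * s + 4 = 2 * (s + 2) by ring]
    field_simp
    ring
  have f2 : -1 + r + 2 * r ^ 2 * t + t ^ 2 + r * t ^ 2 = 3 * (s ^ 6 - 2 * s ^ 5 - 3 * s ^ 4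
      + 12 * s ^ 3 - 25 * s ^ 2 - 114 * s - 85) / (s ^ 3 + 2 * s ^ 2 - 7 * s - 14) ^ 2 := by
    rw [show s ^ 3 + 2 * s ^ 2 - 7 * s - 14 = (s + 2) * (s ^ 2 - 7) by ring, hr, ht,
      show 2 * s + 4 = 2 * (s + 2) by ring]
    field_simp
    ring
  have f3 : -r - r ^ 2 - 2 * t - r * t ^ 2 + r ^ 2 * t ^ 2 = 1 / 2 * (s ^ 6 - 2 * s ^ 5 - 3 * s ^ 4
      + 12 * s ^ 3 - 25 * s ^ 2 - 114 * s - 85) * (s - 1) ^ 2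
      / (s ^ 3 + 2 * s ^ 2 - 7 * s - 14) ^ 2 := by
    rw [show s ^ 3 + 2 * s ^ 2 - 7 * s - 14 = (s + 2) * (s ^ 2 - 7) by ring, hr, ht,
      show 2 * s + 4 = 2 * (s + 2) by ring]
    field_simp
    ring
  have f4 : r - r ^ 2 - 2 * t + r * t ^ 2 + r ^ 2 * t ^ 2 = (5 * s ^ 6 - 10 * s ^ 5 - 3 * s ^ 4
      + 60 * s ^ 3 - 101 * s ^ 2 - 378 * s - 221) / (s ^ 3 + 2 * s ^ 2 - 7 * s - 14) ^ 2 := by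
    rw [show s ^ 3 + 2 * s ^ 2 - 7 * s - 14 = (s + 2) * (s ^ 2 - 7) by ring, hr, ht,
      show 2 * s + 4 = 2 * (s + 2) by ring]
    field_simp
    ring
  have hd : s ^ 3 + 2 * s ^ 2 - 7 * s - 14 ≠ 0 := by
    rw [show s ^ 3 + 2 * s ^ 2 - 7 * s - 14 = (s + 2) * (s ^ 2 - 7) by ring]
    exact mul_ne_zero h1' h2
  rw [f1, f2, f3, f4]
  generalize s ^ 3 + 2 * s ^ 2 - 7 * s - 14 = d at hd
  field_simp
  ring

/-- The restriction of the branch polynomial to `D₂`, in terms of the parameter `s`. -/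
theorem aeval_branchPoly_one {E : Type*} [Field E] [Algebra ℚ E] {s r t : E}
    (h1 : s ≠ 0) (h2 : s + 3 ≠ 0) (ht : t = (3 - s ^ 2) / (2 * s))
    (hr : r = (s + s ^ 2) / (s + 3)) :
    MvPolynomial.aeval ![r, t] branchPoly * ((s ^ 2 + 3 * s) ^ 3) ^ 2 =
      (1 / 16 * (s ^ 3 + s ^ 2 - 3 * s - 3) * (s ^ 4 - 2 * s ^ 2 + 9) ^ 2) ^ 2 *
      (-15 * s ^ 4 + 12 * s ^ 3 + 138 * s ^ 2 + 36 * s - 135) := by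
  have : CharZero E := algebraRat.charZero E
  rw [aeval_branchPoly]
  have f1 : 1 + r - 2 * r ^ 2 * t - t ^ 2 + r * t ^ 2 = 1 / 4 * (5 * s ^ 7 + 11 * s ^ 6
      - 13 * s ^ 5 - 31 * s ^ 4 + 51 * s ^ 3 + 117 * s ^ 2 - 27 * s - 81)
      / (s ^ 2 * (s + 3) ^ 2) := by
    rw [hr, ht]
    field_simp
    ring
  have f2 : -1 + r + 2 * r ^ 2 * t + t ^ 2 + r * t ^ 2 = -3 / 4 * (s ^ 7 + s ^ 6 - 5 * s ^ 5
      - 5 * s ^ 4 + 15 * s ^ 3 + 15 * s ^ 2 - 27 * s - 27) / (s ^ 2 * (s + 3) ^ 2) := by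
    rw [hr, ht]
    field_simp
    ring
  have f3 : -r - r ^ 2 - 2 * t - r * t ^ 2 + r ^ 2 * t ^ 2 = 1 / 4 * (s ^ 6 - 2 * s ^ 5 - 7 * s ^ 4
      + 4 * s ^ 3 + 19 * s ^ 2 - 18 * s - 45) / (s * (s + 3)) := by
    rw [hr, ht]
    field_simp
    ring
  have f4 : r - r ^ 2 - 2 * t + r * t ^ 2 + r ^ 2 * t ^ 2 = 1 / 4 * (s ^ 6 - 5 * s ^ 4
      + 15 * s ^ 2 - 27) / (s * (s + 3)) := by
    rw [hr, ht]
    field_simp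
    ring
  rw [f1, f2, f3, f4, show s ^ 2 + 3 * s = s * (s + 3) by ring]
  generalize hd : s + 3 = d at h2
  field_simp
  ring

/-- The restriction of the branch polynomial to `D₃`, in terms of the parameter `s`. -/
theorem aeval_branchPoly_two {E : Type*} [Field E] [Algebra ℚ E] {s r t : E}
    (h1 : s ≠ 0) (h2 : s ^ 2 + 3 ≠ 0) (ht : t = (3 - s ^ 2) / (2 * s))
    (hr : r = (3 - 2 * s - s ^ 2) / (s ^ 2 + 3)) :
    MvPolynomial.aeval ![r, t] branchPoly * (s ^ 3 * (s ^ 2 + 3) ^ 4) ^ 2 =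
      (1 / 4 * (s ^ 4 - 10 * s ^ 2 + 9) * (s ^ 4 - 2 * s ^ 2 + 9) ^ 2) ^ 2 *
      (9 * s ^ 4 + 48 * s ^ 3 - 42 * s ^ 2 - 144 * s + 81) := by
  have : CharZero E := algebraRat.charZero E
  rw [aeval_branchPoly]
  have f1 : 1 + r - 2 * r ^ 2 * t - t ^ 2 + r * t ^ 2 = -1 / 2 * (s ^ 7 - s ^ 6 - 11 * s ^ 5
      + 11 * s ^ 4 + 27 * s ^ 3 - 27 * s ^ 2 - 81 * s + 81) / (s * (s ^ 2 + 3) ^ 2) := by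
    rw [hr, ht]
    field_simp
    ring
  have f2 : -1 + r + 2 * r ^ 2 * t + t ^ 2 + r * t ^ 2 = -3 / 2 * (s ^ 7 + 3 * s ^ 6 - 3 * s ^ 5
      - 9 * s ^ 4 + 11 * s ^ 3 + 33 * s ^ 2 - 9 * s - 27) / (s ^ 2 * (s ^ 2 + 3) ^ 2) := by
    rw [hr, ht]
    field_simp
    ring
  have f3 : -r - r ^ 2 - 2 * t - r * t ^ 2 + r ^ 2 * t ^ 2 = 1 / 2 * (s ^ 7 + 5 * s ^ 6 - 7 * s ^ 5
      - 19 * s ^ 4 + 19 * s ^ 3 + 63 * s ^ 2 - 45 * s - 81) / (s * (s ^ 2 + 3) ^ 2) := by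
    rw [hr, ht]
    field_simp
    ring
  have f4 : r - r ^ 2 - 2 * t + r * t ^ 2 + r ^ 2 * t ^ 2 = 1 / 2 * (3 * s ^ 7 - 5 * s ^ 6
      - 21 * s ^ 5 + 19 * s ^ 4 + 57 * s ^ 3 - 63 * s ^ 2 - 135 * s + 81)
      / (s ^ 2 * (s ^ 2 + 3) ^ 2) := by
    rw [hr, ht]
    field_simp
    ring
  rw [f1, f2, f3, f4]
  generalize hd : s ^ 2 + 3 = d at h2
  field_simp
  ring

end Exotic

/-! ### Parametrizations of the curves `Dᵢ` and their pullbacks -/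

namespace Exotic

/-- The quartic of the model of the pullback of `D₁` is separable, by an explicit Bézout identity;
likewise below for the quartics of `D₂` and `D₃` and for the reversed quartics, which describe the
models near `s = ∞`. -/
theorem isCoprime_quartic_zero :
    IsCoprime (-15 * X ^ 4 + 60 * X ^ 3 + 114 * X ^ 2 - 348 * X - 351 : ℚ[X])
      (derivative (-15 * X ^ 4 + 60 * X ^ 3 + 114 * X ^ 2 - 348 * X - 351)) := by
  have hN : (C (1 / 276480) : ℚ[X]) * 276480 = 1 := by
    rw [← map_ofNat (C : ℚ →+* ℚ[X]), ← map_mul]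
    norm_num
  refine ⟨C (1 / 276480) * (340 * X ^ 2 - 680 * X - 172),
    C (1 / 276480) * (-85 * X ^ 3 + 255 * X ^ 2 + 451 * X - 621), ?_⟩
  have hd : derivative (-15 * X ^ 4 + 60 * X ^ 3 + 114 * X ^ 2 - 348 * X - 351 : ℚ[X])
      = -60 * X ^ 3 + 180 * X ^ 2 + 228 * X - 348 := by
    simp [map_ofNat (C : ℚ →+* ℚ[X])]
    ring
  rw [hd]
  linear_combination hN

theorem isCoprime_quartic_zero_reverse :
    IsCoprime (-351 * X ^ 4 - 348 * X ^ 3 + 114 * X ^ 2 + 60 * X - 15 : ℚ[X])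
      (derivative (-351 * X ^ 4 - 348 * X ^ 3 + 114 * X ^ 2 + 60 * X - 15)) := by
  have hN : (C (1 / 276480) : ℚ[X]) * 276480 = 1 := by
    rw [← map_ofNat (C : ℚ →+* ℚ[X]), ← map_mul]
    norm_num
  refine ⟨C (1 / 276480) * (547092 * X ^ 2 + 541128 * X + 61108),
    C (1 / 276480) * (-136773 * X ^ 3 - 169183 * X ^ 2 - 1389 * X + 19885), ?_⟩
  have hd : derivative (-351 * X ^ 4 - 348 * X ^ 3 + 114 * X ^ 2 + 60 * X - 15 : ℚ[X])
      = -1404 * X ^ 3 - 1044 * X ^ 2 + 228 * X + 60 := by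
    simp [map_ofNat (C : ℚ →+* ℚ[X])]
    ring
  rw [hd]
  linear_combination hN

theorem isCoprime_quartic_one :
    IsCoprime (-15 * X ^ 4 + 12 * X ^ 3 + 138 * X ^ 2 + 36 * X - 135 : ℚ[X])
      (derivative (-15 * X ^ 4 + 12 * X ^ 3 + 138 * X ^ 2 + 36 * X - 135)) := by
  have hN : (C (1 / 82944) : ℚ[X]) * 82944 = 1 := by
    rw [← map_ofNat (C : ℚ →+* ℚ[X]), ← map_mul]
    norm_num
  refine ⟨C (1 / 82944) * (740 * X ^ 2 - 1464 * X - 812),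
    C (1 / 82944) * (-185 * X ^ 3 + 403 * X ^ 2 + 1003 * X - 741), ?_⟩
  have hd : derivative (-15 * X ^ 4 + 12 * X ^ 3 + 138 * X ^ 2 + 36 * X - 135 : ℚ[X])
      = -60 * X ^ 3 + 36 * X ^ 2 + 276 * X + 36 := by
    simp [map_ofNat (C : ℚ →+* ℚ[X])]
    ring
  rw [hd]
  linear_combination hN

theorem isCoprime_quartic_one_reverse :
    IsCoprime (-135 * X ^ 4 + 36 * X ^ 3 + 138 * X ^ 2 + 12 * X - 15 : ℚ[X])
      (derivative (-135 * X ^ 4 + 36 * X ^ 3 + 138 * X ^ 2 + 12 * X - 15)) := by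
  have hN : (C (1 / 9216) : ℚ[X]) * 9216 = 1 := by
    rw [← map_ofNat (C : ℚ →+* ℚ[X]), ← map_mul]
    norm_num
  refine ⟨C (1 / 9216) * (6660 * X ^ 2 - 4392 * X - 812),
    C (1 / 9216) * (-1665 * X ^ 3 + 1209 * X ^ 2 + 1003 * X - 247), ?_⟩
  have hd : derivative (-135 * X ^ 4 + 36 * X ^ 3 + 138 * X ^ 2 + 12 * X - 15 : ℚ[X])
      = -540 * X ^ 3 + 108 * X ^ 2 + 276 * X + 12 := by
    simp [map_ofNat (C : ℚ →+* ℚ[X])]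
    ring
  rw [hd]
  linear_combination hN

theorem isCoprime_quartic_two :
    IsCoprime (9 * X ^ 4 + 48 * X ^ 3 - 42 * X ^ 2 - 144 * X + 81 : ℚ[X])
      (derivative (9 * X ^ 4 + 48 * X ^ 3 - 42 * X ^ 2 - 144 * X + 81)) := by
  have hN : (C (1 / 179712) : ℚ[X]) * 179712 = 1 := by
    rw [← map_ofNat (C : ℚ →+* ℚ[X]), ← map_mul]
    norm_num
  refine ⟨C (1 / 179712) * (-516 * X ^ 2 - 2244 * X - 272),
    C (1 / 179712) * (129 * X ^ 3 + 733 * X ^ 2 - 173 * X - 1401), ?_⟩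
  have hd : derivative (9 * X ^ 4 + 48 * X ^ 3 - 42 * X ^ 2 - 144 * X + 81 : ℚ[X])
      = 36 * X ^ 3 + 144 * X ^ 2 - 84 * X - 144 := by
    simp [map_ofNat (C : ℚ →+* ℚ[X])]
    ring
  rw [hd]
  linear_combination hN

theorem isCoprime_quartic_two_reverse :
    IsCoprime (81 * X ^ 4 - 144 * X ^ 3 - 42 * X ^ 2 + 48 * X + 9 : ℚ[X])
      (derivative (81 * X ^ 4 - 144 * X ^ 3 - 42 * X ^ 2 + 48 * X + 9)) := by
  have hN : (C (1 / 19968) : ℚ[X]) * 19968 = 1 := by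
    rw [← map_ofNat (C : ℚ →+* ℚ[X]), ← map_mul]
    norm_num
  refine ⟨C (1 / 19968) * (-4644 * X ^ 2 + 6732 * X - 272),
    C (1 / 19968) * (1161 * X ^ 3 - 2199 * X ^ 2 - 173 * X + 467), ?_⟩
  have hd : derivative (81 * X ^ 4 - 144 * X ^ 3 - 42 * X ^ 2 + 48 * X + 9 : ℚ[X])
      = 324 * X ^ 3 - 432 * X ^ 2 - 84 * X + 48 := by
    simp [map_ofNat (C : ℚ →+* ℚ[X])]
    ring
  rw [hd]
  linear_combination hN

theorem ne_zero_of_eval_ne_zero {p : ℚ[X]} (x : ℚ) (h : p.eval x ≠ 0) : p ≠ 0 := by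
  rintro rfl
  simp at h

theorem C_one_div_mul_ofNat (n : ℕ) [n.AtLeastTwo] :
    (C (1 / OfNat.ofNat n) : ℚ[X]) * OfNat.ofNat n = 1 := by
  rw [← map_ofNat (C : ℚ →+* ℚ[X]), ← map_mul, one_div, inv_mul_cancel₀ (by simp), map_one]

/-- The double cover of `D₁`: the conic is `w² = t² - 4 t + 1`. -/
def conicCoverZero : ConicCover (polyD 0) branchPoly where
  a := X ^ 2 - 4 * X - 3
  b := X ^ 2 + 1
  b' := 2 * (X + 1)
  c := -(3 * X ^ 2 + 4 * X - 1)
  h₁ := -4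
  h₀ := 1
  q := -15 * X ^ 4 + 60 * X ^ 3 + 114 * X ^ 2 - 348 * X - 351
  m := C (1 / 2) * (X ^ 2 - 2 * X - 5) * (X ^ 5 - X ^ 4 + 2 * X ^ 3 + 14 * X ^ 2 + X - 17) ^ 2
  n := (X ^ 3 + 2 * X ^ 2 - 7 * X - 14) ^ 4
  ha := ne_zero_of_eval_ne_zero 2 (by norm_num)
  hb' := ne_zero_of_eval_ne_zero 2 (by norm_num)
  hm := ne_zero_of_eval_ne_zero 2 (by norm_num)
  hn := ne_zero_of_eval_ne_zero 2 (by norm_num)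
  conic_ne := by norm_num
  disc_eq := by
    simp only [map_neg, map_ofNat, map_one]
    ring
  primitive := ⟨C (1 / 8) * (X - 1), C (1 / 8) * (5 - X), 0, by
    linear_combination C_one_div_mul_ofNat 8⟩
  eq_P := by
    simp only [map_add, map_sub, map_mul, map_pow, map_neg, map_one, map_ofNat, aeval_X]
    simp [polyD]
    ring
  q_separable := isCoprime_quartic_zero
  q_natDegree := by
    have : (-15 * X ^ 4 + 60 * X ^ 3 + 114 * X ^ 2 - 348 * X - 351 : ℚ[X]).natDegree = 4 := by
      compute_degree!
    omega
  branch := by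
    intro E _ _ s r t hs ht hr
    have hne : ∀ p : ℚ[X], p ≠ 0 → aeval s p ≠ 0 := fun p hp =>
      (map_ne_zero_iff _ (transcendental_iff_injective.mp hs)).mpr hp
    simp only [map_add, map_sub, map_mul, map_pow, map_neg, map_one, map_ofNat, aeval_X,
      sub_neg_eq_add] at ht hr
    have h1 : 2 * s + 4 ≠ 0 := by
      have := hne (2 * X + 4) (ne_zero_of_eval_ne_zero 2 (by norm_num))
      simpa only [map_add, map_sub, map_mul, map_pow, map_ofNat, map_one, aeval_X] using this
    have h2 : s ^ 2 - 7 ≠ 0 := by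
      have := hne (X ^ 2 - 7) (ne_zero_of_eval_ne_zero 2 (by norm_num))
      simpa only [map_add, map_sub, map_mul, map_pow, map_ofNat, map_one, aeval_X] using this
    have h3 : s ^ 2 + 8 * s + 9 ≠ 0 := by
      have := hne (X ^ 2 + 8 * X + 9) (ne_zero_of_eval_ne_zero 2 (by norm_num))
      simpa only [map_add, map_sub, map_mul, map_pow, map_ofNat, map_one, aeval_X] using this
    have hC (x : ℚ) : aeval s (C x) = algebraMap ℚ E x := aeval_C s x
    have : CharZero E := algebraRat.charZero E
    have ht' := eq_div_of_mul_eq h1 ht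
    have hr' : r = (3 + 4 * s - s ^ 2) / (s ^ 2 - 7) := by
      rw [eq_div_iff h2]
      apply mul_left_cancel₀ h3
      have h1' : s + 2 ≠ 0 := fun h => h1 (by linear_combination 2 * h)
      rw [ht', show 2 * s + 4 = 2 * (s + 2) by ring] at hr
      field_simp at hr
      linear_combination hr
    simpa only [map_add, map_sub, map_mul, map_pow, map_neg, map_zero, map_one, map_ofNat,
      aeval_X, hC,
      map_div₀] using aeval_branchPoly_zero h1 h2 ht' hr'

/-- The double cover of `D₂`: the conic is `w² = t² + 3`. -/
def conicCoverOne : ConicCover (polyD 1) branchPoly where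
  a := X - 1
  b := -(X ^ 2 + 1)
  b' := X
  c := -(X + 1)
  h₁ := 0
  h₀ := 3
  q := -15 * X ^ 4 + 12 * X ^ 3 + 138 * X ^ 2 + 36 * X - 135
  m := C (1 / 16) * (X ^ 3 + X ^ 2 - 3 * X - 3) * (X ^ 4 - 2 * X ^ 2 + 9) ^ 2
  n := (X ^ 2 + 3 * X) ^ 3
  ha := ne_zero_of_eval_ne_zero 2 (by norm_num)
  hb' := ne_zero_of_eval_ne_zero 2 (by norm_num)
  hm := ne_zero_of_eval_ne_zero 2 (by norm_num)
  hn := ne_zero_of_eval_ne_zero 2 (by norm_num)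
  conic_ne := by norm_num
  disc_eq := by
    simp only [map_ofNat, map_zero]
    ring
  primitive := ⟨C (1 / 2) * -(X + 1), -C (1 / 2), 0, by
    linear_combination C_one_div_mul_ofNat 2⟩
  eq_P := by
    simp only [map_add, map_sub, map_pow, map_neg, map_one, aeval_X]
    simp [polyD]
    ring
  q_separable := isCoprime_quartic_one
  q_natDegree := by
    have : (-15 * X ^ 4 + 12 * X ^ 3 + 138 * X ^ 2 + 36 * X - 135 : ℚ[X]).natDegree = 4 := by
      compute_degree!
    omega
  branch := by
    intro E _ _ s r t hs ht hr
    have hne : ∀ p : ℚ[X], p ≠ 0 → aeval s p ≠ 0 := fun p hp =>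
      (map_ne_zero_iff _ (transcendental_iff_injective.mp hs)).mpr hp
    simp only [map_add, map_sub, map_pow, map_neg, map_zero, map_one, map_ofNat, aeval_X,
      sub_zero] at ht hr
    have h1 : s ≠ 0 := by
      have := hne (X) (ne_zero_of_eval_ne_zero 2 (by norm_num))
      simpa only [map_add, map_sub, map_mul, map_pow, map_ofNat, map_one, aeval_X] using this
    have h2 : s + 3 ≠ 0 := by
      have := hne (X + 3) (ne_zero_of_eval_ne_zero 2 (by norm_num))
      simpa only [map_add, map_sub, map_mul, map_pow, map_ofNat, map_one, aeval_X] using this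
    have h3 : s - 1 ≠ 0 := by
      have := hne (X - 1) (ne_zero_of_eval_ne_zero 2 (by norm_num))
      simpa only [map_add, map_sub, map_mul, map_pow, map_ofNat, map_one, aeval_X] using this
    have hC (x : ℚ) : aeval s (C x) = algebraMap ℚ E x := aeval_C s x
    have : CharZero E := algebraRat.charZero E
    have ht' := eq_div_of_mul_eq (mul_ne_zero two_ne_zero h1) ht
    have hr' : r = (s + s ^ 2) / (s + 3) := by
      rw [eq_div_iff h2]
      apply mul_left_cancel₀ (mul_ne_zero h1 h3)
      rw [ht'] at hr
      field_simp at hr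
      linear_combination -hr / 2
    simpa only [map_add, map_sub, map_mul, map_pow, map_neg, map_zero, map_one, map_ofNat,
      aeval_X, hC,
      map_div₀] using aeval_branchPoly_one h1 h2 ht' hr'

/-- The double cover of `D₃`: the conic is `w² = t² + 3`. -/
def conicCoverTwo : ConicCover (polyD 2) branchPoly where
  a := X ^ 2 + 3
  b := 0
  b' := X - 1
  c := -(X - 1) ^ 2
  h₁ := 0
  h₀ := 3
  q := 9 * X ^ 4 + 48 * X ^ 3 - 42 * X ^ 2 - 144 * X + 81
  m := C (1 / 4) * (X ^ 4 - 10 * X ^ 2 + 9) * (X ^ 4 - 2 * X ^ 2 + 9) ^ 2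
  n := X ^ 3 * (X ^ 2 + 3) ^ 4
  ha := ne_zero_of_eval_ne_zero 2 (by norm_num)
  hb' := ne_zero_of_eval_ne_zero 2 (by norm_num)
  hm := ne_zero_of_eval_ne_zero 2 (by norm_num)
  hn := ne_zero_of_eval_ne_zero 2 (by norm_num)
  conic_ne := by norm_num
  disc_eq := by
    simp only [map_ofNat, map_zero]
    ring
  primitive := ⟨C (1 / 8) * (3 - X), 0, C (1 / 8) * (1 - X), by
    linear_combination C_one_div_mul_ofNat 8⟩
  eq_P := by
    simp only [map_add, map_sub, map_pow, map_neg, map_zero, map_one, map_ofNat, aeval_X]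
    simp [polyD]
    ring
  q_separable := isCoprime_quartic_two
  q_natDegree := by
    have : (9 * X ^ 4 + 48 * X ^ 3 - 42 * X ^ 2 - 144 * X + 81 : ℚ[X]).natDegree = 4 := by
      compute_degree!
    omega
  branch := by
    intro E _ _ s r t hs ht hr
    have hne : ∀ p : ℚ[X], p ≠ 0 → aeval s p ≠ 0 := fun p hp =>
      (map_ne_zero_iff _ (transcendental_iff_injective.mp hs)).mpr hp
    simp only [map_add, map_sub, map_pow, map_zero, map_one, map_ofNat, aeval_X,
      sub_zero] at ht hr
    have h1 : s ≠ 0 := by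
      have := hne (X) (ne_zero_of_eval_ne_zero 2 (by norm_num))
      simpa only [map_add, map_sub, map_mul, map_pow, map_ofNat, map_one, aeval_X] using this
    have h2 : s ^ 2 + 3 ≠ 0 := by
      have := hne (X ^ 2 + 3) (ne_zero_of_eval_ne_zero 2 (by norm_num))
      simpa only [map_add, map_sub, map_mul, map_pow, map_ofNat, map_one, aeval_X] using this
    have hC (x : ℚ) : aeval s (C x) = algebraMap ℚ E x := aeval_C s x
    have : CharZero E := algebraRat.charZero E
    have ht' := eq_div_of_mul_eq (mul_ne_zero two_ne_zero h1) ht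
    have hr' : r = (3 - 2 * s - s ^ 2) / (s ^ 2 + 3) := by
      rw [eq_div_iff h2]
      apply mul_left_cancel₀ h2
      rw [ht'] at hr
      field_simp at hr
      linear_combination hr
    simpa only [map_add, map_sub, map_mul, map_pow, map_neg, map_zero, map_one, map_ofNat,
      aeval_X, hC,
      map_div₀] using aeval_branchPoly_two h1 h2 ht' hr'

end Exotic

/-! ### Weierstrass models -/

/-- If `k(x, y)` contains a transcendental element and `(x, y)` satisfies a Weierstrass equation,
then `x` is transcendental, since `y` is integral over `k(x)`. -/
theorem transcendental_of_weierstrass {k K : Type} [Field k] [Field K] [Algebra k K] {x y s : K}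
    (hs : Transcendental k s) (hK : IntermediateField.adjoin k {x, y} = ⊤)
    {a₁ a₂ a₃ a₄ a₆ : k}
    (h : y ^ 2 + algebraMap k K a₁ * x * y + algebraMap k K a₃ * y =
      x ^ 3 + algebraMap k K a₂ * x ^ 2 + algebraMap k K a₄ * x + algebraMap k K a₆) :
    Transcendental k x := by
  intro hx
  have hxA : x ∈ algebraicClosure k K := mem_algebraicClosure_iff.mpr hx
  have hyA : y ∈ algebraicClosure k K := by
    let x' : algebraicClosure k K := ⟨x, hxA⟩
    have hint : IsIntegral (algebraicClosure k K) y := by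
      refine ⟨X ^ 2 + C (algebraMap k _ a₁ * x' + algebraMap k _ a₃) * X
        - C (x' ^ 3 + algebraMap k _ a₂ * x' ^ 2 + algebraMap k _ a₄ * x' + algebraMap k _ a₆),
        by monicity!, ?_⟩
      rw [← aeval_def]
      simp only [map_add, map_sub, map_mul, map_pow, aeval_X, aeval_C]
      change y ^ 2 + (algebraMap k K a₁ * x + algebraMap k K a₃) * y
        - (x ^ 3 + algebraMap k K a₂ * x ^ 2 + algebraMap k K a₄ * x + algebraMap k K a₆) = 0
      linear_combination h
    exact mem_algebraicClosure_iff.mpr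
      (isIntegral_trans (R := k) (A := algebraicClosure k K) y hint).isAlgebraic
  have hle : IntermediateField.adjoin k {x, y} ≤ algebraicClosure k K := by
    rw [IntermediateField.adjoin_le_iff]
    rintro z (rfl | rfl)
    · exact hxA
    · exact hyA
  rw [hK] at hle
  exact hs (mem_algebraicClosure_iff.mp (hle IntermediateField.mem_top))

/-- If `K = k(x, y)` with `x` transcendental and `(x, y)` satisfying the equation of a Weierstrass
curve `W`, then `K` is the fraction field of the coordinate ring of `W`. -/
theorem exists_isFractionRing_coordinateRing {k K : Type} [Field k] [Field K] [Algebra k K]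
    (W : WeierstrassCurve k) {x y : K} (hx : Transcendental k x)
    (hK : IntermediateField.adjoin k {x, y} = ⊤)
    (h : y ^ 2 + algebraMap k K W.a₁ * x * y + algebraMap k K W.a₃ * y =
      x ^ 3 + algebraMap k K W.a₂ * x ^ 2 + algebraMap k K W.a₄ * x + algebraMap k K W.a₆) :
    ∃ _ : Algebra W.toAffine.CoordinateRing K,
      IsScalarTower k W.toAffine.CoordinateRing K ∧ IsFractionRing W.toAffine.CoordinateRing K := by
  have hroot : eval₂ (aeval x : k[X] →ₐ[k] K) y W.toAffine.polynomial = 0 := by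
    rw [WeierstrassCurve.Affine.polynomial]
    simp only [eval₂_add, eval₂_sub, eval₂_mul, eval₂_pow, eval₂_X, eval₂_C, RingHom.coe_coe,
      map_add, map_mul, map_pow, aeval_X, aeval_C]
    linear_combination h
  let ψ : W.toAffine.CoordinateRing →ₐ[k] K :=
    AdjoinRoot.liftAlgHom W.toAffine.polynomial (aeval x) y hroot
  have hψX : ∀ p : k[X], ψ (algebraMap k[X] _ p) = aeval x p := fun p =>
    AdjoinRoot.lift_of hroot
  have hψY : ψ (AdjoinRoot.root _) = y := AdjoinRoot.lift_root hroot
  have hfin : Module.Finite k[X] W.toAffine.CoordinateRing :=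
    WeierstrassCurve.Affine.monic_polynomial.finite_adjoinRoot
  have hker : RingHom.ker ψ = ⊥ := by
    apply Ideal.eq_bot_of_comap_eq_bot (R := k[X])
    rw [eq_bot_iff]
    intro p hp
    rw [Ideal.mem_comap, RingHom.mem_ker, hψX] at hp
    exact transcendental_iff_injective.mp hx (by rw [hp, map_zero])
  have hinj : Function.Injective ψ := (RingHom.injective_iff_ker_eq_bot _).mpr hker
  let alg : Algebra W.toAffine.CoordinateRing K := ψ.toRingHom.toAlgebra
  have hfaith : FaithfulSMul W.toAffine.CoordinateRing K :=
    (faithfulSMul_iff_algebraMap_injective _ _).mpr hinj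
  refine ⟨alg, IsScalarTower.of_algebraMap_eq fun c => (ψ.commutes c).symm,
    IsFractionRing.of_field _ _ fun z => ?_⟩
  have hz : z ∈ IntermediateField.adjoin k {x, y} := hK ▸ IntermediateField.mem_top
  obtain ⟨n, hn, d, hd, rfl⟩ := IntermediateField.mem_adjoin_iff_div.mp hz
  have hle : Algebra.adjoin k {x, y} ≤ ψ.range := by
    refine Algebra.adjoin_le ?_
    rintro w (rfl | rfl)
    · exact ⟨algebraMap k[X] _ X, (hψX X).trans (aeval_X _)⟩
    · exact ⟨_, hψY⟩
  obtain ⟨n', rfl⟩ := hle hn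
  obtain ⟨d', rfl⟩ := hle hd
  exact ⟨n', d', rfl⟩

/-- Cassels' transformation of the quartic `v² = v₀² + d U + c U² + b U³ + a U⁴` with the rational
point `(0, v₀)` into a Weierstrass equation. -/
theorem weierstrass_of_quartic {K : Type*} [Field K] [CharZero K] {U v v₀ d c b a x y : K}
    (hU : U ≠ 0) (hv₀ : v₀ ≠ 0)
    (hv : v ^ 2 = v₀ ^ 2 + d * U + c * U ^ 2 + b * U ^ 3 + a * U ^ 4)
    (hx : x = (2 * v₀ * (v + v₀) + d * U) / U ^ 2)
    (hy : y = (4 * v₀ ^ 2 * (v + v₀) + 2 * v₀ * (d * U + c * U ^ 2) - d ^ 2 * U ^ 2 / (2 * v₀))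
      / U ^ 3) :
    y ^ 2 + d / v₀ * x * y + 2 * v₀ * b * y = x ^ 3 + (c - d ^ 2 / (4 * v₀ ^ 2)) * x ^ 2
        + -(4 * v₀ ^ 2 * a) * x + a * (d ^ 2 - 4 * v₀ ^ 2 * c) ∧
      U * y = 2 * v₀ * (x + c) - d ^ 2 / (2 * v₀) ∧
      v = -v₀ + U * (U * x - d) / (2 * v₀) := by
  refine ⟨?_, ?_, ?_⟩
  · rw [← sub_eq_zero]
    have key : y ^ 2 + d / v₀ * x * y + 2 * v₀ * b * y - (x ^ 3 + (c - d ^ 2 / (4 * v₀ ^ 2)) * x ^ 2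
        + -(4 * v₀ ^ 2 * a) * x + a * (d ^ 2 - 4 * v₀ ^ 2 * c))
        = (-8 * v₀ ^ 3 * v - 8 * v₀ ^ 4 - 4 * v₀ ^ 2 * (d * U + c * U ^ 2) + d ^ 2 * U ^ 2) / U ^ 6
          * (v ^ 2 - (v₀ ^ 2 + d * U + c * U ^ 2 + b * U ^ 3 + a * U ^ 4)) := by
      rw [hx, hy]
      field_simp
      ring
    rw [key, hv, sub_self, mul_zero]
  · rw [hx, hy]
    field_simp
    ring
  · rw [hx]
    field_simp
    ring

/-- The function field of a quartic `v² = q(s)` with a rational point `(s₀, v₀)`, `v₀ ≠ 0`, is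
generated by two elements that satisfy a Weierstrass equation. -/
theorem exists_weierstrass_generators {k K : Type} [Field k] [CharZero k] [Field K] [Algebra k K]
    {s v : K} (hs : Transcendental k s) {q : k[X]} (hq : IsCoprime q (derivative q))
    (hdeg : 0 < q.natDegree) (hv : v ^ 2 = aeval s q)
    (hK : IntermediateField.adjoin k {s, v} = ⊤) {s₀ v₀ d c b a : k} (hv₀ : v₀ ≠ 0)
    (hqs : q = C (v₀ ^ 2) + C d * (X - C s₀) + C c * (X - C s₀) ^ 2 + C b * (X - C s₀) ^ 3
      + C a * (X - C s₀) ^ 4) :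
    ∃ x y : K, IntermediateField.adjoin k {x, y} = ⊤ ∧
      y ^ 2 + algebraMap k K (d / v₀) * x * y + algebraMap k K (2 * v₀ * b) * y =
        x ^ 3 + algebraMap k K (c - d ^ 2 / (4 * v₀ ^ 2)) * x ^ 2
        + algebraMap k K (-(4 * v₀ ^ 2 * a)) * x
        + algebraMap k K (a * (d ^ 2 - 4 * v₀ ^ 2 * c)) := by
  have : CharZero K := charZero_of_injective_algebraMap (algebraMap k K).injective
  have hU : s - algebraMap k K s₀ ≠ 0 := fun h0 =>
    hs (by rw [sub_eq_zero.mp h0]; exact isAlgebraic_algebraMap s₀)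
  have hV₀ : algebraMap k K v₀ ≠ 0 := (_root_.map_ne_zero _).mpr hv₀
  have hv' := hv
  rw [hqs] at hv'
  simp only [map_add, map_sub, map_mul, map_pow, aeval_X, aeval_C] at hv'
  obtain ⟨x, hx⟩ : ∃ x, x = (2 * algebraMap k K v₀ * (v + algebraMap k K v₀)
      + algebraMap k K d * (s - algebraMap k K s₀)) / (s - algebraMap k K s₀) ^ 2 := ⟨_, rfl⟩
  obtain ⟨y, hy⟩ : ∃ y, y = (4 * algebraMap k K v₀ ^ 2 * (v + algebraMap k K v₀)
      + 2 * algebraMap k K v₀ * (algebraMap k K d * (s - algebraMap k K s₀)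
        + algebraMap k K c * (s - algebraMap k K s₀) ^ 2)
      - algebraMap k K d ^ 2 * (s - algebraMap k K s₀) ^ 2 / (2 * algebraMap k K v₀))
      / (s - algebraMap k K s₀) ^ 3 := ⟨_, rfl⟩
  obtain ⟨h1, h2, h3⟩ := weierstrass_of_quartic hU hV₀ hv' hx hy
  have hy0 : y ≠ 0 := by
    -- otherwise `v` would be a polynomial in `s`
    intro h0
    rw [hy, div_eq_zero_iff, or_iff_left (pow_ne_zero 3 hU)] at h0
    have := eq_zero_of_add_mul_sqrt_eq_zero hs hq hdeg hv
      (a := C (4 * v₀ ^ 3) + C (2 * v₀) * (C d * (X - C s₀) + C c * (X - C s₀) ^ 2)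
        - C (d ^ 2 / (2 * v₀)) * (X - C s₀) ^ 2) (b := C (4 * v₀ ^ 2)) (by
        simp only [map_add, map_sub, map_mul, map_pow, map_div₀, aeval_X, aeval_C, map_ofNat]
        linear_combination h0)
    exact C_ne_zero.mpr (mul_ne_zero (by norm_num) (pow_ne_zero 2 hv₀)) this.2
  refine ⟨x, y, ?_, by simpa only [map_div₀, map_sub, map_mul, map_pow, map_neg, map_ofNat]⟩
  set M := IntermediateField.adjoin k {x, y}
  have hxM : x ∈ M := IntermediateField.subset_adjoin _ _ (by simp)
  have hyM : y ∈ M := IntermediateField.subset_adjoin _ _ (by simp)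
  have hc := M.algebraMap_mem
  have h2M : (2 : K) ∈ M := ofNat_mem M 2
  have hUM : s - algebraMap k K s₀ ∈ M := by
    rw [eq_div_of_mul_eq hy0 h2]
    exact div_mem (sub_mem (mul_mem (mul_mem h2M (hc _)) (add_mem hxM (hc _)))
      (div_mem (pow_mem (hc _) 2) (mul_mem h2M (hc _)))) hyM
  have hvM : v ∈ M := by
    rw [h3]
    exact add_mem (neg_mem (hc _)) (div_mem (mul_mem hUM (sub_mem (mul_mem hUM hxM) (hc _)))
      (mul_mem h2M (hc _)))
  have hsM : s ∈ M := by simpa using add_mem hUM (hc s₀)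
  rw [eq_top_iff, ← hK, IntermediateField.adjoin_le_iff]
  rintro z (rfl | rfl)
  · exact hsM
  · exact hvM

/-- Rescaling and translating the generators of a function field: the change of variables between
two Weierstrass equations preserves the field they generate. -/
theorem adjoin_pair_eq_top_of_affine {k K : Type} [Field k] [Field K] [Algebra k K] {x y : K}
    (hK : IntermediateField.adjoin k {x, y} = ⊤) {u u' ρ σ τ : k} {x' y' : K}
    (hx : x = algebraMap k K u * x' + algebraMap k K ρ)
    (hy : y = algebraMap k K u' * y' + algebraMap k K σ * x' + algebraMap k K τ) :
    IntermediateField.adjoin k {x', y'} = ⊤ := by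
  set M := IntermediateField.adjoin k {x', y'}
  have hxM : x' ∈ M := IntermediateField.subset_adjoin _ _ (by simp)
  have hyM : y' ∈ M := IntermediateField.subset_adjoin _ _ (by simp)
  have hc := M.algebraMap_mem
  rw [eq_top_iff, ← hK, IntermediateField.adjoin_le_iff]
  rintro z (rfl | rfl)
  · rw [hx]
    exact add_mem (mul_mem (hc _) hxM) (hc _)
  · rw [hy]
    exact add_mem (add_mem (mul_mem (hc _) hyM) (mul_mem (hc _) hxM)) (hc _)

theorem weierstrass_variableChange {K : Type*} [Field K] {u r s t a₁ a₂ a₃ a₄ a₆ x y x' y' : K}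
    (hu : u ≠ 0) (hx : x = u ^ 2 * x' + r) (hy : y = u ^ 3 * y' + u ^ 2 * s * x' + t)
    (h : y ^ 2 + a₁ * x * y + a₃ * y = x ^ 3 + a₂ * x ^ 2 + a₄ * x + a₆) :
    y' ^ 2 + u⁻¹ * (a₁ + 2 * s) * x' * y' + u⁻¹ ^ 3 * (a₃ + r * a₁ + 2 * t) * y' =
      x' ^ 3 + u⁻¹ ^ 2 * (a₂ - s * a₁ + 3 * r - s ^ 2) * x' ^ 2
        + u⁻¹ ^ 4 * (a₄ - s * a₃ + 2 * r * a₂ - (t + r * s) * a₁ + 3 * r ^ 2 - 2 * s * t) * x'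
        + u⁻¹ ^ 6 * (a₆ + r * a₄ + r ^ 2 * a₂ + r ^ 3 - t * a₃ - t ^ 2 - r * t * a₁) := by
  rw [hx, hy] at h
  field_simp
  linear_combination h

namespace ConicCover

variable {k : Type} [Field k] [CharZero k] {P f : MvPolynomial (Fin 2) k}

/-- The double cover is birational to every Weierstrass curve `W` that is isomorphic to the one
attached to a rational point `(s₀, v₀)` of `v² = q(s)`. -/
theorem birationalOver_weierstrass (D : ConicCover P f) {s₀ v₀ d c b a : k} (hv₀ : v₀ ≠ 0)
    (hqs : D.q = C (v₀ ^ 2) + C d * (X - C s₀) + C c * (X - C s₀) ^ 2 + C b * (X - C s₀) ^ 3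
      + C a * (X - C s₀) ^ 4) (W : WeierstrassCurve k) (φ : WeierstrassCurve.VariableChange k)
    (hW : W = φ • (⟨d / v₀, c - d ^ 2 / (4 * v₀ ^ 2), 2 * v₀ * b, -(4 * v₀ ^ 2 * a),
      a * (d ^ 2 - 4 * v₀ ^ 2 * c)⟩ : WeierstrassCurve k)) :
    AlgebraicGeometry.Scheme.BirationalOver (structureMap k (CoordRing (coverIdeal P f)))
      (structureMap k W.toAffine.CoordinateRing) := by
  have := D.isPrime_coverIdeal
  obtain ⟨s, v, hs, hv, hK⟩ := D.exists_functionField_cover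
  obtain ⟨x, y, hxy, h⟩ :=
    exists_weierstrass_generators hs D.q_separable D.q_natDegree hv hK hv₀ hqs
  set ι := algebraMap k (FunctionField (coverIdeal P f))
  have hu : ι φ.u ≠ 0 := (_root_.map_ne_zero _).mpr φ.u.ne_zero
  obtain ⟨x', hx'⟩ : ∃ x', x = ι φ.u ^ 2 * x' + ι φ.r :=
    ⟨(x - ι φ.r) / ι φ.u ^ 2, by field_simp; ring⟩
  obtain ⟨y', hy'⟩ : ∃ y', y = ι φ.u ^ 3 * y' + ι φ.u ^ 2 * ι φ.s * x' + ι φ.t :=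
    ⟨(y - ι φ.u ^ 2 * ι φ.s * x' - ι φ.t) / ι φ.u ^ 3, by field_simp; ring⟩
  have hxy' : IntermediateField.adjoin k {x', y'} = ⊤ :=
    adjoin_pair_eq_top_of_affine hxy (u := φ.u ^ 2) (u' := φ.u ^ 3) (σ := φ.u ^ 2 * φ.s)
      (by simpa only [map_pow] using hx') (by simpa only [map_pow, map_mul] using hy')
  have h' := weierstrass_variableChange hu hx' hy' h
  have hW' : y' ^ 2 + ι W.a₁ * x' * y' + ι W.a₃ * y' =
      x' ^ 3 + ι W.a₂ * x' ^ 2 + ι W.a₄ * x' + ι W.a₆ := by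
    rw [hW, WeierstrassCurve.variableChange_def]
    simpa only [map_add, map_sub, map_mul, map_pow, map_neg, map_div₀, map_ofNat, map_inv₀,
      Units.val_inv_eq_inv_val] using h'
  obtain ⟨_, _, _⟩ := exists_isFractionRing_coordinateRing W
    (transcendental_of_weierstrass hs hxy' hW') hxy' hW'
  exact birationalOver_of_isFractionRing (FunctionField (coverIdeal P f))

end ConicCover

/-! ### The curves `Dᵢ`, their pullbacks and the elliptic curves `Eᵢ` -/

namespace Exotic

theorem birationalOver_pullback_curveD (i : Fin 3) :
    AlgebraicGeometry.Scheme.BirationalOver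
      (structureMap ℚ (CoordRing (pullback (curveD i))))
      (structureMap ℚ (curveE i).toAffine.CoordinateRing) := by
  have hC (n : ℕ) [n.AtLeastTwo] : (C (OfNat.ofNat n) : ℚ[X]) = OfNat.ofNat n := map_ofNat C n
  rw [pullback_curveD]
  -- `(s₀, v₀)` is a rational point of `v² = q(s)`, and `d, c, b, a` are the Taylor coefficients of
  -- `q` at `s₀` of degrees one to four
  fin_cases i
  · refine conicCoverZero.birationalOver_weierstrass (s₀ := 3) (v₀ := 6) (d := 336) (c := -156)
      (b := -120) (a := -15) (by norm_num) ?_ _ ⟨Units.mk0 2 two_ne_zero, 52, -28, -736⟩ ?_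
    · simp only [conicCoverZero, map_neg, map_pow, hC]
      ring
    · rw [WeierstrassCurve.variableChange_def]
      ext <;> norm_num [curveE]
  · refine conicCoverOne.birationalOver_weierstrass (s₀ := 1) (v₀ := 6) (d := 288) (c := 84)
      (b := -48) (a := -15) (by norm_num) ?_ _ ⟨Units.mk0 2 two_ne_zero, -28, -24, 960⟩ ?_
    · simp only [conicCoverOne, map_neg, map_pow, map_one, hC]
      ring
    · rw [WeierstrassCurve.variableChange_def]
      ext <;> norm_num [curveE]
  · refine conicCoverTwo.birationalOver_weierstrass (s₀ := 0) (v₀ := 9) (d := -144) (c := -42)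
      (b := 48) (a := 9) (by norm_num) ?_ _ ⟨Units.mk0 4 four_ne_zero, 10, 10, -320⟩ ?_
    · simp only [conicCoverTwo, map_neg, map_pow, map_zero, hC]
      ring
    · rw [WeierstrassCurve.variableChange_def]
      ext <;> norm_num [curveE]

theorem isElliptic_curveE (i : Fin 3) : (curveE i).IsElliptic := by
  refine ⟨?_⟩
  rw [isUnit_iff_ne_zero]
  fin_cases i <;>
    norm_num [curveE, WeierstrassCurve.Δ, WeierstrassCurve.b₂, WeierstrassCurve.b₄,
      WeierstrassCurve.b₆, WeierstrassCurve.b₈]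

/-- `Dᵢ` and its pullback are absolutely irreducible curves, of genus zero and one. -/
theorem geometry_curveD (i : Fin 3) :
    IsCurve (curveD i) ∧ genus (curveD i) = 0 ∧ IsCurve (pullback (curveD i)) ∧
      genus (pullback (curveD i)) = 1 := by
  have hC {E : Type} [Field E] [Algebra ℚ E] (x : E) (n : ℕ) [n.AtLeastTwo] :
      aeval x (OfNat.ofNat n : ℚ[X]) = OfNat.ofNat n := map_ofNat _ n
  rw [pullback_curveD]
  fin_cases i
  · refine ⟨conicCoverZero.isCurve_span, conicCoverZero.genus_span,
      conicCoverZero.isCurve_coverIdeal, conicCoverZero.genus_coverIdeal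
        isCoprime_quartic_zero_reverse ?_ ?_⟩
    · have : (-351 * X ^ 4 - 348 * X ^ 3 + 114 * X ^ 2 + 60 * X - 15 : ℚ[X]).natDegree = 4 := by
        compute_degree!
      omega
    · intro E _ _ s hs
      simp only [conicCoverZero, map_add, map_sub, map_mul, map_pow, map_neg, hC, aeval_X]
      field_simp
      ring
  · refine ⟨conicCoverOne.isCurve_span, conicCoverOne.genus_span,
      conicCoverOne.isCurve_coverIdeal, conicCoverOne.genus_coverIdeal
        isCoprime_quartic_one_reverse ?_ ?_⟩
    · have : (-135 * X ^ 4 + 36 * X ^ 3 + 138 * X ^ 2 + 12 * X - 15 : ℚ[X]).natDegree = 4 := by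
        compute_degree!
      omega
    · intro E _ _ s hs
      simp only [conicCoverOne, map_add, map_sub, map_mul, map_pow, map_neg, hC, aeval_X]
      field_simp
      ring
  · refine ⟨conicCoverTwo.isCurve_span, conicCoverTwo.genus_span,
      conicCoverTwo.isCurve_coverIdeal, conicCoverTwo.genus_coverIdeal
        isCoprime_quartic_two_reverse ?_ ?_⟩
    · have : (81 * X ^ 4 - 144 * X ^ 3 - 42 * X ^ 2 + 48 * X + 9 : ℚ[X]).natDegree = 4 := by
        compute_degree!
      omega
    · intro E _ _ s hs
      simp only [conicCoverTwo, map_add, map_sub, map_mul, map_pow, hC, aeval_X]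
      field_simp
      ring

end Exotic

/-! ### Points of infinite order -/

namespace WeierstrassCurve.Affine

theorem sq_two_mul_add_eq {F : Type*} [Field F] {W : Affine F} {x y : F} (h : W.Equation x y) :
    (2 * y + W.a₁ * x + W.a₃) ^ 2 = 4 * x ^ 3 + W.b₂ * x ^ 2 + 2 * W.b₄ * x + W.b₆ := by
  rw [equation_iff'] at h
  simp only [WeierstrassCurve.b₂, WeierstrassCurve.b₄, WeierstrassCurve.b₆]
  linear_combination 4 * h

/-- The duplication formula for the `x`-coordinate. -/
theorem addX_self_mul {F : Type*} [Field F] [DecidableEq F] {W : Affine F} {x y : F}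
    (h : W.Equation x y) (hy : y ≠ W.negY x y) :
    W.addX x x (W.slope x x y y) * (4 * x ^ 3 + W.b₂ * x ^ 2 + 2 * W.b₄ * x + W.b₆)
      = x ^ 4 - W.b₄ * x ^ 2 - 2 * W.b₆ * x - W.b₈ := by
  rw [← sq_two_mul_add_eq h, slope_of_Y_ne rfl hy]
  have hw : y - W.negY x y = 2 * y + W.a₁ * x + W.a₃ := by
    rw [negY]
    ring
  have hw0 : 2 * y + W.a₁ * x + W.a₃ ≠ 0 := hw ▸ sub_ne_zero.mpr hy
  rw [equation_iff'] at h
  rw [hw]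
  have hℓ := div_mul_cancel₀ (3 * x ^ 2 + 2 * W.a₂ * x + W.a₄ - W.a₁ * y) hw0
  generalize (3 * x ^ 2 + 2 * W.a₂ * x + W.a₄ - W.a₁ * y) / (2 * y + W.a₁ * x + W.a₃) = ℓ at hℓ
  simp only [addX, WeierstrassCurve.b₄, WeierstrassCurve.b₆, WeierstrassCurve.b₈]
  linear_combination (ℓ * (2 * y + W.a₁ * x + W.a₃) + (3 * x ^ 2 + 2 * W.a₂ * x + W.a₄ - W.a₁ * y)
      + W.a₁ * (2 * y + W.a₁ * x + W.a₃)) * hℓ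
    - (W.a₁ ^ 2 + 4 * W.a₂ + 8 * x) * h

end WeierstrassCurve.Affine

/-- `x` is a rational number of `2`-adic valuation `-m`. -/
def HasTwoAdicPole (m : ℕ) (x : ℚ) : Prop :=
  ∃ a d : ℤ, Odd a ∧ Odd d ∧ x * (2 ^ m * d) = a

theorem HasTwoAdicPole.unique {m m' : ℕ} {x : ℚ} (h : HasTwoAdicPole m x)
    (h' : HasTwoAdicPole m' x) : m = m' := by
  wlog hle : m ≤ m' generalizing m m'
  · exact (this h' h (le_of_not_ge hle)).symm
  obtain ⟨a, d, ha, hd, h⟩ := h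
  obtain ⟨a', d', ha', hd', h'⟩ := h'
  obtain ⟨j, rfl⟩ := Nat.exists_eq_add_of_le hle
  have key : a' * d = a * d' * 2 ^ j := by
    have : (a' * d : ℚ) = a * d' * 2 ^ j := by
      rw [← h, ← h', pow_add]
      ring
    exact_mod_cast this
  rcases j with _ | j
  · rfl
  · have h1 : Odd (a' * d) := ha'.mul hd
    rw [key, pow_succ, ← mul_assoc] at h1
    exact absurd (Int.even_mul.mpr (Or.inr even_two)) (Int.not_even_iff_odd.mpr h1)

/-- Near the origin of the `2`-adic points, doubling lowers the valuation of `x` by two. -/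
theorem HasTwoAdicPole.double {b₂ b₄ b₆ b₈ : ℤ} {k : ℕ} {x x' : ℚ} (hx : HasTwoAdicPole (k + 3) x) :
    4 * x ^ 3 + b₂ * x ^ 2 + 2 * b₄ * x + b₆ ≠ 0 ∧
    (x' * (4 * x ^ 3 + b₂ * x ^ 2 + 2 * b₄ * x + b₆) = x ^ 4 - b₄ * x ^ 2 - 2 * b₆ * x - b₈ →
      HasTwoAdicPole (k + 2 + 3) x') := by
  obtain ⟨a, d, ha, hd, hx⟩ := hx
  obtain ⟨n, hn⟩ : ∃ n : ℤ, n = a ^ 4 + 2 * (-32 * b₄ * a ^ 2 * (2 ^ k * d) ^ 2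
    - 2 ^ 9 * b₆ * a * (2 ^ k * d) ^ 3 - 2 ^ 11 * b₈ * (2 ^ k * d) ^ 4) := ⟨_, rfl⟩
  obtain ⟨e, he⟩ : ∃ e : ℤ, e = a ^ 3 + 2 * (b₂ * a ^ 2 * (2 ^ k * d)
    + 16 * b₄ * a * (2 ^ k * d) ^ 2 + 64 * b₆ * (2 ^ k * d) ^ 3) := ⟨_, rfl⟩
  have hnodd : Odd n := hn ▸ (ha.pow).add_even (even_two_mul _)
  have heodd : Odd e := he ▸ (ha.pow).add_even (even_two_mul _)
  have h2k : (2 : ℚ) ^ k * d ≠ 0 := by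
    refine mul_ne_zero (by positivity) ?_
    rintro h
    rw [Int.cast_eq_zero] at h
    simp [h] at hd
  rw [show (2 : ℚ) ^ (k + 3) * d = 8 * (2 ^ k * d) by ring] at hx
  have he' : (4 * x ^ 3 + b₂ * x ^ 2 + 2 * b₄ * x + b₆) * (128 * (2 ^ k * d) ^ 3) = e := by
    rw [he]
    push_cast
    rw [← hx]
    ring
  have hn' : (x ^ 4 - b₄ * x ^ 2 - 2 * b₆ * x - b₈) * (8 * (2 ^ k * d)) ^ 4 = n := by
    rw [hn]
    push_cast
    rw [← hx]
    ring
  refine ⟨fun h0 => ?_, fun h => ⟨n, d * e, hnodd, hd.mul heodd, ?_⟩⟩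
  · rw [h0, zero_mul] at he'
    rw [show e = 0 by exact_mod_cast he'.symm] at heodd
    simp at heodd
  · push_cast
    rw [← hn', ← h, ← he']
    ring

namespace WeierstrassCurve

/-- If an integral Weierstrass curve has a rational point whose `x`-coordinate has `2`-adic
valuation at most `-3`, then the points `2ⁿ P` have pairwise distinct `x`-coordinates. -/
theorem exists_double_sequence (W : WeierstrassCurve ℤ) {k : ℕ} {x y : ℚ}
    (h : (W.map (Int.castRingHom ℚ)).toAffine.Nonsingular x y) (hx : HasTwoAdicPole (k + 3) x)
    (n : ℕ) : ∃ (x' y' : ℚ) (h' : (W.map (Int.castRingHom ℚ)).toAffine.Nonsingular x' y'),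
      2 ^ n • Affine.Point.some x y h = Affine.Point.some x' y' h' ∧
      HasTwoAdicPole (k + 2 * n + 3) x' := by
  induction n with
  | zero => exact ⟨x, y, h, by simp, hx⟩
  | succ n ih =>
    obtain ⟨x', y', h', heq, hx'⟩ := ih
    have hb₂ : (W.map (Int.castRingHom ℚ)).toAffine.b₂ = W.b₂ := map_b₂ ..
    have hb₄ : (W.map (Int.castRingHom ℚ)).toAffine.b₄ = W.b₄ := map_b₄ ..
    have hb₆ : (W.map (Int.castRingHom ℚ)).toAffine.b₆ = W.b₆ := map_b₆ ..
    have hb₈ : (W.map (Int.castRingHom ℚ)).toAffine.b₈ = W.b₈ := map_b₈ ..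
    have hy : y' ≠ (W.map (Int.castRingHom ℚ)).toAffine.negY x' y' := by
      intro hy
      apply (hx'.double (x' := 0) (b₂ := W.b₂) (b₄ := W.b₄) (b₆ := W.b₆) (b₈ := W.b₈)).1
      rw [← hb₂, ← hb₄, ← hb₆, ← Affine.sq_two_mul_add_eq h'.1]
      rw [Affine.negY] at hy
      have : 2 * y' + (W.map (Int.castRingHom ℚ)).toAffine.a₁ * x'
          + (W.map (Int.castRingHom ℚ)).toAffine.a₃ = 0 := by linear_combination hy
      rw [this]
      norm_num
    have hdouble := Affine.Point.add_self_of_Y_ne (h₁ := h') hy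
    rw [← two_nsmul, ← heq, ← mul_nsmul, ← pow_succ] at hdouble
    refine ⟨_, _, _, hdouble,
      (hx'.double (b₂ := W.b₂) (b₄ := W.b₄) (b₆ := W.b₆) (b₈ := W.b₈)).2 ?_⟩
    rw [← hb₂, ← hb₄, ← hb₆, ← hb₈]
    exact Affine.addX_self_mul h'.1 hy

theorem infinite_setOf_equation (W : WeierstrassCurve ℤ) {k : ℕ} {x y : ℚ}
    (h : (W.map (Int.castRingHom ℚ)).toAffine.Nonsingular x y) (hx : HasTwoAdicPole (k + 3) x) :
    {x' : ℚ | ∃ y', (W.map (Int.castRingHom ℚ)).toAffine.Equation x' y'}.Infinite := by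
  choose x' y' h' _ hx' using W.exists_double_sequence h hx
  refine Set.infinite_of_injective_forall_mem (f := x') (fun m n hmn => ?_)
    fun n => ⟨y' n, (h' n).1⟩
  have := (hmn ▸ hx' m).unique (hx' n)
  omega

theorem one_le_rank_point (W : WeierstrassCurve ℤ) {k : ℕ} {x y : ℚ}
    (h : (W.map (Int.castRingHom ℚ)).toAffine.Nonsingular x y) (hx : HasTwoAdicPole (k + 3) x) :
    1 ≤ Module.rank ℤ (W.map (Int.castRingHom ℚ)).toAffine.Point := by
  choose x' y' h' heq hx' using W.exists_double_sequence h hx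
  set P := Affine.Point.some x y h
  have hinj : Function.Injective fun n : ℕ => 2 ^ n • P := by
    intro m n hmn
    simp only [heq, Affine.Point.some.injEq] at hmn
    have := (hmn.1 ▸ hx' m).unique (hx' n)
    omega
  have hfin : ¬ IsOfFinAddOrder P := by
    intro hP
    have hmem (n : ℕ) : 2 ^ n • P ∈ (AddSubmonoid.multiples P : Set _) := ⟨2 ^ n, rfl⟩
    exact Set.infinite_of_injective_forall_mem hinj hmem (finite_multiples.mpr hP)
  have hli : LinearIndependent ℤ fun _ : Unit => P := by
    rw [Fintype.linearIndependent_iff]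
    intro g hg i
    by_contra hne
    refine hfin (isOfFinAddOrder_iff_zsmul_eq_zero.mpr ⟨g (), hne, ?_⟩)
    simpa using hg
  simpa using hli.cardinal_le_rank

end WeierstrassCurve

namespace Exotic

/-- The integral models of the curves `Eᵢ`. -/
def curveEInt : Fin 3 → WeierstrassCurve ℤ :=
  ![⟨0, 0, 0, -2892, -59024⟩, ⟨0, 0, 0, -876, -9520⟩, ⟨1, -1, 1, -41, 96⟩]

theorem map_curveEInt (i : Fin 3) : (curveEInt i).map (Int.castRingHom ℚ) = curveE i := by
  fin_cases i <;> ext <;> simp [curveEInt, curveE]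

theorem exists_point_hasTwoAdicPole (i : Fin 3) : ∃ (k : ℕ) (x y : ℚ),
    ((curveEInt i).map (Int.castRingHom ℚ)).toAffine.Nonsingular x y ∧
      HasTwoAdicPole (k + 3) x := by
  have hE : ∀ i x y, (curveE i).toAffine.Equation x y → (curveE i).toAffine.Nonsingular x y := by
    intro i x y
    have := isElliptic_curveE i
    exact WeierstrassCurve.Affine.equation_iff_nonsingular.mp
  rw [map_curveEInt]
  fin_cases i
  · refine ⟨1, 27609 / 400, -2119523 / 8000, hE _ _ _ ?_, 27609, 25, by decide, by decide,
      by norm_num⟩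
    rw [WeierstrassCurve.Affine.equation_iff']
    norm_num [curveE]
  · refine ⟨1, 884729433155681 / 6685637635600, -25593591021206391940079 / 17286785808865496000,
      hE _ _ _ ?_, 884729433155681, 417852352225, by decide, by decide, by norm_num⟩
    rw [WeierstrassCurve.Affine.equation_iff']
    norm_num [curveE]
  · refine ⟨3, 8121 / 1600, -101151 / 64000, hE _ _ _ ?_, 8121, 25, by decide, by decide,
      by norm_num⟩
    rw [WeierstrassCurve.Affine.equation_iff']
    norm_num [curveE]

theorem one_le_rank_curveE (i : Fin 3) : 1 ≤ Module.rank ℤ (curveE i).toAffine.Point := by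
  obtain ⟨k, x, y, h, hx⟩ := exists_point_hasTwoAdicPole i
  have := (curveEInt i).one_le_rank_point h hx
  rwa [map_curveEInt] at this

end Exotic

/-! ### Exotic quintuples from points of the surface -/

namespace Exotic

/-- Regularity of a quadruple expresses `4 (a b + 1) (c d + 1)` as a square. -/
theorem IsRegular.isSquare {a b c d : ℚ} (h : IsRegular a b c d) (hab : IsSquare (a * b + 1))
    (hab0 : a * b + 1 ≠ 0) : IsSquare (c * d + 1) := by
  obtain ⟨w, hw⟩ := hab
  have hw0 : w ≠ 0 := by
    rintro rfl
    exact hab0 (by rw [hw, mul_zero])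
  rw [IsRegular, hw] at h
  refine ⟨(a + b - c - d) / (2 * w), ?_⟩
  field_simp
  linear_combination -h

theorem forall_pairs_of_symm {R : ℚ → ℚ → Prop} (hR : ∀ x y, R x y → R y x) {a b c d e : ℚ}
    (hab : R a b) (hac : R a c) (had : R a d) (hae : R a e) (hbc : R b c) (hbd : R b d)
    (hbe : R b e) (hcd : R c d) (hce : R c e) (hde : R d e) :
    ∀ x ∈ ({a, b, c, d, e} : Finset ℚ), ∀ y ∈ ({a, b, c, d, e} : Finset ℚ), x ≠ y → R x y := by
  intro x hx y hy hxy
  simp only [Finset.mem_insert, Finset.mem_singleton] at hx hy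
  rcases hx with rfl | rfl | rfl | rfl | rfl <;> rcases hy with rfl | rfl | rfl | rfl | rfl <;>
    first
    | exact absurd rfl hxy
    | assumption
    | exact hR _ _ (by assumption)

/-- The quintuples `{k₁ k₂ p, k₁ / (k₂ p), k₂ / (k₁ p), p / (k₁ k₂), e}`: the products of two of the
first four elements are the squares of `p`, `k₁`, `k₂` and of their inverses, and the relation
between `p`, `k₁` and `k₂` makes both quadruples regular. -/
theorem isExoticQuintuple_of_sq {p k₁ k₂ a b c d e : ℚ} (hp0 : p ≠ 0) (hk₁0 : k₁ ≠ 0)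
    (hk₂0 : k₂ ≠ 0) (hp : IsSquare (p ^ 2 + 1)) (hk₁ : IsSquare (k₁ ^ 2 + 1))
    (hk₂ : IsSquare (k₂ ^ 2 + 1))
    (hrel : (k₁ + k₂) ^ 2 = 4 * p ^ 2 * (p ^ 2 + 1) * (1 - k₁ * k₂) ^ 2)
    (ha : a = k₁ * k₂ * p) (hb : b = k₁ / (k₂ * p)) (hc : c = k₂ / (k₁ * p))
    (hd : d = p / (k₁ * k₂)) (he : e = a + d - (2 * p + 1 / p)) (he0 : e ≠ 0)
    (hae : IsSquare (a * e)) (hab' : a ≠ b) (hac' : a ≠ c) (had' : a ≠ d) (hae' : a ≠ e)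
    (hbc' : b ≠ c) (hbd' : b ≠ d) (hbe' : b ≠ e) (hcd' : c ≠ d) (hce' : c ≠ e) (hde' : d ≠ e) :
    IsExoticQuintuple {a, b, c, d, e} := by
  have ha0 : a ≠ 0 := by rw [ha]; positivity
  have hb0 : b ≠ 0 := by rw [hb]; positivity
  have hc0 : c ≠ 0 := by rw [hc]; positivity
  have hd0 : d ≠ 0 := by rw [hd]; positivity
  have hab : a * b = k₁ ^ 2 := by rw [ha, hb]; field_simp
  have hac : a * c = k₂ ^ 2 := by rw [ha, hc]; field_simp
  have had : a * d = p ^ 2 := by rw [ha, hd]; field_simp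
  have hbc : b * c = (1 / p) ^ 2 := by rw [hb, hc]; field_simp
  have hbd : b * d = (1 / k₂) ^ 2 := by rw [hb, hd]; field_simp
  have hcd : c * d = (1 / k₁) ^ 2 := by rw [hc, hd]; field_simp
  have hinv : ∀ {x : ℚ}, x ≠ 0 → IsSquare (x ^ 2 + 1) → IsSquare ((1 / x) ^ 2 + 1) := by
    rintro x hx ⟨w, hw⟩
    refine ⟨w / x, ?_⟩
    field_simp
    linear_combination hw
  have hmul : ∀ x : ℚ, IsSquare (a * x) → IsSquare (x * e) := by
    rintro x ⟨w, hw⟩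
    obtain ⟨z, hz⟩ := hae
    refine ⟨w * z / a, ?_⟩
    field_simp
    linear_combination (a * e) * hw + w ^ 2 * hz
  have hr₁ : IsRegular a b d e := by
    have : (a + b - d - e) ^ 2 - 4 * (a * b + 1) * (d * e + 1)
        = ((k₁ + k₂) ^ 2 - 4 * p ^ 2 * (p ^ 2 + 1) * (1 - k₁ * k₂) ^ 2) / (p ^ 2 * k₂ ^ 2) := by
      rw [he, ha, hb, hd]
      field_simp
      ring
    rw [hrel, sub_self, zero_div] at this
    exact sub_eq_zero.mp this
  have hr₂ : IsRegular a c d e := by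
    have : (a + c - d - e) ^ 2 - 4 * (a * c + 1) * (d * e + 1)
        = ((k₁ + k₂) ^ 2 - 4 * p ^ 2 * (p ^ 2 + 1) * (1 - k₁ * k₂) ^ 2) / (p ^ 2 * k₁ ^ 2) := by
      rw [he, ha, hc, hd]
      field_simp
      ring
    rw [hrel, sub_self, zero_div] at this
    exact sub_eq_zero.mp this
  have sab : IsSquare (a * b + 1) := hab ▸ hk₁
  have sac : IsSquare (a * c + 1) := hac ▸ hk₂
  have sad : IsSquare (a * d + 1) := had ▸ hp
  have sbc : IsSquare (b * c + 1) := hbc ▸ hinv hp0 hp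
  have sbd : IsSquare (b * d + 1) := hbd ▸ hinv hk₂0 hk₂
  have scd : IsSquare (c * d + 1) := hcd ▸ hinv hk₁0 hk₁
  have sde : IsSquare (d * e + 1) := hr₁.isSquare sab (by rw [hab]; positivity)
  have sae : IsSquare (a * e + 1) := by
    have h : IsRegular b d a e := by
      unfold IsRegular at *
      linear_combination hr₁
    exact h.isSquare sbd (by rw [hbd]; positivity)
  have sbe : IsSquare (b * e + 1) := by
    have h : IsRegular a d b e := by
      unfold IsRegular at *
      linear_combination hr₁
    exact h.isSquare sad (by rw [had]; positivity)
  have sce : IsSquare (c * e + 1) := by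
    have h : IsRegular a d c e := by
      unfold IsRegular at *
      linear_combination hr₂
    exact h.isSquare sad (by rw [had]; positivity)
  refine ⟨?_, ⟨?_, ?_⟩, ⟨a, b, c, d, e, rfl, ?_, hr₁, hr₂⟩, ?_⟩
  · rw [Finset.card_insert_of_notMem (by simp [hab', hac', had', hae']),
      Finset.card_insert_of_notMem (by simp [hbc', hbd', hbe']),
      Finset.card_insert_of_notMem (by simp [hcd', hce']),
      Finset.card_insert_of_notMem (by simp [hde']), Finset.card_singleton]
  · simp only [Finset.mem_insert, Finset.mem_singleton, not_or]
    exact ⟨ha0.symm, hb0.symm, hc0.symm, hd0.symm, he0.symm⟩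
  · exact forall_pairs_of_symm (R := fun x y => IsSquare (x * y + 1))
      (fun x y h => by rwa [mul_comm]) sab sac sad sae sbc sbd sbe scd sce sde
  · rw [ha, hb, hc, hd]
    field_simp
  · have hsq : ∀ x : ℚ, IsSquare (x ^ 2) := IsSquare.sq
    exact forall_pairs_of_symm (R := fun x y => IsSquare (x * y))
      (fun x y h => by rwa [mul_comm]) (hab ▸ hsq _) (hac ▸ hsq _) (had ▸ hsq _) hae (hbc ▸ hsq _)
      (hbd ▸ hsq _) (hmul b (hab ▸ hsq _)) (hcd ▸ hsq _) (hmul c (hac ▸ hsq _))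
      (hmul d (had ▸ hsq _))

/-- A rational point `(r, t, y)` of `S` gives an exotic quintuple, unless it degenerates. -/
theorem isExoticQuintuple_of_branchPoly {r t p k₁ T k₂ a b c d e : ℚ} (hr : r ≠ 0)
    (ht : 1 - t ^ 2 ≠ 0) (hpr : p = (1 - r ^ 2) / (2 * r)) (hk₁t : k₁ = 2 * t / (1 - t ^ 2))
    (hTr : T = (1 - r ^ 4) / (2 * r ^ 2)) (hT : 1 + T * k₁ ≠ 0) (hk₂T : k₂ = (T - k₁) / (1 + T * k₁))
    (hp0 : p ≠ 0) (hk₁0 : k₁ ≠ 0) (hk₂0 : k₂ ≠ 0)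
    (hbr : IsSquare (MvPolynomial.aeval ![r, t] branchPoly))
    (ha : a = k₁ * k₂ * p) (hb : b = k₁ / (k₂ * p)) (hc : c = k₂ / (k₁ * p))
    (hd : d = p / (k₁ * k₂)) (he : e = a + d - (2 * p + 1 / p)) (he0 : e ≠ 0)
    (hab' : a ≠ b) (hac' : a ≠ c) (had' : a ≠ d) (hae' : a ≠ e)
    (hbc' : b ≠ c) (hbd' : b ≠ d) (hbe' : b ≠ e) (hcd' : c ≠ d) (hce' : c ≠ e) (hde' : d ≠ e) :
    IsExoticQuintuple {a, b, c, d, e} := by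
  have hk₂T' : k₂ * (1 + T * k₁) = T - k₁ := by rw [hk₂T, div_mul_cancel₀ _ hT]
  have hrel : k₁ + k₂ = T * (1 - k₁ * k₂) := by linear_combination hk₂T'
  have hTp : T ^ 2 = 4 * p ^ 2 * (p ^ 2 + 1) := by
    rw [hTr, hpr]
    field_simp
    ring
  refine isExoticQuintuple_of_sq hp0 hk₁0 hk₂0 ⟨(1 + r ^ 2) / (2 * r), ?_⟩
    ⟨(1 + t ^ 2) / (1 - t ^ 2), ?_⟩
    ⟨(1 + r ^ 4) / (2 * r ^ 2) * ((1 + t ^ 2) / (1 - t ^ 2)) / (1 + T * k₁), ?_⟩ ?_ ha hb hc hd he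
    he0 ?_ hab' hac' had' hae' hbc' hbd' hbe' hcd' hce' hde'
  · rw [hpr]
    field_simp
    ring
  · rw [hk₁t]
    field_simp
    ring
  · have h1 : k₁ ^ 2 + 1 = ((1 + t ^ 2) / (1 - t ^ 2)) ^ 2 := by
      rw [hk₁t]
      field_simp
      ring
    have h2 : T ^ 2 + 1 = ((1 + r ^ 4) / (2 * r ^ 2)) ^ 2 := by
      rw [hTr]
      field_simp
      ring
    have h3 : k₂ ^ 2 + 1 = (T ^ 2 + 1) * (k₁ ^ 2 + 1) / (1 + T * k₁) ^ 2 := by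
      rw [eq_div_iff (pow_ne_zero 2 hT)]
      linear_combination (k₂ * (1 + T * k₁) + T - k₁) * hk₂T'
    rw [h3, h1, h2, ← mul_pow, ← div_pow, sq]
  · rw [hrel, mul_pow, hTp]
  · set D := 2 * r ^ 2 * (1 - t ^ 2) + 2 * t * (1 - r ^ 4) with hD
    have hDT : (1 + T * k₁) * (2 * r ^ 2 * (1 - t ^ 2)) = D := by
      rw [hTr, hk₁t, hD]
      field_simp
    have hD0 : D ≠ 0 := by
      rw [← hDT]
      positivity
    have hk₂D : k₂ = ((1 - r ^ 4) * (1 - t ^ 2) - 4 * t * r ^ 2) / D := by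
      rw [eq_div_iff hD0, ← hDT, ← mul_assoc, hk₂T', hTr, hk₁t]
      field_simp
      ring
    have h1 : a * e = p ^ 2 * (1 - k₁ * k₂) ^ 2 - k₁ * k₂ := by
      rw [he, ha, hd]
      field_simp
      ring
    have h2 : a * e * ((1 - t ^ 2) * D) ^ 2 = MvPolynomial.aeval ![r, t] branchPoly := by
      rw [h1, aeval_branchPoly, hk₂D, hpr, hk₁t]
      field_simp
      rw [hD]
      ring
    obtain ⟨w, hw⟩ := hbr
    refine ⟨w / ((1 - t ^ 2) * D), ?_⟩
    rw [div_mul_div_comm, ← hw, ← h2]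
    field_simp

end Exotic

/-! ### Rational functions with finitely many zeros -/

/-- The function `f` is given by a rational function without pole at `x`, wherever the denominator
of a suitable representation does not vanish. -/
def IsRationalRegularAt {K : Type*} [Field K] (x : K) (f : K → K) : Prop :=
  ∃ n d : K[X], d.eval x ≠ 0 ∧ ∀ s, d.eval s ≠ 0 → f s = n.eval s / d.eval s

namespace IsRationalRegularAt

variable {K : Type*} [Field K] {x : K} {f g : K → K}

theorem polynomial (p : K[X]) : IsRationalRegularAt x fun s => p.eval s :=
  ⟨p, 1, by simp, fun s _ => by simp⟩

theorem const (c : K) : IsRationalRegularAt x fun _ => c := by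
  simpa using polynomial (x := x) (C c)

theorem id : IsRationalRegularAt x fun s => s := by
  simpa using polynomial (x := x) X

theorem add (hf : IsRationalRegularAt x f) (hg : IsRationalRegularAt x g) :
    IsRationalRegularAt x fun s => f s + g s := by
  obtain ⟨n, d, hd, hf⟩ := hf
  obtain ⟨n', d', hd', hg⟩ := hg
  refine ⟨n * d' + n' * d, d * d', by simp [hd, hd'], fun s hs => ?_⟩
  rw [eval_mul] at hs
  beta_reduce
  rw [hf s (left_ne_zero_of_mul hs), hg s (right_ne_zero_of_mul hs),
    div_add_div _ _ (left_ne_zero_of_mul hs) (right_ne_zero_of_mul hs)]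
  simp [mul_comm]

theorem mul (hf : IsRationalRegularAt x f) (hg : IsRationalRegularAt x g) :
    IsRationalRegularAt x fun s => f s * g s := by
  obtain ⟨n, d, hd, hf⟩ := hf
  obtain ⟨n', d', hd', hg⟩ := hg
  refine ⟨n * n', d * d', by simp [hd, hd'], fun s hs => ?_⟩
  rw [eval_mul] at hs
  beta_reduce
  rw [hf s (left_ne_zero_of_mul hs), hg s (right_ne_zero_of_mul hs), div_mul_div_comm]
  simp

theorem sub (hf : IsRationalRegularAt x f) (hg : IsRationalRegularAt x g) :
    IsRationalRegularAt x fun s => f s - g s := by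
  simpa [sub_eq_add_neg] using hf.add ((const (-1)).mul hg)

theorem div (hf : IsRationalRegularAt x f) (hg : IsRationalRegularAt x g) (hx : g x ≠ 0) :
    IsRationalRegularAt x fun s => f s / g s := by
  obtain ⟨n, d, hd, hf⟩ := hf
  obtain ⟨n', d', hd', hg⟩ := hg
  rw [hg x hd', div_ne_zero_iff] at hx
  refine ⟨n * (d' * d'), d * (n' * d'), by simp [hd, hd', hx.1], fun s hs => ?_⟩
  simp only [eval_mul] at hs ⊢
  have h1 := left_ne_zero_of_mul hs
  have h2 := left_ne_zero_of_mul (right_ne_zero_of_mul hs)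
  have h3 := right_ne_zero_of_mul (right_ne_zero_of_mul hs)
  rw [hf s h1, hg s h3]
  field_simp

theorem pow (hf : IsRationalRegularAt x f) (n : ℕ) : IsRationalRegularAt x fun s => f s ^ n := by
  induction n with
  | zero => simpa using const 1
  | succ n ih => simpa [pow_succ] using ih.mul hf

theorem finite_setOf_eq_zero (hf : IsRationalRegularAt x f) (hx : f x ≠ 0) :
    {s | f s = 0}.Finite := by
  classical
  obtain ⟨n, d, hd, hf⟩ := hf
  rw [hf x hd, div_ne_zero_iff] at hx
  have hnd : n * d ≠ 0 := fun h => mul_ne_zero hx.1 hd (by rw [← eval_mul, h, eval_zero])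
  refine ((n * d).roots.toFinset.finite_toSet).subset fun s hs => ?_
  rw [Finset.mem_coe, Multiset.mem_toFinset, mem_roots hnd, IsRoot.def, eval_mul]
  by_cases h : d.eval s = 0
  · rw [h, mul_zero]
  · have h0 := hf s h
    rw [hs, eq_comm, div_eq_zero_iff, or_iff_left h] at h0
    rw [h0, zero_mul]

end IsRationalRegularAt

/-! ### Infinitely many exotic quintuples -/

namespace Exotic

/-- The coordinate `r` on `D₁` as a function of the parameter `s`. -/
def rParam (s : ℚ) : ℚ := (3 + 4 * s - s ^ 2) / (s ^ 2 - 7)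

/-- The coordinate `t` on `D₁` as a function of the parameter `s`. -/
def tParam (s : ℚ) : ℚ := (1 - s ^ 2) / (2 * s + 4)

/-- The square root `p` of the product of the first and the fourth element. -/
def pParam (s : ℚ) : ℚ := (1 - rParam s ^ 2) / (2 * rParam s)

/-- The square root `k₁` of the product of the first two elements. -/
def k₁Param (s : ℚ) : ℚ := 2 * tParam s / (1 - tParam s ^ 2)

/-- A square root `T` of `4 p² (p² + 1)`; regularity amounts to `k₁ + k₂ = T (1 - k₁ k₂)`, through
which `k₁` determines `k₂`. -/
def auxParam (s : ℚ) : ℚ := (1 - rParam s ^ 4) / (2 * rParam s ^ 2)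

/-- The square root `k₂` of the product of the first and the third element. -/
def k₂Param (s : ℚ) : ℚ := (auxParam s - k₁Param s) / (1 + auxParam s * k₁Param s)

/-- The first element of the quintuple with parameter `s`. -/
def aParam (s : ℚ) : ℚ := k₁Param s * k₂Param s * pParam s

/-- The second element of the quintuple with parameter `s`. -/
def bParam (s : ℚ) : ℚ := k₁Param s / (k₂Param s * pParam s)

/-- The third element of the quintuple with parameter `s`. -/
def cParam (s : ℚ) : ℚ := k₂Param s / (k₁Param s * pParam s)

/-- The fourth element of the quintuple with parameter `s`. -/
def dParam (s : ℚ) : ℚ := pParam s / (k₁Param s * k₂Param s)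

/-- The fifth element of the quintuple with parameter `s`. -/
def eParam (s : ℚ) : ℚ := aParam s + dParam s - (2 * pParam s + 1 / pParam s)

/-- The quartic `q` of the model `v² = q(s)` of the pullback of `D₁`. -/
def quarticParam (s : ℚ) : ℚ := -15 * s ^ 4 + 60 * s ^ 3 + 114 * s ^ 2 - 348 * s - 351

theorem isRationalRegularAt_rParam {x : ℚ} (hx : x ^ 2 - 7 ≠ 0) : IsRationalRegularAt x rParam :=
  (((IsRationalRegularAt.const 3).add ((IsRationalRegularAt.const 4).mul .id)).sub
    (IsRationalRegularAt.id.pow 2)).div ((IsRationalRegularAt.id.pow 2).sub (.const 7)) hx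

theorem isRationalRegularAt_pParam {x : ℚ} (hx : x ^ 2 - 7 ≠ 0) (hr : rParam x ≠ 0) :
    IsRationalRegularAt x pParam :=
  ((IsRationalRegularAt.const 1).sub ((isRationalRegularAt_rParam hx).pow 2)).div
    ((IsRationalRegularAt.const 2).mul (isRationalRegularAt_rParam hx))
    (mul_ne_zero two_ne_zero hr)

theorem finite_setOf_pParam_sq_eq (c : ℚ) : {s | pParam s ^ 2 = c}.Finite := by
  -- the values of `p` at `0` and `5` are `-20 / 21` and `-40 / 9`, so one of their squares is not `c`
  obtain ⟨x, hx, hr, hc⟩ : ∃ x : ℚ, x ^ 2 - 7 ≠ 0 ∧ rParam x ≠ 0 ∧ pParam x ^ 2 - c ≠ 0 := by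
    by_cases hc : c = 400 / 441
    · exact ⟨5, by norm_num, by norm_num [rParam], by norm_num [rParam, pParam, hc]⟩
    · refine ⟨0, by norm_num, by norm_num [rParam], fun h => hc ?_⟩
      rw [← sub_eq_zero.mp h]
      norm_num [rParam, pParam]
  refine ((((isRationalRegularAt_pParam hx hr).pow 2).sub
    (.const c)).finite_setOf_eq_zero hc).subset fun s hs => ?_
  exact sub_eq_zero.mpr hs

open Filter in
/-- All but finitely many parameters for which the quartic is a square give exotic quintuples. -/
theorem eventually_isExoticQuintuple : ∀ᶠ s in cofinite, IsSquare (quarticParam s) →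
    pParam s ^ 2 = aParam s * dParam s ∧
      IsExoticQuintuple {aParam s, bParam s, cParam s, dParam s, eParam s} := by
  -- the parameter `0` is nondegenerate (although the quartic is not a square there)
  have hr0 : rParam 0 = -3 / 7 := by norm_num [rParam]
  have ht0 : tParam 0 = 1 / 4 := by norm_num [tParam]
  have hp0 : pParam 0 = -20 / 21 := by norm_num [pParam, hr0]
  have hk₁0 : k₁Param 0 = 8 / 15 := by norm_num [k₁Param, ht0]
  have hT0 : auxParam 0 = 1160 / 441 := by norm_num [auxParam, hr0]
  have hk₂0 : k₂Param 0 = 48 / 55 := by norm_num [k₂Param, hT0, hk₁0]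
  have ha0 : aParam 0 = -512 / 1155 := by norm_num [aParam, hp0, hk₁0, hk₂0]
  have hb0 : bParam 0 = -77 / 120 := by norm_num [bParam, hp0, hk₁0, hk₂0]
  have hc0 : cParam 0 = -189 / 110 := by norm_num [cParam, hp0, hk₁0, hk₂0]
  have hd0 : dParam 0 = -1375 / 672 := by norm_num [dParam, hp0, hk₁0, hk₂0]
  have he0 : eParam 0 = 819 / 1760 := by norm_num [eParam, ha0, hd0, hp0]
  have hden₁ : IsRationalRegularAt (0 : ℚ) fun s => s ^ 2 - 7 :=
    (IsRationalRegularAt.id.pow 2).sub (.const 7)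
  have hden₂ : IsRationalRegularAt (0 : ℚ) fun s => 2 * s + 4 :=
    ((IsRationalRegularAt.const 2).mul .id).add (.const 4)
  have hr : IsRationalRegularAt 0 rParam := isRationalRegularAt_rParam (by norm_num)
  have ht : IsRationalRegularAt 0 tParam :=
    ((IsRationalRegularAt.const 1).sub (IsRationalRegularAt.id.pow 2)).div hden₂ (by norm_num)
  have hp : IsRationalRegularAt 0 pParam :=
    isRationalRegularAt_pParam (by norm_num) (by norm_num [hr0])
  have hden₃ : IsRationalRegularAt 0 fun s => 1 - tParam s ^ 2 :=
    (IsRationalRegularAt.const 1).sub (ht.pow 2)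
  have hk₁ : IsRationalRegularAt 0 k₁Param :=
    ((IsRationalRegularAt.const 2).mul ht).div hden₃ (by norm_num [ht0])
  have hT : IsRationalRegularAt 0 auxParam :=
    ((IsRationalRegularAt.const 1).sub (hr.pow 4)).div
      ((IsRationalRegularAt.const 2).mul (hr.pow 2)) (by norm_num [hr0])
  have hden₄ : IsRationalRegularAt 0 fun s => 1 + auxParam s * k₁Param s :=
    (IsRationalRegularAt.const 1).add (hT.mul hk₁)
  have hk₂ : IsRationalRegularAt 0 k₂Param := (hT.sub hk₁).div hden₄ (by norm_num [hT0, hk₁0])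
  have ha : IsRationalRegularAt 0 aParam := (hk₁.mul hk₂).mul hp
  have hb : IsRationalRegularAt 0 bParam := hk₁.div (hk₂.mul hp) (by norm_num [hk₂0, hp0])
  have hc : IsRationalRegularAt 0 cParam := hk₂.div (hk₁.mul hp) (by norm_num [hk₁0, hp0])
  have hd : IsRationalRegularAt 0 dParam := hp.div (hk₁.mul hk₂) (by norm_num [hk₁0, hk₂0])
  have he : IsRationalRegularAt 0 eParam := (ha.add hd).sub
    (((IsRationalRegularAt.const 2).mul hp).add
      ((IsRationalRegularAt.const 1).div hp (by norm_num [hp0])))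
  have key : ∀ {f : ℚ → ℚ}, IsRationalRegularAt 0 f → f 0 ≠ 0 → ∀ᶠ s in cofinite, f s ≠ 0 :=
    fun hf h0 => by simpa [eventually_cofinite] using hf.finite_setOf_eq_zero h0
  have key' : ∀ {f g : ℚ → ℚ}, IsRationalRegularAt 0 f → IsRationalRegularAt 0 g → f 0 - g 0 ≠ 0 →
      ∀ᶠ s in cofinite, f s ≠ g s := fun hf hg h0 =>
    (key (hf.sub hg) h0).mono fun s hs => sub_ne_zero.mp hs
  filter_upwards [key hden₁ (by norm_num), key hden₂ (by norm_num), key hr (by norm_num [hr0]),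
    key hden₃ (by norm_num [ht0]), key hden₄ (by norm_num [hT0, hk₁0]), key hp (by norm_num [hp0]),
    key hk₁ (by norm_num [hk₁0]), key hk₂ (by norm_num [hk₂0]), key he (by norm_num [he0]),
    key' ha hb (by norm_num [ha0, hb0]), key' ha hc (by norm_num [ha0, hc0]),
    key' ha hd (by norm_num [ha0, hd0]), key' ha he (by norm_num [ha0, he0]),
    key' hb hc (by norm_num [hb0, hc0]), key' hb hd (by norm_num [hb0, hd0]),
    key' hb he (by norm_num [hb0, he0]), key' hc hd (by norm_num [hc0, hd0]),
    key' hc he (by norm_num [hc0, he0]), key' hd he (by norm_num [hd0, he0])]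
    with s h₁ h₂ h₃ h₄ h₅ h₆ h₇ h₈ h₉ hab hac had hae hbc hbd hbe hcd hce hde
  rintro ⟨v, hv⟩
  refine ⟨?_, isExoticQuintuple_of_branchPoly h₃ h₄ rfl rfl rfl h₅ rfl h₆ h₇ h₈ ?_ rfl rfl rfl rfl
    rfl h₉ hab hac had hae hbc hbd hbe hcd hce hde⟩
  · rw [aParam, dParam]
    field_simp
  · have h := aeval_branchPoly_zero h₂ h₁ (t := tParam s) (r := rParam s) rfl rfl
    have hn : s ^ 3 + 2 * s ^ 2 - 7 * s - 14 ≠ 0 := fun h0 =>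
      mul_ne_zero h₂ h₁ (by linear_combination 2 * h0)
    change _ = _ * quarticParam s at h
    rw [hv] at h
    refine ⟨1 / 2 * (s ^ 2 - 2 * s - 5) * (s ^ 5 - s ^ 4 + 2 * s ^ 3 + 14 * s ^ 2 + s - 17) ^ 2 * v
      / (s ^ 3 + 2 * s ^ 2 - 7 * s - 14) ^ 4, ?_⟩
    rw [div_mul_div_comm, eq_div_iff (mul_ne_zero (pow_ne_zero 4 hn) (pow_ne_zero 4 hn)), ← sq, h]
    ring

theorem finite_setOf_sq_eq (c : ℚ) : {v : ℚ | v ^ 2 = c}.Finite := by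
  obtain ⟨x, hx⟩ : ∃ x : ℚ, x ^ 2 - c ≠ 0 := by
    by_cases hc : c = 0
    · exact ⟨1, by norm_num [hc]⟩
    · exact ⟨0, by simpa using hc⟩
  exact (((IsRationalRegularAt.id.pow 2).sub (.const c)).finite_setOf_eq_zero hx).subset
    fun v hv => sub_eq_zero.mpr hv

/-- The birational map from `E₁` to the quartic `v² = q(s)`, with inverse. -/
theorem quarticParam_of_equation {x y ξ η U v : ℚ} (h : y ^ 2 = x ^ 3 - 2892 * x - 59024)
    (hξ : ξ = 4 * x + 52) (hη : η = 8 * y - 112 * x - 736) (hη0 : η ≠ 0)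
    (hU : U * η = 12 * ξ - 11280) (hU0 : U ≠ 0) (hv : v = -6 + U * (U * ξ - 336) / 12) :
    v ^ 2 = quarticParam (3 + U) ∧ x = ((12 * (v + 6) + 336 * U) / U ^ 2 - 52) / 4 := by
  constructor
  · have hW : η ^ 2 + 56 * ξ * η - 1440 * η = ξ ^ 3 - 940 * ξ ^ 2 + 2160 * ξ - 2030400 := by
      rw [hξ, hη]
      linear_combination 64 * h
    have key : η * (U * ξ ^ 2 - 672 * ξ - 12 * η + 17280 + 2160 * U) = 0 := by
      linear_combination (ξ ^ 2 + 2160) * hU - 12 * hW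
    have key' := (mul_eq_zero.mp key).resolve_left hη0
    rw [hv, quarticParam]
    linear_combination U ^ 3 / 144 * key' + U ^ 2 / 12 * hU
  · rw [hv, hξ]
    field_simp
    ring

/-- The quartic takes infinitely many square values, since `E₁` has infinitely many rational
points. -/
theorem infinite_setOf_isSquare_quarticParam : {s | IsSquare (quarticParam s)}.Infinite := by
  intro hfin
  obtain ⟨k, x₀, y₀, h₀, hx₀⟩ := exists_point_hasTwoAdicPole 0
  have hinf := (curveEInt 0).infinite_setOf_equation h₀ hx₀
  rw [map_curveEInt] at hinf
  refine hinf ?_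
  have hroots : {x : ℚ | x ^ 3 - 2892 * x - 59024 - (14 * x + 92) ^ 2 = 0}.Finite := by
    let p : ℚ[X] := X ^ 3 - 2892 * X - 59024 - (14 * X + 92) ^ 2
    have hp (x : ℚ) : p.eval x = x ^ 3 - 2892 * x - 59024 - (14 * x + 92) ^ 2 := by simp [p]
    refine ((IsRationalRegularAt.polynomial p).finite_setOf_eq_zero (x := 0) ?_).subset
      fun x hx => (hp x).trans hx
    norm_num [hp]
  have hpts : (⋃ s ∈ {s | IsSquare (quarticParam s)}, ⋃ v ∈ {v : ℚ | v ^ 2 = quarticParam s},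
      {((12 * (v + 6) + 336 * (s - 3)) / (s - 3) ^ 2 - 52) / 4}).Finite :=
    hfin.biUnion fun s _ => (finite_setOf_sq_eq _).biUnion fun v _ => Set.finite_singleton _
  refine ((hroots.union (Set.finite_singleton 222)).union hpts).subset ?_
  rintro x ⟨y, hxy⟩
  rw [WeierstrassCurve.Affine.equation_iff'] at hxy
  have h : y ^ 2 = x ^ 3 - 2892 * x - 59024 := by
    simp only [curveE, Matrix.cons_val_zero] at hxy
    linear_combination hxy
  obtain ⟨η, hη⟩ : ∃ η, η = 8 * y - 112 * x - 736 := ⟨_, rfl⟩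
  by_cases hη0 : η = 0
  · refine Or.inl (Or.inl ?_)
    have hy : y = 14 * x + 92 := by linear_combination (hη0 - hη) / 8
    rw [Set.mem_ofPred_eq, ← hy, h, sub_self]
  obtain ⟨U, hU⟩ : ∃ U, U = (12 * (4 * x + 52) - 11280) / η := ⟨_, rfl⟩
  have hUη : U * η = 12 * (4 * x + 52) - 11280 := by rw [hU, div_mul_cancel₀ _ hη0]
  by_cases hU0 : U = 0
  · refine Or.inl (Or.inr ?_)
    rw [hU0, zero_mul] at hUη
    rw [Set.mem_singleton_iff]
    linear_combination -hUη / 48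
  obtain ⟨hv, hx⟩ := quarticParam_of_equation h rfl hη hη0 hUη hU0 rfl
  refine Or.inr ?_
  simp only [Set.mem_iUnion]
  refine ⟨3 + U, ⟨_, hv.symm.trans (sq _)⟩, _, hv, ?_⟩
  rw [Set.mem_singleton_iff, add_sub_cancel_left]
  exact hx

theorem infinite_setOf_isExoticQuintuple : {M : Finset ℚ | IsExoticQuintuple M}.Infinite := by
  intro hfin
  have hbad := Filter.eventually_cofinite.mp eventually_isExoticQuintuple
  refine (infinite_setOf_isSquare_quarticParam.sdiff hbad) ?_
  have hcover : (⋃ M ∈ {M : Finset ℚ | IsExoticQuintuple M}, ⋃ x ∈ (M : Set ℚ), ⋃ y ∈ (M : Set ℚ),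
      {s | pParam s ^ 2 = x * y}).Finite :=
    hfin.biUnion fun M _ => M.finite_toSet.biUnion fun x _ => M.finite_toSet.biUnion fun y _ =>
      finite_setOf_pParam_sq_eq _
  refine hcover.subset fun s hs => ?_
  obtain ⟨hsq, hgood⟩ := hs
  rw [Set.mem_ofPred_eq, not_not] at hgood
  obtain ⟨hp, hM⟩ := hgood hsq
  simp only [Set.mem_iUnion]
  exact ⟨_, hM, aParam s, by simp, dParam s, by simp, hp⟩

end Exotic

end

theorem mainTheorem2 :
    (∀ i : Fin 3,
      -- `D_i` is an absolutely irreducible plane curve of genus zero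
      AffineVariety.IsCurve (Exotic.curveD i) ∧
      AffineVariety.genus (Exotic.curveD i) = 0 ∧
      -- its pullback to `S` is an absolutely irreducible curve over `ℚ` of genus one
      AffineVariety.IsCurve (Exotic.pullback (Exotic.curveD i)) ∧
      AffineVariety.genus (Exotic.pullback (Exotic.curveD i)) = 1 ∧
      -- the pullback is birational over `ℚ` to the elliptic curve `E_i`
      (Exotic.curveE i).IsElliptic ∧
      AlgebraicGeometry.Scheme.BirationalOver
        (AffineVariety.structureMap ℚ
          (AffineVariety.CoordRing (Exotic.pullback (Exotic.curveD i))))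
        (AffineVariety.structureMap ℚ (Exotic.curveE i).toAffine.CoordinateRing) ∧
      -- the Mordell–Weil rank of `E_i` over `ℚ` is at least one
      1 ≤ Module.rank ℤ (Exotic.curveE i).toAffine.Point) ∧
    {M : Finset ℚ | Exotic.IsExoticQuintuple M}.Infinite := by
  refine ⟨fun i => ?_, Exotic.infinite_setOf_isExoticQuintuple⟩
  obtain ⟨h1, h2, h3, h4⟩ := Exotic.geometry_curveD i
  exact ⟨h1, h2, h3, h4, Exotic.isElliptic_curveE i, Exotic.birationalOver_pullback_curveD i,
    Exotic.one_le_rank_curveE i⟩
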